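/- Let $J\subset\mathbb R$ and $U\subset\mathbb R^3$ be open, and let $X:J\times U\to\mathbb R^4$ be, in local coordinates $x=(x_1,x_2,x_3)$, a smooth family of immersed hypersurfaces with smooth unit normal $\nu$, metric $g_{ij}=\langle X_{,i},X_{,j}\rangle$ and second fundamental form $h_{ij}=-\langle X_{,ij},\nu\rangle$. Assume that all principal curvatures (the eigenvalues of $(h_{ij})$ with respect to $(g_{ij})$) are positive, so that $\nu$ is the outer normal, and that $\frac{d}{dt}X=-F\nu$. Here $F$ and $w$ are symmetric $C^2$ functions of the principal curvatures on $\mathbb R^3_+$. Indices after a semicolon denote covariant derivatives with respect to $g$. Put $F^{ij}=\partial F/\partial h_{ij}$ and $Lw=\frac{d}{dt}w-F^{ij}w_{;ij}$. Let $(t,x)\in J\times U$ be a point with $w_{;i}=0$ for $i=1,2,3$, at which the coordinates satisfy $g_{ij}=\delta_{ij}$ and $(h_{ij})=\operatorname{diag}(a,b,c)$. Subscripts $a,b,c$ on $F$ and $w$ denote partial derivatives, evaluated at $(a,b,c)$. Any quotient with denominator $a-b$, $a-c$ or $b-c$ is interpreted as a limit (of the whole quotient, as a function of the principal curvatures) where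 its denominator vanishes. For real $p,q,r$ and $f\in\{F,w\}$ write $$Q_f(p,q,r)=f_{aa}p^2+f_{bb}q^2+f_{cc}r^2+2\,(f_{ab}\,pq+f_{ac}\,pr+f_{bc}\,qr).$$ **(i)** At this point $$Lw=C_w+E_w\,h_{12;3}^2+R_w(h_{11;1},h_{22;1},h_{33;1})+S_w(h_{11;2},h_{22;2},h_{33;2})+T_w(h_{11;3},h_{22;3},h_{33;3}),$$ where, with $G=a^2F_a+b^2F_b+c^2F_c$ and $K=F-aF_a-bF_b-cF_c$, $$C_w=a\,w_a(G+aK)+b\,w_b(G+bK)+c\,w_c(G+cK),$$ $$\tfrac12E_w=\tfrac{w_c(F_a-F_b)-F_c(w_a-w_b)}{a-b}+\tfrac{w_b(F_a-F_c)-F_b(w_a-w_c)}{a-c}+\tfrac{w_a(F_b-F_c)-F_a(w_b-w_c)}{b-c},$$ $$\begin{aligned}R_w(p,q,r)=\;&w_aQ_F(p,q,r)+2w_b\tfrac{F_a-F_b}{a-b}q^2+2w_c\tfrac{F_a-F_c}{a-c}r^2\\&-F_aQ_w(p,q,r)-2F_b\tfrac{w_a-w_b}{a-b}q^2-2F_c\tfrac{w_a-w_c}{a-c}r^2,\end{aligned}$$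 $$\begin{aligned}S_w(p,q,r)=\;&2w_a\tfrac{F_a-F_b}{a-b}p^2+w_bQ_F(p,q,r)+2w_c\tfrac{F_b-F_c}{b-c}r^2\\&-2F_a\tfrac{w_a-w_b}{a-b}p^2-F_bQ_w(p,q,r)-2F_c\tfrac{w_b-w_c}{b-c}r^2,\end{aligned}$$ $$\begin{aligned}T_w(p,q,r)=\;&2w_a\tfrac{F_a-F_c}{a-c}p^2+2w_b\tfrac{F_b-F_c}{b-c}q^2+w_cQ_F(p,q,r)\\&-2F_a\tfrac{w_a-w_c}{a-c}p^2-2F_b\tfrac{w_b-w_c}{b-c}q^2-F_cQ_w(p,q,r).\end{aligned}$$ **(ii)** At this point, if $w_a\ne0$, respectively $w_b\neq0$, respectively $w_c\ne0$, then $$h_{11;1}=-\tfrac1{w_a}(w_bh_{22;1}+w_ch_{33;1}),\quad h_{22;2}=-\tfrac1{w_b}(w_ah_{11;2}+w_ch_{33;2}),\quad h_{33;3}=-\tfrac1{w_c}(w_ah_{11;3}+w_bh_{22;3}),$$ and, respectively, $$R_w(h_{11;1},h_{22;1},h_{33;1})=x_1^{\top}M^{R_w}x_1,\quad S_w(h_{11;2},h_{22;2},h_{33;2})=x_2^{\top}M^{S_w}x_2,\quad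 T_w(h_{11;3},h_{22;3},h_{33;3})=x_3^{\top}M^{T_w}x_3$$ with $x_1=\binom{h_{22;1}}{h_{33;1}}$, $x_2=\binom{h_{11;2}}{h_{33;2}}$, $x_3=\binom{h_{11;3}}{h_{22;3}}$, and symmetric $2\times2$ matrices with the following entries. For $M^{R_w}$: $$\begin{aligned} m_{11}&=2\tfrac{F_aw_b-F_bw_a}{a-b}+F_{aa}\tfrac{w_b^2}{w_a}-2F_{ab}w_b+F_{bb}w_a-F_a\Big(w_{aa}\tfrac{w_b^2}{w_a^2}-2w_{ab}\tfrac{w_b}{w_a}+w_{bb}\Big),\\ m_{12}&=F_{aa}\tfrac{w_bw_c}{w_a}-F_{ab}w_c-F_{ac}w_b+F_{bc}w_a-F_a\Big(w_{aa}\tfrac{w_bw_c}{w_a^2}-w_{ab}\tfrac{w_c}{w_a}-w_{ac}\tfrac{w_b}{w_a}+w_{bc}\Big),\\ m_{22}&=2\tfrac{F_aw_c-F_cw_a}{a-c}+F_{aa}\tfrac{w_c^2}{w_a}-2F_{ac}w_c+F_{cc}w_a-F_a\Big(w_{aa}\tfrac{w_c^2}{w_a^2}-2w_{ac}\tfrac{w_c}{w_a}+w_{cc}\Big).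 \end{aligned}$$ For $M^{S_w}$: $$\begin{aligned} m_{11}&=2\tfrac{F_aw_b-F_bw_a}{a-b}+F_{aa}w_b-2F_{ab}w_a+F_{bb}\tfrac{w_a^2}{w_b}-F_b\Big(w_{aa}-2w_{ab}\tfrac{w_a}{w_b}+w_{bb}\tfrac{w_a^2}{w_b^2}\Big),\\ m_{12}&=-F_{ab}w_c+F_{ac}w_b+F_{bb}\tfrac{w_aw_c}{w_b}-F_{bc}w_a-F_b\Big(-w_{ab}\tfrac{w_c}{w_b}+w_{ac}+w_{bb}\tfrac{w_aw_c}{w_b^2}-w_{bc}\tfrac{w_a}{w_b}\Big),\\ m_{22}&=2\tfrac{F_bw_c-F_cw_b}{b-c}+F_{bb}\tfrac{w_c^2}{w_b}-2F_{bc}w_c+F_{cc}w_b-F_b\Big(w_{bb}\tfrac{w_c^2}{w_b^2}-2w_{bc}\tfrac{w_c}{w_b}+w_{cc}\Big). \end{aligned}$$ For $M^{T_w}$: $$\begin{aligned} m_{11}&=2\tfrac{F_aw_c-F_cw_a}{a-c}+F_{aa}w_c-2F_{ac}w_a+F_{cc}\tfrac{w_a^2}{w_c}-F_c\Big(w_{aa}-2w_{ac}\tfrac{w_a}{w_c}+w_{cc}\tfrac{w_a^2}{w_c^2}\Big),\\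 m_{12}&=F_{ab}w_c-F_{ac}w_b-F_{bc}w_a+F_{cc}\tfrac{w_aw_b}{w_c}-F_c\Big(w_{ab}-w_{ac}\tfrac{w_b}{w_c}-w_{bc}\tfrac{w_a}{w_c}+w_{cc}\tfrac{w_aw_b}{w_c^2}\Big),\\ m_{22}&=2\tfrac{F_bw_c-F_cw_b}{b-c}+F_{bb}w_c-2F_{bc}w_b+F_{cc}\tfrac{w_b^2}{w_c}-F_c\Big(w_{bb}-2w_{bc}\tfrac{w_b}{w_c}+w_{cc}\tfrac{w_b^2}{w_c^2}\Big). \end{aligned}$$ -/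

import Mathlib

open Filter
open scoped ContDiff Topology

noncomputable section

namespace CurvatureFlow

/-- The local coordinate space `ℝ³`; also the space of triples `(λ₁, λ₂, λ₃) = (a, b, c)` of
principal curvatures. -/
abbrev Coord : Type := Fin 3 → ℝ

/-- The ambient Euclidean space `ℝ⁴`. -/
abbrev Ambient : Type := EuclideanSpace ℝ (Fin 4)

/-- The partial derivative of `u` in the `k`-th variable. It is used for `u_{,k} = ∂u/∂x_k` in the
space variables as well as for `f_a, f_b, f_c` (`k = 0, 1, 2`) in the principal curvatures. -/
def pd {V : Type*} [NormedAddCommGroup V] [NormedSpace ℝ V] (k : Fin 3) (u : Coord → V)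
    (x : Coord) : V :=
  fderiv ℝ u x (Pi.single k 1)

/-! ### Geometry of a parametrized hypersurface `X : U ⊆ ℝ³ → ℝ⁴` with unit normal `ν` -/

/-- The induced metric `g_{ij} = ⟨X_{,i}, X_{,j}⟩`. -/
def metric (X : Coord → Ambient) (x : Coord) : Matrix (Fin 3) (Fin 3) ℝ :=
  Matrix.of fun i j => inner ℝ (pd i X x) (pd j X x)

/-- The second fundamental form `h_{ij} = -⟨X_{,ij}, ν⟩`. -/
def secondForm (X ν : Coord → Ambient) (x : Coord) : Matrix (Fin 3) (Fin 3) ℝ :=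
  Matrix.of fun i j => -inner ℝ (pd j (pd i X) x) (ν x)

/-- The Christoffel symbols `Γ^k_{ij} = ½ g^{kl} (g_{il,j} + g_{jl,i} - g_{ij,l})`. -/
def christoffel (X : Coord → Ambient) (k i j : Fin 3) (x : Coord) : ℝ :=
  (1 / 2) * ∑ l, (metric X x)⁻¹ k l *
    (pd j (fun y => metric X y i l) x + pd i (fun y => metric X y j l) x
      - pd l (fun y => metric X y i j) x)

/-- The covariant derivative `h_{ij;k} = h_{ij,k} - Γ^l_{ik} h_{lj} - Γ^l_{jk} h_{il}`. -/
def secondFormCov (X ν : Coord → Ambient) (i j k : Fin 3) (x : Coord) : ℝ :=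
  pd k (fun y => secondForm X ν y i j) x
    - ∑ l, christoffel X l i k x * secondForm X ν x l j
    - ∑ l, christoffel X l j k x * secondForm X ν x i l

/-- The second covariant derivative `u_{;ij} = u_{,ij} - Γ^k_{ij} u_{,k}` of a function `u`. -/
def hessianCov (X : Coord → Ambient) (u : Coord → ℝ) (i j : Fin 3) (x : Coord) : ℝ :=
  pd j (pd i u) x - ∑ k, christoffel X k i j x * pd k u x

/-- The eigenvalues of `h` with respect to `g`, i.e. the eigenvalues of `h^i_j = g^{ik} h_{kj}`,
repeated according to multiplicity and listed in increasing order. -/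
def principalCurvatures (g h : Matrix (Fin 3) (Fin 3) ℝ) : Coord :=
  fun i => ((g⁻¹ * h).charpoly.roots.sort (· ≤ ·)).getD i 0

/-- A function `f` of the principal curvatures, regarded as a function of `(g_{ij}, h_{ij})`. -/
def ofForms (f : Coord → ℝ) (g h : Matrix (Fin 3) (Fin 3) ℝ) : ℝ :=
  f (principalCurvatures g h)

/-- `F^{ij} = ∂F/∂h_{ij}`, with the usual convention for functions of symmetric matrices: `F^{ij}`
is the derivative in the direction of the symmetric matrix `(e_{ij} + e_{ji}) / 2`. -/
def derivForm (F : Coord → ℝ) (g h : Matrix (Fin 3) (Fin 3) ℝ) (i j : Fin 3) : ℝ :=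
  deriv (fun s : ℝ => ofForms F g
    (h + s • ((1 / 2 : ℝ) • (Matrix.single i j (1 : ℝ) + Matrix.single j i (1 : ℝ))))) 0

/-- A function `w` of the principal curvatures, evaluated on the hypersurface at `X x`. -/
def onSurface (w : Coord → ℝ) (X ν : Coord → Ambient) (x : Coord) : ℝ :=
  ofForms w (metric X x) (secondForm X ν x)

/-! ### Functions of the principal curvatures and the flow -/

/-- The positive cone `ℝ³₊`. -/
def posCone : Set Coord := {lam | ∀ i, 0 < lam i}

/-- `f` is a symmetric function of class `C²` of positive principal curvatures. -/
structure IsCurvatureFunction (f : Coord → ℝ) : Prop where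
  contDiffOn : ContDiffOn ℝ 2 f posCone
  symm : ∀ σ : Equiv.Perm (Fin 3), ∀ lam ∈ posCone, f (lam ∘ σ) = f lam

/-- In local coordinates `x ∈ U`, for times `t ∈ J`, the hypersurfaces `X t` are smooth, immersed,
strictly convex with respect to the unit normal `ν t` (this makes `ν` the outer normal), and
move by `dX/dt = -F ν`. -/
structure IsFlow (F : Coord → ℝ) (J : Set ℝ) (U : Set Coord) (X ν : ℝ → Coord → Ambient) :
    Prop where
  isOpen_time : IsOpen J
  isOpen_space : IsOpen U
  smooth : ContDiffOn ℝ ∞ (fun p : ℝ × Coord => X p.1 p.2) (J ×ˢ U)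
  smooth_normal : ContDiffOn ℝ ∞ (fun p : ℝ × Coord => ν p.1 p.2) (J ×ˢ U)
  immersion : ∀ t ∈ J, ∀ x ∈ U, LinearIndependent ℝ (fun i => pd i (X t) x)
  unit : ∀ t ∈ J, ∀ x ∈ U, ‖ν t x‖ = 1
  normal : ∀ t ∈ J, ∀ x ∈ U, ∀ i, inner ℝ (pd i (X t) x) (ν t x) = 0
  convex : ∀ t ∈ J, ∀ x ∈ U,
    principalCurvatures (metric (X t) x) (secondForm (X t) (ν t) x) ∈ posCone
  evolution : ∀ t ∈ J, ∀ x ∈ U,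
    HasDerivAt (fun s => X s x) (-(onSurface F (X t) (ν t) x) • ν t x) t

/-- The linear operator `Lw = dw/dt - F^{ij} w_{;ij}`. -/
def linOp (F w : Coord → ℝ) (X ν : ℝ → Coord → Ambient) (t : ℝ) (x : Coord) : ℝ :=
  deriv (fun s => onSurface w (X s) (ν s) x) t
    - ∑ i, ∑ j, derivForm F (metric (X t) x) (secondForm (X t) (ν t) x) i j
        * hessianCov (X t) (onSurface w (X t) (ν t)) i j x

/-! ### The explicit terms -/

open Classical in
/-- The quotient `N / (λ_i - λ_j)` at `lam`, interpreted as a limit where `λ_i = λ_j`. -/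
def quot (i j : Fin 3) (N : Coord → ℝ) (lam : Coord) : ℝ :=
  if lam i = lam j then
    limUnder (𝓝[{μ : Coord | μ i ≠ μ j}] lam) (fun μ => N μ / (μ i - μ j))
  else N lam / (lam i - lam j)

/-- The constant terms `C_w`. -/
def termC (F w : Coord → ℝ) (lam : Coord) : ℝ :=
  let a := lam 0
  let b := lam 1
  let c := lam 2
  let Fa := pd 0 F lam
  let Fb := pd 1 F lam
  let Fc := pd 2 F lam
  let wa := pd 0 w lam
  let wb := pd 1 w lam
  let wc := pd 2 w lam
  a * wa * (a ^ 2 * Fa + b ^ 2 * Fb + c ^ 2 * Fc + a * (F lam - a * Fa - b * Fb - c * Fc))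
    + b * wb * (a ^ 2 * Fa + b ^ 2 * Fb + c ^ 2 * Fc + b * (F lam - a * Fa - b * Fb - c * Fc))
    + c * wc * (a ^ 2 * Fa + b ^ 2 * Fb + c ^ 2 * Fc + c * (F lam - a * Fa - b * Fb - c * Fc))

/-- The coefficient `E_w` of `h_{12;3}²`. -/
def termE (F w : Coord → ℝ) (lam : Coord) : ℝ :=
  2 * (quot 0 1 (fun μ => pd 2 w μ * (pd 0 F μ - pd 1 F μ) - pd 2 F μ * (pd 0 w μ - pd 1 w μ)) lam
    + quot 0 2 (fun μ => pd 1 w μ * (pd 0 F μ - pd 2 F μ) - pd 1 F μ * (pd 0 w μ - pd 2 w μ)) lam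
    + quot 1 2 (fun μ => pd 0 w μ * (pd 1 F μ - pd 2 F μ) - pd 0 F μ * (pd 1 w μ - pd 2 w μ)) lam)

/-- The quadratic form
`f_aa p² + f_bb q² + f_cc r² + 2 (f_ab p q + f_ac p r + f_bc q r)` of second derivatives. -/
def hessForm (f : Coord → ℝ) (lam : Coord) (p q r : ℝ) : ℝ :=
  pd 0 (pd 0 f) lam * p ^ 2 + pd 1 (pd 1 f) lam * q ^ 2 + pd 2 (pd 2 f) lam * r ^ 2
    + 2 * (pd 1 (pd 0 f) lam * p * q + pd 2 (pd 0 f) lam * p * r + pd 2 (pd 1 f) lam * q * r)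

/-- The quotient `(f_i - f_j) / (λ_i - λ_j)`, interpreted as a limit where `λ_i = λ_j`. -/
def diffQuot (i j : Fin 3) (f : Coord → ℝ) (lam : Coord) : ℝ :=
  quot i j (fun μ => pd i f μ - pd j f μ) lam

/-- The gradient terms `R_w`, with `p = h_{11;1}`, `q = h_{22;1}`, `r = h_{33;1}`. -/
def termR (F w : Coord → ℝ) (lam : Coord) (p q r : ℝ) : ℝ :=
  pd 0 w lam * hessForm F lam p q r
    + pd 1 w lam * (2 * diffQuot 0 1 F lam * q ^ 2)
    + pd 2 w lam * (2 * diffQuot 0 2 F lam * r ^ 2)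
    - pd 0 F lam * hessForm w lam p q r
    - pd 1 F lam * (2 * diffQuot 0 1 w lam * q ^ 2)
    - pd 2 F lam * (2 * diffQuot 0 2 w lam * r ^ 2)

/-- The gradient terms `S_w`, with `p = h_{11;2}`, `q = h_{22;2}`, `r = h_{33;2}`. -/
def termS (F w : Coord → ℝ) (lam : Coord) (p q r : ℝ) : ℝ :=
  pd 0 w lam * (2 * diffQuot 0 1 F lam * p ^ 2)
    + pd 1 w lam * hessForm F lam p q r
    + pd 2 w lam * (2 * diffQuot 1 2 F lam * r ^ 2)
    - pd 0 F lam * (2 * diffQuot 0 1 w lam * p ^ 2)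
    - pd 1 F lam * hessForm w lam p q r
    - pd 2 F lam * (2 * diffQuot 1 2 w lam * r ^ 2)

/-- The gradient terms `T_w`, with `p = h_{11;3}`, `q = h_{22;3}`, `r = h_{33;3}`. -/
def termT (F w : Coord → ℝ) (lam : Coord) (p q r : ℝ) : ℝ :=
  pd 0 w lam * (2 * diffQuot 0 2 F lam * p ^ 2)
    + pd 1 w lam * (2 * diffQuot 1 2 F lam * q ^ 2)
    + pd 2 w lam * hessForm F lam p q r
    - pd 0 F lam * (2 * diffQuot 0 2 w lam * p ^ 2)
    - pd 1 F lam * (2 * diffQuot 1 2 w lam * q ^ 2)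
    - pd 2 F lam * hessForm w lam p q r

/-- The quotient `(F_i w_j - F_j w_i) / (λ_i - λ_j)`, interpreted as a limit where
`λ_i = λ_j`. -/
def crossQuot (i j : Fin 3) (F w : Coord → ℝ) (lam : Coord) : ℝ :=
  quot i j (fun μ => pd i F μ * pd j w μ - pd j F μ * pd i w μ) lam

/-- The symmetric matrix `M^{R_w}`. -/
def matR (F w : Coord → ℝ) (lam : Coord) : Matrix (Fin 2) (Fin 2) ℝ :=
  let Fa := pd 0 F lam
  let Faa := pd 0 (pd 0 F) lam
  let Fab := pd 1 (pd 0 F) lam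
  let Fac := pd 2 (pd 0 F) lam
  let Fbb := pd 1 (pd 1 F) lam
  let Fbc := pd 2 (pd 1 F) lam
  let Fcc := pd 2 (pd 2 F) lam
  let wa := pd 0 w lam
  let wb := pd 1 w lam
  let wc := pd 2 w lam
  let waa := pd 0 (pd 0 w) lam
  let wab := pd 1 (pd 0 w) lam
  let wac := pd 2 (pd 0 w) lam
  let wbb := pd 1 (pd 1 w) lam
  let wbc := pd 2 (pd 1 w) lam
  let wcc := pd 2 (pd 2 w) lam
  let m11 := 2 * crossQuot 0 1 F w lam
    + Faa * (wb ^ 2 / wa) - 2 * Fab * wb + Fbb * wa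
    - Fa * (waa * (wb ^ 2 / wa ^ 2) - 2 * wab * (wb / wa) + wbb)
  let m12 := Faa * (wb * wc / wa) - Fab * wc - Fac * wb + Fbc * wa
    - Fa * (waa * (wb * wc / wa ^ 2) - wab * (wc / wa) - wac * (wb / wa) + wbc)
  let m22 := 2 * crossQuot 0 2 F w lam
    + Faa * (wc ^ 2 / wa) - 2 * Fac * wc + Fcc * wa
    - Fa * (waa * (wc ^ 2 / wa ^ 2) - 2 * wac * (wc / wa) + wcc)
  !![m11, m12; m12, m22]

/-- The symmetric matrix `M^{S_w}`. -/
def matS (F w : Coord → ℝ) (lam : Coord) : Matrix (Fin 2) (Fin 2) ℝ :=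
  let Fb := pd 1 F lam
  let Faa := pd 0 (pd 0 F) lam
  let Fab := pd 1 (pd 0 F) lam
  let Fac := pd 2 (pd 0 F) lam
  let Fbb := pd 1 (pd 1 F) lam
  let Fbc := pd 2 (pd 1 F) lam
  let Fcc := pd 2 (pd 2 F) lam
  let wa := pd 0 w lam
  let wb := pd 1 w lam
  let wc := pd 2 w lam
  let waa := pd 0 (pd 0 w) lam
  let wab := pd 1 (pd 0 w) lam
  let wac := pd 2 (pd 0 w) lam
  let wbb := pd 1 (pd 1 w) lam
  let wbc := pd 2 (pd 1 w) lam
  let wcc := pd 2 (pd 2 w) lam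
  let m11 := 2 * crossQuot 0 1 F w lam
    + Faa * wb - 2 * Fab * wa + Fbb * (wa ^ 2 / wb)
    - Fb * (waa - 2 * wab * (wa / wb) + wbb * (wa ^ 2 / wb ^ 2))
  let m12 := -Fab * wc + Fac * wb + Fbb * (wa * wc / wb) - Fbc * wa
    - Fb * (-wab * (wc / wb) + wac + wbb * (wa * wc / wb ^ 2) - wbc * (wa / wb))
  let m22 := 2 * crossQuot 1 2 F w lam
    + Fbb * (wc ^ 2 / wb) - 2 * Fbc * wc + Fcc * wb
    - Fb * (wbb * (wc ^ 2 / wb ^ 2) - 2 * wbc * (wc / wb) + wcc)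
  !![m11, m12; m12, m22]

/-- The symmetric matrix `M^{T_w}`. -/
def matT (F w : Coord → ℝ) (lam : Coord) : Matrix (Fin 2) (Fin 2) ℝ :=
  let Fc := pd 2 F lam
  let Faa := pd 0 (pd 0 F) lam
  let Fab := pd 1 (pd 0 F) lam
  let Fac := pd 2 (pd 0 F) lam
  let Fbb := pd 1 (pd 1 F) lam
  let Fbc := pd 2 (pd 1 F) lam
  let Fcc := pd 2 (pd 2 F) lam
  let wa := pd 0 w lam
  let wb := pd 1 w lam
  let wc := pd 2 w lam
  let waa := pd 0 (pd 0 w) lam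
  let wab := pd 1 (pd 0 w) lam
  let wac := pd 2 (pd 0 w) lam
  let wbb := pd 1 (pd 1 w) lam
  let wbc := pd 2 (pd 1 w) lam
  let wcc := pd 2 (pd 2 w) lam
  let m11 := 2 * crossQuot 0 2 F w lam
    + Faa * wc - 2 * Fac * wa + Fcc * (wa ^ 2 / wc)
    - Fc * (waa - 2 * wac * (wa / wc) + wcc * (wa ^ 2 / wc ^ 2))
  let m12 := Fab * wc - Fac * wb - Fbc * wa + Fcc * (wa * wb / wc)
    - Fc * (wab - wac * (wb / wc) - wbc * (wa / wc) + wcc * (wa * wb / wc ^ 2))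
  let m22 := 2 * crossQuot 1 2 F w lam
    + Fbb * wc - 2 * Fbc * wb + Fcc * (wb ^ 2 / wc)
    - Fc * (wbb - 2 * wbc * (wb / wc) + wcc * (wb ^ 2 / wc ^ 2))
  !![m11, m12; m12, m22]

end CurvatureFlow

end

/-! Write `A = g⁻¹h` for the shape operator and `λ` for the principal curvatures. At the point `A`
is diagonal, and the flow gives `∂ₜg = -2Fh` and `∂ₜν = grad F`; hence the diagonal entries of `A`
evolve by `F_{;kk} + F λ_k²`. Therefore `Lw = ∑ₖ [w_k (F_{;kk} + F λ_k²) - F_k w_{;kk}]`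
(`IsFlow.linOp_eq`).

The Hessian entry `f_{;ii}` of a symmetric function `f` is `∑ₖ f_k D_{ki}`, with `D_{ki}` the second
derivative of `A_{kk}` in direction `i`, plus the Hessian form of `f` in the `h_{kk;i}`, plus `2
(f_k - f_l)/(λ_k - λ_l) h_{kl;i}²` summed over `k < l`. The same `D` and `h_{ij;k}` serve `F` and
`w` (`IsHypersurface.exists_covariant_jet`). In `Lw` the `D` terms occur only through `D_{lk} -
D_{kl}`, with coefficient `w_k F_l`; the Gauss and Codazzi equations make this difference cubic in
`λ`, which yields `C_w`. By Codazzi `h_{ij;k}` is totally symmetric, so the quadratic terms sort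
into `E_w`, `R_w`, `S_w` and `T_w`. At a critical point `∑ₖ w_k h_{kk;i} = 0`; eliminating one
component for each `i` gives the three matrices.

The analytic difficulty is that eigenvalues need not be differentiable where they coincide, while
`F` and `w` are only `C²`. Near a given `λ`, a symmetric `C²` function equals a polynomial `Q` in
the elementary symmetric functions up to a remainder vanishing to second order
(`IsCurvatureFunction.exists_flat`). The polynomial part is smooth in `A`. The remainder contributes
nothing to first or second derivatives at the point, because unordered eigenvalues are locally
Lipschitz (`IsDiag.exists_perm_abs_sub_le`, `SmoothForms.hasFDerivAt_fderiv_of_flat`). In terms of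
`Q`, the quotient `(f_i - f_j)/(λ_i - λ_j)` is one expression for equal and for distinct eigenvalues
(`Flat.diffQuot_eq`), so no case distinction reaches the geometry.

Covariant derivatives are computed after a quadratic change of coordinates that removes the
Christoffel symbols at the point. -/

noncomputable section

namespace CurvatureFlow

/-! ### Calculus of directional derivatives -/

/-- The derivative of `u` in the direction `v`. -/
def dirD {E V : Type*} [NormedAddCommGroup E] [NormedSpace ℝ E] [NormedAddCommGroup V]
    [NormedSpace ℝ V] (v : E) (u : E → V) (y : E) : V :=
  fderiv ℝ u y v

section Calculus

variable {E V : Type*} [NormedAddCommGroup E] [NormedSpace ℝ E] [NormedAddCommGroup V]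
  [NormedSpace ℝ V] {s : Set E} {x : E} {v w : E}

lemma pd_eq_dirD (k : Fin 3) (u : Coord → V) : pd k u = dirD (Pi.single k 1) u := rfl

lemma dirD_congr {u₁ u₂ : E → V} (h : u₁ =ᶠ[𝓝 x] u₂) : dirD v u₁ x = dirD v u₂ x := by
  rw [dirD, dirD, h.fderiv_eq]

lemma dirD_congr_on {u₁ u₂ : E → V} (hs : IsOpen s) (h : ∀ y ∈ s, u₁ y = u₂ y) :
    ∀ y ∈ s, dirD v u₁ y = dirD v u₂ y := fun _ hy =>
  dirD_congr (eventually_of_mem (hs.mem_nhds hy) h)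

lemma contDiffOn_dirD {u : E → V} (hs : IsOpen s) (hu : ContDiffOn ℝ ∞ u s) :
    ContDiffOn ℝ ∞ (dirD v u) s :=
  (hu.fderiv_of_isOpen hs (by simp)).clm_apply contDiffOn_const

lemma differentiableAt_of_contDiffOn {u : E → V} (hs : IsOpen s) (hu : ContDiffOn ℝ ∞ u s)
    (hx : x ∈ s) : DifferentiableAt ℝ u x :=
  (hu.contDiffAt (hs.mem_nhds hx)).differentiableAt (by simp)

lemma dirD_comm {u : E → V} (hs : IsOpen s) (hu : ContDiffOn ℝ ∞ u s) (hx : x ∈ s) :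
    dirD v (dirD w u) x = dirD w (dirD v u) x := by
  have h1 : ContDiffAt ℝ ∞ u x := hu.contDiffAt (hs.mem_nhds hx)
  have h2 : DifferentiableAt ℝ (fderiv ℝ u) x :=
    (h1.fderiv_right (m := 1) (by norm_cast)).differentiableAt (by simp)
  have h3 := (contDiffAt_infty.1 h1 2).isSymmSndFDerivAt (by simp)
  have key : ∀ a b : E, dirD a (dirD b u) x = fderiv ℝ (fderiv ℝ u) x a b := by
    intro a b
    have : dirD b u = fun y => fderiv ℝ u y b := rfl
    rw [dirD, this, fderiv_clm_apply h2 (differentiableAt_const b)]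
    simp
  rw [key, key, h3.eq]

lemma dirD_const (c : V) : dirD v (fun _ : E => c) x = 0 := by simp [dirD]

lemma dirD_add {a b : E → V} (ha : DifferentiableAt ℝ a x) (hb : DifferentiableAt ℝ b x) :
    dirD v (fun y => a y + b y) x = dirD v a x + dirD v b x := by
  simp only [dirD]; rw [fderiv_fun_add ha hb]; rfl

lemma dirD_sub {a b : E → V} (ha : DifferentiableAt ℝ a x) (hb : DifferentiableAt ℝ b x) :
    dirD v (fun y => a y - b y) x = dirD v a x - dirD v b x := by
  simp only [dirD]; rw [fderiv_fun_sub ha hb]; rfl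

lemma dirD_neg {a : E → V} : dirD v (fun y => -a y) x = -dirD v a x := by
  simp only [dirD]; rw [fderiv_fun_neg]; rfl

lemma dirD_sum {ι : Type*} (t : Finset ι) {a : ι → E → V}
    (ha : ∀ i ∈ t, DifferentiableAt ℝ (a i) x) :
    dirD v (fun y => ∑ i ∈ t, a i y) x = ∑ i ∈ t, dirD v (a i) x := by
  simp only [dirD]; rw [fderiv_fun_sum ha]; simp

lemma dirD_mul {a b : E → ℝ} (ha : DifferentiableAt ℝ a x) (hb : DifferentiableAt ℝ b x) :
    dirD v (fun y => a y * b y) x = dirD v a x * b x + a x * dirD v b x := by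
  simp only [dirD]; rw [fderiv_fun_mul ha hb]; simp; ring

lemma dirD_smul {a : E → ℝ} {b : E → V} (ha : DifferentiableAt ℝ a x)
    (hb : DifferentiableAt ℝ b x) :
    dirD v (fun y => a y • b y) x = dirD v a x • b x + a x • dirD v b x := by
  simp only [dirD]; rw [fderiv_fun_smul ha hb]; simp; rw [add_comm]

lemma dirD_inner {H : Type*} [NormedAddCommGroup H] [InnerProductSpace ℝ H] {a b : E → H}
    (ha : DifferentiableAt ℝ a x) (hb : DifferentiableAt ℝ b x) :
    dirD v (fun y => inner ℝ (a y) (b y)) x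
      = inner ℝ (dirD v a x) (b x) + inner ℝ (a x) (dirD v b x) := by
  simp only [dirD]; rw [fderiv_inner_apply ℝ ha hb]; ring

section SecondOrder

variable (hs : IsOpen s) (hx : x ∈ s)
include hs hx

lemma dirD₂_add {a b : E → V} (ha : ContDiffOn ℝ ∞ a s) (hb : ContDiffOn ℝ ∞ b s) :
    dirD v (dirD w (fun y => a y + b y)) x = dirD v (dirD w a) x + dirD v (dirD w b) x := by
  rw [dirD_congr_on hs (fun y hy => dirD_add (differentiableAt_of_contDiffOn hs ha hy)
    (differentiableAt_of_contDiffOn hs hb hy)) x hx]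
  exact dirD_add (differentiableAt_of_contDiffOn hs (contDiffOn_dirD hs ha) hx)
    (differentiableAt_of_contDiffOn hs (contDiffOn_dirD hs hb) hx)

lemma dirD₂_sub {a b : E → V} (ha : ContDiffOn ℝ ∞ a s) (hb : ContDiffOn ℝ ∞ b s) :
    dirD v (dirD w (fun y => a y - b y)) x = dirD v (dirD w a) x - dirD v (dirD w b) x := by
  rw [dirD_congr_on hs (fun y hy => dirD_sub (differentiableAt_of_contDiffOn hs ha hy)
    (differentiableAt_of_contDiffOn hs hb hy)) x hx]
  exact dirD_sub (differentiableAt_of_contDiffOn hs (contDiffOn_dirD hs ha) hx)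
    (differentiableAt_of_contDiffOn hs (contDiffOn_dirD hs hb) hx)

lemma dirD₂_mul {a b : E → ℝ} (ha : ContDiffOn ℝ ∞ a s) (hb : ContDiffOn ℝ ∞ b s) :
    dirD v (dirD w (fun y => a y * b y)) x
      = dirD v (dirD w a) x * b x + dirD w a x * dirD v b x
        + (dirD v a x * dirD w b x + a x * dirD v (dirD w b) x) := by
  have da := differentiableAt_of_contDiffOn hs ha hx
  have db := differentiableAt_of_contDiffOn hs hb hx
  have dda := differentiableAt_of_contDiffOn hs (contDiffOn_dirD (v := w) hs ha) hx
  have ddb := differentiableAt_of_contDiffOn hs (contDiffOn_dirD (v := w) hs hb) hx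
  rw [dirD_congr_on hs (fun y hy => dirD_mul (differentiableAt_of_contDiffOn hs ha hy)
    (differentiableAt_of_contDiffOn hs hb hy)) x hx]
  refine (dirD_add (dda.fun_mul db) (da.fun_mul ddb)).trans ?_
  rw [dirD_mul dda db, dirD_mul da ddb]

lemma dirD₂_smul {a : E → ℝ} {b : E → V} (ha : ContDiffOn ℝ ∞ a s) (hb : ContDiffOn ℝ ∞ b s) :
    dirD v (dirD w (fun y => a y • b y)) x
      = dirD v (dirD w a) x • b x + dirD w a x • dirD v b x
        + (dirD v a x • dirD w b x + a x • dirD v (dirD w b) x) := by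
  have da := differentiableAt_of_contDiffOn hs ha hx
  have db := differentiableAt_of_contDiffOn hs hb hx
  have dda := differentiableAt_of_contDiffOn hs (contDiffOn_dirD (v := w) hs ha) hx
  have ddb := differentiableAt_of_contDiffOn hs (contDiffOn_dirD (v := w) hs hb) hx
  rw [dirD_congr_on hs (fun y hy => dirD_smul (differentiableAt_of_contDiffOn hs ha hy)
    (differentiableAt_of_contDiffOn hs hb hy)) x hx]
  refine (dirD_add (dda.fun_smul db) (da.fun_smul ddb)).trans ?_
  rw [dirD_smul dda db, dirD_smul da ddb]

lemma dirD₂_inner {H : Type*} [NormedAddCommGroup H] [InnerProductSpace ℝ H] {a b : E → H}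
    (ha : ContDiffOn ℝ ∞ a s) (hb : ContDiffOn ℝ ∞ b s) :
    dirD v (dirD w (fun y => inner ℝ (a y) (b y))) x
      = inner ℝ (dirD v (dirD w a) x) (b x) + inner ℝ (dirD w a x) (dirD v b x)
        + (inner ℝ (dirD v a x) (dirD w b x) + inner ℝ (a x) (dirD v (dirD w b) x)) := by
  have da := differentiableAt_of_contDiffOn hs ha hx
  have db := differentiableAt_of_contDiffOn hs hb hx
  have dda := differentiableAt_of_contDiffOn hs (contDiffOn_dirD (v := w) hs ha) hx
  have ddb := differentiableAt_of_contDiffOn hs (contDiffOn_dirD (v := w) hs hb) hx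
  rw [dirD_congr_on hs (fun y hy => dirD_inner (differentiableAt_of_contDiffOn hs ha hy)
    (differentiableAt_of_contDiffOn hs hb hy)) x hx,
    dirD_add (dda.inner ℝ db) (da.inner ℝ ddb), dirD_inner dda db, dirD_inner da ddb]

lemma dirD₂_sum {ι : Type*} (t : Finset ι) {a : ι → E → V}
    (ha : ∀ i ∈ t, ContDiffOn ℝ ∞ (a i) s) :
    dirD v (dirD w (fun y => ∑ i ∈ t, a i y)) x = ∑ i ∈ t, dirD v (dirD w (a i)) x := by
  rw [dirD_congr_on hs (fun y hy => dirD_sum t fun i hi =>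
    differentiableAt_of_contDiffOn hs (ha i hi) hy) x hx]
  exact dirD_sum t fun i hi => differentiableAt_of_contDiffOn hs (contDiffOn_dirD hs (ha i hi)) hx

end SecondOrder

end Calculus

/-! ### Simultaneous diagonalization and principal curvatures -/

/-- `μ` lists the eigenvalues of `h` with respect to `g`: some basis is orthonormal for `g` and
diagonalizes `h` with diagonal entries `μ`. -/
def IsDiag (g h : Matrix (Fin 3) (Fin 3) ℝ) (μ : Coord) : Prop :=
  ∃ P : Matrix (Fin 3) (Fin 3) ℝ, P.transpose * g * P = 1 ∧ P.transpose * h * P = .diagonal μ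

-- Factor `g = BᵀB` and diagonalize the symmetric matrix `(B⁻¹)ᵀ h B⁻¹` by an orthogonal `U`; then
-- `P = B⁻¹U` works.
open Matrix MatrixOrder in
lemma exists_isDiag {g h : Matrix (Fin 3) (Fin 3) ℝ} (hg : g.PosDef) (hh : hᵀ = h) :
    ∃ μ, IsDiag g h μ := by
  obtain ⟨B, hB⟩ := CStarAlgebra.nonneg_iff_eq_star_mul_self.mp hg.posSemidef.nonneg
  have hB' : g = Bᵀ * B := by rw [hB, star_eq_conjTranspose, conjTranspose_eq_transpose_of_trivial]
  have hdet : IsUnit B.det := by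
    have := hg.det_pos.ne'
    rw [hB', det_mul] at this
    exact isUnit_iff_ne_zero.2 (right_ne_zero_of_mul this)
  have hdetT : IsUnit Bᵀ.det := by rwa [det_transpose]
  have hC : ((B⁻¹)ᵀ * h * B⁻¹).IsHermitian := by
    rw [IsHermitian, conjTranspose_eq_transpose_of_trivial]
    simp only [transpose_mul, transpose_transpose, hh, Matrix.mul_assoc]
  set U : Matrix (Fin 3) (Fin 3) ℝ := ↑hC.eigenvectorUnitary with hU
  have hUU : Uᵀ * U = 1 := by
    have := Unitary.coe_star_mul_self hC.eigenvectorUnitary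
    rwa [star_eq_conjTranspose, conjTranspose_eq_transpose_of_trivial] at this
  refine ⟨hC.eigenvalues, B⁻¹ * U, ?_, ?_⟩
  · rw [hB', transpose_mul, transpose_nonsing_inv]
    calc Uᵀ * (Bᵀ)⁻¹ * (Bᵀ * B) * (B⁻¹ * U)
        = Uᵀ * (((Bᵀ)⁻¹ * Bᵀ) * (B * B⁻¹)) * U := by simp only [Matrix.mul_assoc]
      _ = 1 := by rw [nonsing_inv_mul _ hdetT, mul_nonsing_inv _ hdet]; simpa using hUU
  · have key := hC.conjStarAlgAut_star_eigenvectorUnitary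
    rw [Unitary.conjStarAlgAut_star_apply, star_eq_conjTranspose,
      conjTranspose_eq_transpose_of_trivial] at key
    rw [transpose_mul]
    calc Uᵀ * (B⁻¹)ᵀ * h * (B⁻¹ * U) = Uᵀ * ((B⁻¹)ᵀ * h * B⁻¹) * U := by
          simp only [Matrix.mul_assoc]
      _ = _ := by rw [hU, key]; rfl

open Matrix in
lemma IsDiag.comp_perm {g h : Matrix (Fin 3) (Fin 3) ℝ} {μ : Coord} (H : IsDiag g h μ)
    (σ : Equiv.Perm (Fin 3)) : IsDiag g h (μ ∘ σ) := by
  obtain ⟨P, h1, h2⟩ := H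
  have key : ∀ k : Matrix (Fin 3) (Fin 3) ℝ,
      (P.submatrix id σ)ᵀ * k * P.submatrix id σ = (Pᵀ * k * P).submatrix σ σ := by
    intro k
    ext i j
    simp [Matrix.mul_apply]
  refine ⟨P.submatrix id σ, ?_, ?_⟩
  · rw [key, h1, submatrix_one_equiv]
  · rw [key, h2, submatrix_diagonal_equiv]

open Matrix in
lemma IsDiag.inv_eq {g : Matrix (Fin 3) (Fin 3) ℝ}
    {P : Matrix (Fin 3) (Fin 3) ℝ} (h1 : Pᵀ * g * P = 1) : g⁻¹ = P * Pᵀ := by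
  have h2 : P * (Pᵀ * g) = 1 := mul_eq_one_comm.1 h1
  rw [← Matrix.mul_assoc] at h2
  exact inv_eq_left_inv h2

-- Since `g⁻¹ = P Pᵀ`, cycling the product `P (Pᵀ h)` turns `g⁻¹h` into `Pᵀ h P`, which is diagonal.
open Matrix Polynomial in
lemma IsDiag.charpoly_eq {g h : Matrix (Fin 3) (Fin 3) ℝ} {μ : Coord} (H : IsDiag g h μ) :
    (g⁻¹ * h).charpoly = ∏ i, (X - C (μ i)) := by
  obtain ⟨P, h1, h2⟩ := H
  rw [IsDiag.inv_eq h1, Matrix.mul_assoc, Matrix.charpoly_mul_comm, h2, charpoly_diagonal]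

lemma IsDiag.principalCurvatures_eq {g h : Matrix (Fin 3) (Fin 3) ℝ} {μ : Coord}
    (H : IsDiag g h μ) : ∃ σ : Equiv.Perm (Fin 3), principalCurvatures g h = μ ∘ σ := by
  refine ⟨Tuple.sort μ, ?_⟩
  have hmono := Tuple.monotone_sort μ
  have hsort : (g⁻¹ * h).charpoly.roots.sort (· ≤ ·) = List.ofFn (μ ∘ Tuple.sort μ) := by
    have hroots : (g⁻¹ * h).charpoly.roots
        = Multiset.map (μ ∘ Tuple.sort μ) Finset.univ.val := by
      rw [H.charpoly_eq, ← Equiv.prod_comp (Tuple.sort μ), Polynomial.roots_prod]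
      · simp
      · simp [Finset.prod_ne_zero_iff, Polynomial.X_sub_C_ne_zero]
    rw [hroots, Fin.univ_val_map, Multiset.coe_sort]
    apply List.mergeSort_of_pairwise
    simp_rw [decide_eq_true_eq, ← List.sortedLE_iff_pairwise]
    exact hmono.sortedLE_ofFn
  funext i
  rw [principalCurvatures, hsort]
  fin_cases i <;> simp

/-- The elementary symmetric functions of three variables. -/
def esymmVec (μ : Coord) : Coord :=
  ![μ 0 + μ 1 + μ 2, μ 0 * μ 1 + μ 0 * μ 2 + μ 1 * μ 2, μ 0 * μ 1 * μ 2]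

lemma esymmVec_comp_perm (μ : Coord) (σ : Equiv.Perm (Fin 3)) :
    esymmVec (μ ∘ σ) = esymmVec μ := by
  have h1 : μ (σ 0) + μ (σ 1) + μ (σ 2) = μ 0 + μ 1 + μ 2 := by
    simpa [Fin.sum_univ_three] using Equiv.sum_comp σ μ
  have h2 : μ (σ 0) ^ 2 + μ (σ 1) ^ 2 + μ (σ 2) ^ 2 = μ 0 ^ 2 + μ 1 ^ 2 + μ 2 ^ 2 := by
    simpa [Fin.sum_univ_three] using Equiv.sum_comp σ (fun i => μ i ^ 2)
  have h3 : μ (σ 0) * μ (σ 1) * μ (σ 2) = μ 0 * μ 1 * μ 2 := by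
    simpa [Fin.prod_univ_three] using Equiv.prod_comp σ μ
  -- The second elementary symmetric function is half of the squared sum minus the sum of squares.
  have h4 : μ (σ 0) * μ (σ 1) + μ (σ 0) * μ (σ 2) + μ (σ 1) * μ (σ 2)
      = μ 0 * μ 1 + μ 0 * μ 2 + μ 1 * μ 2 := by
    have : (μ (σ 0) + μ (σ 1) + μ (σ 2)) ^ 2 = (μ 0 + μ 1 + μ 2) ^ 2 := by rw [h1]
    linarith
  simp only [esymmVec, Function.comp_apply, h1, h3, h4]

/-- The invariants of a `3 × 3` matrix: up to sign, the coefficients of its characteristic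
polynomial. -/
def matInv (A : Matrix (Fin 3) (Fin 3) ℝ) : Coord :=
  ![A 0 0 + A 1 1 + A 2 2,
    A 0 0 * A 1 1 - A 0 1 * A 1 0 + (A 0 0 * A 2 2 - A 0 2 * A 2 0)
      + (A 1 1 * A 2 2 - A 1 2 * A 2 1),
    A 0 0 * (A 1 1 * A 2 2) - A 0 0 * (A 1 2 * A 2 1) - A 0 1 * (A 1 0 * A 2 2)
      + A 0 1 * (A 1 2 * A 2 0) + A 0 2 * (A 1 0 * A 2 1) - A 0 2 * (A 1 1 * A 2 0)]

lemma IsDiag.matInv_eq {g h : Matrix (Fin 3) (Fin 3) ℝ} {μ : Coord} (H : IsDiag g h μ) :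
    matInv (g⁻¹ * h) = esymmVec μ := by
  have key : ∀ x : ℝ, (Matrix.scalar (Fin 3) x - g⁻¹ * h).det = ∏ i, (x - μ i) := by
    intro x
    rw [← Matrix.eval_charpoly, H.charpoly_eq, Polynomial.eval_prod]
    simp
  set A := g⁻¹ * h
  -- Two monic cubics that agree at `0`, `1` and `-1` have the same coefficients.
  have k0 := key 0
  have k1 := key 1
  have k2 := key (-1)
  simp only [Matrix.det_fin_three, Fin.prod_univ_three, Matrix.sub_apply, Matrix.scalar_apply,
    Matrix.diagonal_apply] at k0 k1 k2
  simp at k0 k1 k2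
  simp only [matInv, esymmVec]
  congr 1
  · linarith
  · congr 1
    · linarith
    · congr 1
      linarith

/-! ### Lipschitz dependence of unordered eigenvalues -/

open Matrix in
lemma exists_perm_entry_lower_bound {W : Matrix (Fin 3) (Fin 3) ℝ} {K d : ℝ}
    (hK : ∀ i j, |W i j| ≤ K) (hd : d ≤ |W.det|) :
    ∃ σ : Equiv.Perm (Fin 3), ∀ i, d ≤ 6 * K ^ 2 * |W i (σ i)| := by
  -- One of the six Leibniz terms has size at least `d / 6`. Its other two factors are at most `K`
  -- each, which bounds every single factor from below.
  have h1 : ∃ σ : Equiv.Perm (Fin 3), d / 6 ≤ |∏ i, W (σ i) i| := by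
    by_contra! hcon
    have h2 : |W.det| ≤ ∑ σ : Equiv.Perm (Fin 3), |∏ i, W (σ i) i| := by
      rw [det_apply]
      refine (Finset.abs_sum_le_sum_abs _ _).trans (Finset.sum_le_sum fun σ _ => le_of_eq ?_)
      rcases Int.units_eq_one_or (Equiv.Perm.sign σ) with h | h <;> simp [h]
    have h3 : ∑ σ : Equiv.Perm (Fin 3), |∏ i, W (σ i) i| < ∑ _σ : Equiv.Perm (Fin 3), d / 6 :=
      Finset.sum_lt_sum_of_nonempty Finset.univ_nonempty fun σ _ => hcon σ
    have h4 : ∑ _σ : Equiv.Perm (Fin 3), d / 6 = d := by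
      simp [Fintype.card_perm, Nat.factorial]
      ring
    linarith
  obtain ⟨σ, hσ⟩ := h1
  refine ⟨σ.symm, fun i => ?_⟩
  have hK0 : 0 ≤ K := (abs_nonneg _).trans (hK 0 0)
  have h2 : |∏ j, W (σ j) j| = |W i (σ.symm i)| * ∏ j ∈ Finset.univ.erase (σ.symm i), |W (σ j) j| := by
    rw [Finset.abs_prod, ← Finset.mul_prod_erase _ _ (Finset.mem_univ (σ.symm i))]
    simp
  have h3 : ∏ j ∈ Finset.univ.erase (σ.symm i), |W (σ j) j| ≤ K ^ 2 := by
    calc ∏ j ∈ Finset.univ.erase (σ.symm i), |W (σ j) j|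
        ≤ ∏ _j ∈ Finset.univ.erase (σ.symm i), K :=
          Finset.prod_le_prod (fun _ _ => abs_nonneg _) fun _ _ => hK _ _
      _ = K ^ 2 := by simp
  nlinarith [mul_le_mul_of_nonneg_left h3 (abs_nonneg (W i (σ.symm i)))]

lemma abs_mul_apply_le {M N : Matrix (Fin 3) (Fin 3) ℝ} {K L : ℝ} (hM : ∀ i j, |M i j| ≤ K)
    (hN : ∀ i j, |N i j| ≤ L) (i j : Fin 3) : |(M * N) i j| ≤ 3 * (K * L) := by
  rw [Matrix.mul_apply]
  calc |∑ k, M i k * N k j| ≤ ∑ k, |M i k * N k j| := Finset.abs_sum_le_sum_abs _ _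
    _ ≤ ∑ _k : Fin 3, K * L := Finset.sum_le_sum fun k _ => by
        rw [abs_mul]
        exact mul_le_mul (hM _ _) (hN _ _) (abs_nonneg _) ((abs_nonneg _).trans (hM i k))
    _ = 3 * (K * L) := by simp

-- The diagonal entries of `g⁻¹ = P Pᵀ` are the squared norms of the rows of `P`.
open Matrix in
lemma IsDiag.abs_apply_le {g P : Matrix (Fin 3) (Fin 3) ℝ} {B : ℝ} (hB : 1 ≤ B)
    (h1 : Pᵀ * g * P = 1) (hg : ∀ i j, |g⁻¹ i j| ≤ B) (i j : Fin 3) : |P i j| ≤ B := by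
  have h2 : P i j ^ 2 ≤ g⁻¹ i i := by
    rw [IsDiag.inv_eq h1, Matrix.mul_apply]
    simp only [transpose_apply, ← sq]
    exact Finset.single_le_sum (f := fun k => P i k ^ 2) (fun _ _ => sq_nonneg _)
      (Finset.mem_univ j)
  have h3 : P i j ^ 2 ≤ B := h2.trans ((le_abs_self _).trans (hg i i))
  exact abs_le_of_sq_le_sq (by nlinarith) (by linarith)

open Matrix in
lemma abs_det_le {g : Matrix (Fin 3) (Fin 3) ℝ} {B : ℝ} (hg : ∀ i j, |g i j| ≤ B) :
    |g.det| ≤ 6 * B ^ 3 := by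
  have := Matrix.det_le (A := g) (abv := AbsoluteValue.abs) (x := B) (by simpa using hg)
  simpa [Nat.factorial] using this

open Matrix in
/-- Eigenvalues depend on the matrix in a locally Lipschitz way, up to a permutation. -/
lemma IsDiag.exists_perm_abs_sub_le {g h g' h' : Matrix (Fin 3) (Fin 3) ℝ} {μ μ' : Coord}
    {B ε : ℝ} (hB : 1 ≤ B) (H : IsDiag g h μ) (H' : IsDiag g' h' μ')
    (hg : ∀ i j, |g i j| ≤ B) (hg' : ∀ i j, |g' i j| ≤ B)
    (hgi : ∀ i j, |g⁻¹ i j| ≤ B) (hgi' : ∀ i j, |g'⁻¹ i j| ≤ B)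
    (hε : ∀ i j, |(g⁻¹ * h - g'⁻¹ * h') i j| ≤ ε) :
    ∃ σ : Equiv.Perm (Fin 3), ∀ i, |μ i - μ' (σ i)| ≤ 78732 * B ^ 12 * ε := by
  obtain ⟨P, hP1, hP2⟩ := H
  obtain ⟨Q, hQ1, hQ2⟩ := H'
  have bP := IsDiag.abs_apply_le hB hP1 hgi
  have bQ := IsDiag.abs_apply_le hB hQ1 hgi'
  have bPi : ∀ i j, |(Pᵀ * g) i j| ≤ 3 * (B * B) :=
    abs_mul_apply_le (fun i j => bP j i) hg
  have bW : ∀ i j, |(Pᵀ * g * Q) i j| ≤ 3 * (3 * (B * B) * B) := abs_mul_apply_le bPi bQ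
  have bM : ∀ i j, |(Pᵀ * g * (g⁻¹ * h - g'⁻¹ * h') * Q) i j| ≤ 3 * (3 * (3 * (B * B) * ε) * B) :=
    abs_mul_apply_le (abs_mul_apply_le bPi hε) bQ
  -- The squared determinant of `W = Pᵀ g Q` is the reciprocal of `det(g⁻¹) det(g')`, and both of
  -- these are at most `6 B³`.
  have hdet : 1 / (6 * B ^ 3) ≤ |(Pᵀ * g * Q).det| := by
    have e1 : P.det * g.det * P.det = 1 := by
      have := congrArg det hP1
      simpa using this
    have e2 : Q.det * g'.det * Q.det = 1 := by
      have := congrArg det hQ1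
      simpa using this
    have e3 : ((Pᵀ * g * Q).det) ^ 2 = g.det * (Q.det) ^ 2 := by
      rw [det_mul, det_mul, det_transpose]
      linear_combination g.det * Q.det ^ 2 * e1
    have b1 : |g⁻¹.det| ≤ 6 * B ^ 3 := abs_det_le hgi
    have b2 : |g'.det| ≤ 6 * B ^ 3 := abs_det_le hg'
    have e4 : g⁻¹.det = P.det ^ 2 := by rw [IsDiag.inv_eq hP1]; simp [sq]
    rw [e4] at b1
    have pB : 0 < 6 * B ^ 3 := by positivity
    have e5 : ((Pᵀ * g * Q).det) ^ 2 * (P.det ^ 2 * g'.det) = 1 := by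
      rw [e3]; linear_combination (Q.det ^ 2 * g'.det) * e1 + e2
    have e6 : |(Pᵀ * g * Q).det| ^ 2 * (|P.det ^ 2| * |g'.det|) = 1 := by
      rw [← abs_pow, ← abs_mul, ← abs_mul, e5, abs_one]
    have e7 : |P.det ^ 2| * |g'.det| ≤ (6 * B ^ 3) * (6 * B ^ 3) :=
      mul_le_mul b1 b2 (abs_nonneg _) pB.le
    rw [div_le_iff₀ pB]
    have e8 : 1 ≤ (|(Pᵀ * g * Q).det| * (6 * B ^ 3)) ^ 2 := by
      rw [← e6, mul_pow, sq (6 * B ^ 3)]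
      exact mul_le_mul_of_nonneg_left e7 (sq_nonneg _)
    have e9 : 0 ≤ |(Pᵀ * g * Q).det| * (6 * B ^ 3) := by positivity
    nlinarith
  obtain ⟨σ, hσ⟩ := exists_perm_entry_lower_bound bW hdet
  refine ⟨σ, fun i => ?_⟩
  -- In the two eigenbases the difference of the shape operators is `diag(μ) W - W diag(μ')`, with
  -- entries `(μ_i - μ'_j) W_ij`. Along a permutation on which `W` is bounded below, smallness of
  -- the difference passes to the eigenvalues.
  have hM : Pᵀ * g * (g⁻¹ * h - g'⁻¹ * h') * Q
      = diagonal μ * (Pᵀ * g * Q) - (Pᵀ * g * Q) * diagonal μ' := by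
    have q1 : Q * (Qᵀ * g') = 1 := mul_eq_one_comm.1 hQ1
    have p1 : P * (Pᵀ * g) = 1 := mul_eq_one_comm.1 hP1
    rw [IsDiag.inv_eq hP1, IsDiag.inv_eq hQ1, ← hP2, ← hQ2]
    calc Pᵀ * g * (P * Pᵀ * h - Q * Qᵀ * h') * Q
        = (Pᵀ * g * P) * (Pᵀ * h) * Q - (Pᵀ * g * Q) * (Qᵀ * h' * Q) := by
          simp only [Matrix.mul_sub, Matrix.sub_mul, Matrix.mul_assoc]
      _ = (Pᵀ * h) * (P * (Pᵀ * g)) * Q - (Pᵀ * g * Q) * (Qᵀ * h' * Q) := by rw [hP1, p1]; simp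
      _ = _ := by simp only [Matrix.mul_assoc]
  have hMi : (Pᵀ * g * (g⁻¹ * h - g'⁻¹ * h') * Q) i (σ i)
      = (μ i - μ' (σ i)) * (Pᵀ * g * Q) i (σ i) := by
    rw [hM, Matrix.sub_apply, diagonal_mul, mul_diagonal]
    ring
  have b := bM i (σ i)
  rw [hMi, abs_mul] at b
  have s := hσ i
  set X := |μ i - μ' (σ i)|
  set Y := |(Pᵀ * g * Q) i (σ i)|
  have pB : 0 < 6 * B ^ 3 := by positivity
  rw [div_le_iff₀ pB] at s
  have X0 : 0 ≤ X := abs_nonneg _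
  -- The constant is `2916 · 27`: the entry bound `9 B³` for `W` and its determinant bound give `6 ·
  -- 81 · 6 B⁹`, and the entries of the transformed difference are at most `27 B³ ε`.
  calc X = X * 1 := by ring
    _ ≤ X * (6 * (3 * (3 * (B * B) * B)) ^ 2 * Y * (6 * B ^ 3)) :=
        mul_le_mul_of_nonneg_left s X0
    _ = 2916 * B ^ 9 * (X * Y) := by ring
    _ ≤ 2916 * B ^ 9 * (3 * (3 * (3 * (B * B) * ε) * B)) :=
        mul_le_mul_of_nonneg_left b (by positivity)
    _ = _ := by ring

/-! ### Functions vanishing to second order at a point -/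

lemma isOpen_posCone : IsOpen posCone := by
  have : posCone = ⋂ i : Fin 3, {lam : Coord | 0 < lam i} := by
    ext; simp [posCone]
  rw [this]
  exact isOpen_iInter_of_finite fun i => isOpen_lt continuous_const (continuous_apply i)

lemma comp_perm_mem_posCone {lam : Coord} (h : lam ∈ posCone) (σ : Equiv.Perm (Fin 3)) :
    lam ∘ σ ∈ posCone := fun i => h (σ i)

lemma IsCurvatureFunction.contDiffAt {f : Coord → ℝ} (hf : IsCurvatureFunction f) {p : Coord}
    (hp : p ∈ posCone) : ContDiffAt ℝ 2 f p :=
  hf.contDiffOn.contDiffAt (isOpen_posCone.mem_nhds hp)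

/-- `r` vanishes to second order at `p`. -/
structure Flat (p : Coord) (r : Coord → ℝ) : Prop where
  contDiffAt : ContDiffAt ℝ 2 r p
  eq_zero : r p = 0
  isLittleO : fderiv ℝ r =o[𝓝 p] fun μ => μ - p

namespace Flat

variable {p : Coord} {r r' k : Coord → ℝ}

lemma eventually_differentiableAt (h : ContDiffAt ℝ 2 r p) : ∀ᶠ μ in 𝓝 p, DifferentiableAt ℝ r μ := by
  filter_upwards [h.eventually (by simp)] with μ hμ
  exact hμ.differentiableAt (by simp)

lemma congr (h : Flat p r) (hr : r' =ᶠ[𝓝 p] r) : Flat p r' :=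
  ⟨h.1.congr_of_eventuallyEq hr, by rw [hr.eq_of_nhds, h.2],
    h.3.congr' (hr.fderiv (𝕜 := ℝ)).symm EventuallyEq.rfl⟩

lemma fderiv_eq_zero (h : Flat p r) : fderiv ℝ r p = 0 := by
  have := (h.3.def one_pos).self_of_nhds
  simpa using this

protected lemma zero : Flat p (fun _ => 0) :=
  ⟨contDiffAt_const, rfl, (Asymptotics.isLittleO_zero _ _).congr (fun _ => by simp) fun _ => rfl⟩

lemma add (h : Flat p r) (h' : Flat p r') : Flat p (fun μ => r μ + r' μ) := by
  refine ⟨h.1.add h'.1, by simp [h.2, h'.2], (h.3.add h'.3).congr' ?_ EventuallyEq.rfl⟩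
  filter_upwards [eventually_differentiableAt h.1, eventually_differentiableAt h'.1] with μ a b
  exact (fderiv_fun_add a b).symm

lemma mul (h : Flat p r) (hk : ContDiffAt ℝ 2 k p) : Flat p (fun μ => r μ * k μ) := by
  refine ⟨h.1.mul hk, by simp [h.2], ?_⟩
  have hr : r =o[𝓝 p] fun μ => μ - p := by
    have := (h.1.differentiableAt (by simp)).hasFDerivAt.isLittleO
    simpa [h.fderiv_eq_zero, h.eq_zero] using this
  have hk1 : k =O[𝓝 p] fun _ => (1 : ℝ) := hk.continuousAt.isBigO_one ℝ
  have hk2 : fderiv ℝ k =O[𝓝 p] fun _ => (1 : ℝ) :=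
    (hk.fderiv_right (m := 1) (by norm_num)).continuousAt.isBigO_one ℝ
  have h1 : (fun μ => r μ • fderiv ℝ k μ) =o[𝓝 p] fun μ => μ - p := by
    rw [← Asymptotics.isLittleO_norm_right] at hr ⊢
    simpa using hr.smul_isBigO hk2
  have h2 : (fun μ => k μ • fderiv ℝ r μ) =o[𝓝 p] fun μ => μ - p := by
    simpa using hk1.smul_isLittleO h.3
  refine (h1.add h2).congr' ?_ EventuallyEq.rfl
  filter_upwards [eventually_differentiableAt h.1, eventually_differentiableAt hk] with μ a b
  exact (fderiv_fun_mul a b).symm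

lemma const_mul (h : Flat p r) (c : ℝ) : Flat p (fun μ => c * r μ) := by
  simpa [mul_comm] using h.mul (contDiffAt_const (c := c))

lemma sub (h : Flat p r) (h' : Flat p r') : Flat p (fun μ => r μ - r' μ) :=
  (h.add (h'.const_mul (-1))).congr (Eventually.of_forall fun μ => by ring)

lemma sum {ι : Type*} (s : Finset ι) {r : ι → Coord → ℝ} (h : ∀ i ∈ s, Flat p (r i)) :
    Flat p (fun μ => ∑ i ∈ s, r i μ) := by
  classical
  induction s using Finset.induction_on with
  | empty => simpa using Flat.zero
  | insert a s ha ih =>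
    simp only [Finset.sum_insert ha]
    exact (h a (by simp)).add (ih fun i hi => h i (by simp [hi]))

/-- The derivative is `3k² dk` with `k = O(μ - p)`. This supplies flat functions whose cutoff shape
is still polynomial. -/
lemma cube (hk : ContDiffAt ℝ 2 k p) (h0 : k p = 0) : Flat p (fun μ => k μ ^ 3) := by
  refine ⟨hk.pow 3, by simp [h0], ?_⟩
  have h1 : k =O[𝓝 p] fun μ => μ - p := by
    have := (hk.differentiableAt (by simp)).hasFDerivAt.isBigO_sub
    simpa [h0] using this
  have h2 : Tendsto k (𝓝 p) (𝓝 0) := by simpa [h0] using hk.continuousAt.tendsto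
  have hk2 : fderiv ℝ k =O[𝓝 p] fun _ => (1 : ℝ) :=
    (hk.fderiv_right (m := 1) (by norm_num)).continuousAt.isBigO_one ℝ
  have h3 : (fun μ => k μ * k μ) =o[𝓝 p] fun μ => ‖μ - p‖ := by
    have := ((Asymptotics.isLittleO_one_iff ℝ).2 h2).mul_isBigO h1.norm_right
    simpa using this
  have h4 := (h3.smul_isBigO hk2).const_smul_left (3 : ℝ)
  rw [← Asymptotics.isLittleO_norm_right]
  refine h4.congr' ?_ (Eventually.of_forall fun μ => by simp)
  filter_upwards [eventually_differentiableAt hk] with μ a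
  rw [fderiv_fun_pow 3 a]
  ext v
  simp
  ring

/-- Composition with a permutation of the coordinates. -/
def permCLM (σ : Equiv.Perm (Fin 3)) : Coord →L[ℝ] Coord :=
  ContinuousLinearMap.pi fun i => ContinuousLinearMap.proj (σ i)

lemma permCLM_apply (σ : Equiv.Perm (Fin 3)) (μ : Coord) : permCLM σ μ = μ ∘ σ := rfl

lemma comp_perm {σ : Equiv.Perm (Fin 3)} (h : Flat (p ∘ σ) r) :
    Flat p (fun μ => r (μ ∘ σ)) := by
  have hc : Tendsto (permCLM σ) (𝓝 p) (𝓝 (p ∘ σ)) := (permCLM σ).continuous.continuousAt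
  refine ⟨?_, h.2, ?_⟩
  · exact ContDiffAt.comp (g := r) (f := permCLM σ) p h.1 (permCLM σ).contDiff.contDiffAt
  · have h1 : (fun μ => fderiv ℝ r (μ ∘ σ)) =o[𝓝 p] fun μ => μ - p := by
      refine (h.3.comp_tendsto hc).trans_isBigO ?_
      have : (fun μ : Coord => permCLM σ (μ - p)) =O[𝓝 p] fun μ => μ - p :=
        (permCLM σ).isBigO_comp _ _
      simpa [Function.comp_def, permCLM_apply] using this
    have h2 : (fun μ => (fderiv ℝ r (μ ∘ σ)).comp (permCLM σ)) =O[𝓝 p]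
        fun μ => fderiv ℝ r (μ ∘ σ) := by
      refine Asymptotics.IsBigO.of_bound ‖permCLM σ‖ (Eventually.of_forall fun μ => ?_)
      rw [mul_comm]
      exact ContinuousLinearMap.opNorm_comp_le _ _
    refine (h2.trans_isLittleO h1).congr' ?_ EventuallyEq.rfl
    filter_upwards [hc.eventually (eventually_differentiableAt h.1)] with μ a
    have : HasFDerivAt r (fderiv ℝ r (μ ∘ σ)) (permCLM σ μ) := a.hasFDerivAt
    exact (this.comp μ (permCLM σ).hasFDerivAt).fderiv.symm

/-- The derivative of the remainder is the first-order Taylor remainder of `fderiv ℝ f`; symmetry of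
the second derivative identifies the derivative of the quadratic term. -/
lemma sub_taylor {f : Coord → ℝ} (hf : ContDiffAt ℝ 2 f p) :
    Flat p (fun μ => f μ - (f p + fderiv ℝ f p (μ - p)
      + (1 / 2) * fderiv ℝ (fderiv ℝ f) p (μ - p) (μ - p))) := by
  have hsymm := hf.isSymmSndFDerivAt (by simp)
  set B := fderiv ℝ (fderiv ℝ f) p with hB
  have hT : ∀ μ, HasFDerivAt (fun μ => f p + fderiv ℝ f p (μ - p)
      + (1 / 2) * B (μ - p) (μ - p)) (fderiv ℝ f p + B (μ - p)) μ := by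
    intro μ
    have hi : HasFDerivAt (fun μ : Coord => μ - p) (ContinuousLinearMap.id ℝ Coord) μ :=
      (hasFDerivAt_id μ).sub_const p
    have h1 := (fderiv ℝ f p).hasFDerivAt.comp μ hi
    have h2 := ((B.hasFDerivAt.comp μ hi).clm_apply hi).const_mul (1 / 2)
    refine ((h1.const_add (f p)).add h2).congr_fderiv ?_
    ext v
    simp
    have := hsymm.eq v (μ - p)
    simp only [map_sub, sub_apply] at this
    linarith
  refine ⟨?_, by simp, ?_⟩
  · refine hf.sub ?_
    fun_prop
  · have h1 := ((hf.fderiv_right (m := 1) (by norm_num)).differentiableAt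
      (by simp)).hasFDerivAt.isLittleO
    refine h1.congr' ?_ EventuallyEq.rfl
    filter_upwards [eventually_differentiableAt hf] with μ a
    rw [fderiv_fun_sub a (hT μ).differentiableAt, (hT μ).fderiv, sub_sub]

end Flat

/-! ### Second-order approximation by symmetric polynomials -/

lemma contDiff_eval (q : MvPolynomial (Fin 3) ℝ) :
    ContDiff ℝ ∞ (fun μ : Coord => MvPolynomial.eval μ q) := by
  induction q using MvPolynomial.induction_on with
  | C a => simpa using contDiff_const
  | add p q hp hq => simpa using hp.add hq
  | mul_X p i hp => simpa using hp.mul (contDiff_apply ℝ ℝ i)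

lemma exists_eval_eq_taylor (p : Coord) (c : ℝ) (L : Coord →L[ℝ] ℝ)
    (B : Coord →L[ℝ] Coord →L[ℝ] ℝ) : ∃ q : MvPolynomial (Fin 3) ℝ, ∀ μ,
      MvPolynomial.eval μ q = c + L (μ - p) + (1 / 2) * B (μ - p) (μ - p) := by
  have hsum : ∀ (M : Coord →L[ℝ] ℝ) (v : Coord), M v = ∑ i, v i * M (Pi.single i 1) := by
    intro M v
    conv_lhs => rw [pi_eq_sum_univ' v]
    simp only [map_sum, map_smul, smul_eq_mul]
  have hX : ∀ (μ : Coord) (i : Fin 3),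
      MvPolynomial.eval μ (MvPolynomial.X i - MvPolynomial.C (p i)) = (μ - p) i := by
    intro μ i
    simp
  have hlin : ∀ M : Coord →L[ℝ] ℝ, ∃ q : MvPolynomial (Fin 3) ℝ, ∀ μ,
      MvPolynomial.eval μ q = M (μ - p) := by
    intro M
    refine ⟨∑ i, (MvPolynomial.X i - MvPolynomial.C (p i)) * MvPolynomial.C (M (Pi.single i 1)),
      fun μ => ?_⟩
    rw [hsum M (μ - p), map_sum]
    refine Finset.sum_congr rfl fun i _ => ?_
    rw [map_mul, hX, MvPolynomial.eval_C]
  obtain ⟨q1, h1⟩ := hlin L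
  choose q2 h2 using fun i : Fin 3 => hlin (B (Pi.single i 1))
  refine ⟨MvPolynomial.C c + q1 + MvPolynomial.C (1 / 2) *
    ∑ i, (MvPolynomial.X i - MvPolynomial.C (p i)) * q2 i, fun μ => ?_⟩
  have h3 : B (μ - p) (μ - p) = ∑ i, (μ - p) i * B (Pi.single i 1) (μ - p) :=
    hsum (B.flip (μ - p)) (μ - p)
  rw [h3, map_add, map_add, map_mul, map_sum, MvPolynomial.eval_C, MvPolynomial.eval_C, h1]
  congr 2
  refine Finset.sum_congr rfl fun i _ => ?_
  rw [map_mul, hX, h2]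

/-- A product of affine factors, one for each `σ` that moves `p`, each built from a coordinate in
which `p` and `p ∘ σ` differ. -/
lemma exists_separating_polynomial (p : Coord) : ∃ q : MvPolynomial (Fin 3) ℝ,
    MvPolynomial.eval p q = 1 ∧
      ∀ σ : Equiv.Perm (Fin 3), p ∘ σ ≠ p → MvPolynomial.eval (p ∘ σ) q = 0 := by
  classical
  open MvPolynomial in
  have h1 : ∀ σ : Equiv.Perm (Fin 3), ∃ q : MvPolynomial (Fin 3) ℝ, p ∘ σ ≠ p →
      eval p q = 1 ∧ eval (p ∘ σ) q = 0 := by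
    intro σ
    by_cases h : p ∘ σ = p
    · exact ⟨0, fun h' => absurd h h'⟩
    · obtain ⟨i, hi⟩ := Function.ne_iff.1 h
      refine ⟨(X i - C (p (σ i))) * C (1 / (p i - p (σ i))), fun _ => ⟨?_, by simp⟩⟩
      have : p i - p (σ i) ≠ 0 := sub_ne_zero.2 (Ne.symm hi)
      simp [this]
  choose q hq using h1
  refine ⟨∏ σ ∈ Finset.univ.filter (fun σ : Equiv.Perm (Fin 3) => p ∘ σ ≠ p), q σ, ?_, ?_⟩
  · rw [map_prod]
    exact Finset.prod_eq_one fun σ hσ => (hq σ (Finset.mem_filter.1 hσ).2).1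
  · intro σ hσ
    rw [map_prod]
    exact Finset.prod_eq_zero (Finset.mem_filter.2 ⟨Finset.mem_univ σ, hσ⟩) (hq σ hσ).2

lemma exists_eval_esymmVec {q : MvPolynomial (Fin 3) ℝ} (hq : q.IsSymmetric) :
    ∃ Q : MvPolynomial (Fin 3) ℝ, ∀ μ : Coord,
      MvPolynomial.eval μ q = MvPolynomial.eval (esymmVec μ) Q := by
  obtain ⟨Q, hQ⟩ := (MvPolynomial.esymmAlgHom_fin_bijective ℝ 3).2 ⟨q, hq⟩
  refine ⟨Q, fun μ => ?_⟩
  have h1 : q = MvPolynomial.aeval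
      (fun i : Fin 3 => MvPolynomial.esymm (Fin 3) ℝ (i + 1)) Q := by
    have := congrArg Subtype.val hQ
    rw [MvPolynomial.esymmAlgHom_apply] at this
    exact this.symm
  have h2 : ∀ i : Fin 3, MvPolynomial.eval μ (MvPolynomial.esymm (Fin 3) ℝ (i + 1))
      = esymmVec μ i := by
    have e2 : Finset.powersetCard 2 (Finset.univ : Finset (Fin 3)) = {{0, 1}, {0, 2}, {1, 2}} := by
      decide
    have e3 : Finset.powersetCard 3 (Finset.univ : Finset (Fin 3)) = {Finset.univ} := by decide
    intro i
    fin_cases i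
    · simp [MvPolynomial.esymm_one, esymmVec, Fin.sum_univ_three]
    · simp [MvPolynomial.esymm, esymmVec, e2]
      rw [Finset.sum_insert (by decide), Finset.sum_insert (by decide), Finset.sum_singleton]
      simp
      ring
    · simp [MvPolynomial.esymm, esymmVec, e3, Fin.prod_univ_three]
  have h3 : (MvPolynomial.eval μ).comp (algebraMap ℝ (MvPolynomial (Fin 3) ℝ))
      = RingHom.id ℝ := by
    ext
    simp
  rw [h1, MvPolynomial.map_aeval, h3]
  simp only [h2]
  rfl

/-- A symmetric function of class `C²` agrees to second order with a polynomial in the elementary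
symmetric functions. -/
lemma IsCurvatureFunction.exists_flat {f : Coord → ℝ} (hf : IsCurvatureFunction f) {p : Coord}
    (hp : p ∈ posCone) : ∃ Q : Coord → ℝ, ContDiff ℝ ∞ Q ∧
      Flat p (fun μ => f μ - Q (esymmVec μ)) := by
  classical
  obtain ⟨T, hT⟩ := exists_eval_eq_taylor p (f p) (fderiv ℝ f p) (fderiv ℝ (fderiv ℝ f) p)
  obtain ⟨ψ, hψ1, hψ0⟩ := exists_separating_polynomial p
  -- The factor `1 - (1 - ψ³)³` equals `1` up to a flat cube where `ψ = 1`, and is a multiple of the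
  -- flat cube `ψ³` where `ψ = 0`. So `b` has the second-order jet of `f` at `p` and a vanishing jet
  -- at every other point of the orbit of `p`.
  set b : MvPolynomial (Fin 3) ℝ := T * (1 - (1 - ψ ^ 3) ^ 3) with hb
  set G := Finset.univ.filter (fun σ : Equiv.Perm (Fin 3) => p ∘ σ = p) with hG
  have hcard : (G.card : ℝ) ≠ 0 := by
    have : (1 : Equiv.Perm (Fin 3)) ∈ G := by
      simp only [hG, Finset.mem_filter, Finset.mem_univ, true_and]; rfl
    exact_mod_cast (Finset.card_pos.2 ⟨_, this⟩).ne'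
  have hsm : ∀ (q : MvPolynomial (Fin 3) ℝ) (x : Coord),
      ContDiffAt ℝ 2 (fun μ => MvPolynomial.eval μ q) x := fun q x =>
    (contDiff_infty.1 (contDiff_eval q) 2).contDiffAt
  have hflat1 : Flat p (fun μ => f μ - MvPolynomial.eval μ b) := by
    have h1 := Flat.sub_taylor (hf.contDiffAt hp)
    have h2 : Flat p (fun μ => (1 - MvPolynomial.eval μ ψ ^ 3) ^ 3) :=
      Flat.cube (contDiffAt_const.sub ((hsm ψ p).pow 3)) (by simp [hψ1])
    refine (h1.add (h2.mul (hsm T p))).congr (Eventually.of_forall fun μ => ?_)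
    simp only [hb, map_mul, map_sub, map_pow, map_one, hT]
    ring
  have hflat2 : ∀ σ : Equiv.Perm (Fin 3), p ∘ σ ≠ p →
      Flat (p ∘ σ) (fun μ => MvPolynomial.eval μ b) := by
    intro σ hσ
    have h2 : Flat (p ∘ σ) (fun μ => MvPolynomial.eval μ ψ ^ 3) :=
      Flat.cube (hsm ψ _) (hψ0 σ hσ)
    refine (h2.mul (hsm (T * (3 - 3 * ψ ^ 3 + ψ ^ 6)) (p ∘ σ))).congr
      (Eventually.of_forall fun μ => ?_)
    have e3 : MvPolynomial.eval μ (3 : MvPolynomial (Fin 3) ℝ) = 3 := map_ofNat _ 3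
    simp only [hb, map_mul, map_add, map_sub, map_pow, map_one, e3]
    ring
  -- In the symmetrization only permutations fixing `p` contribute to the jet at `p`, each with the
  -- jet of `f`. Hence the division by the order of the stabilizer `G`.
  set q : MvPolynomial (Fin 3) ℝ :=
    MvPolynomial.C (1 / (G.card : ℝ)) * ∑ σ : Equiv.Perm (Fin 3), MvPolynomial.rename σ b with hq
  have hqs : q.IsSymmetric := by
    intro τ
    rw [hq, map_mul, MvPolynomial.rename_C, map_sum]
    congr 1
    simp only [MvPolynomial.rename_rename]
    exact Fintype.sum_equiv (Equiv.mulLeft τ) _ _ fun σ => rfl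
  obtain ⟨Q, hQ⟩ := exists_eval_esymmVec hqs
  refine ⟨fun μ => MvPolynomial.eval μ Q, contDiff_eval Q, ?_⟩
  have hsum : Flat p (fun μ => (1 / (G.card : ℝ)) *
      (∑ σ ∈ G, (f (μ ∘ σ) - MvPolynomial.eval (μ ∘ σ) b)
        - ∑ σ ∈ Finset.univ.filter (fun σ : Equiv.Perm (Fin 3) => ¬ p ∘ σ = p),
          MvPolynomial.eval (μ ∘ σ) b)) := by
    refine ((Flat.sum _ fun σ hσ => ?_).sub (Flat.sum _ fun σ hσ => ?_)).const_mul _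
    · refine Flat.comp_perm (r := fun μ => f μ - MvPolynomial.eval μ b) ?_
      rw [(Finset.mem_filter.1 hσ).2]
      exact hflat1
    · exact Flat.comp_perm (r := fun μ => MvPolynomial.eval μ b)
        (hflat2 σ (Finset.mem_filter.1 hσ).2)
  refine hsum.congr ?_
  filter_upwards [isOpen_posCone.mem_nhds hp] with μ hμ
  have e1 : ∑ σ ∈ G, f (μ ∘ σ) = G.card * f μ := by
    rw [Finset.sum_congr rfl fun σ _ => hf.symm σ μ hμ]
    simp
  rw [← hQ, hq, Finset.sum_sub_distrib, e1]
  have e2 : MvPolynomial.eval μ (∑ σ : Equiv.Perm (Fin 3), MvPolynomial.rename σ b)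
      = ∑ σ ∈ G, MvPolynomial.eval (μ ∘ σ) b
        + ∑ σ ∈ Finset.univ.filter (fun σ : Equiv.Perm (Fin 3) => ¬ p ∘ σ = p),
          MvPolynomial.eval (μ ∘ σ) b := by
    rw [Finset.sum_filter_add_sum_filter_not, map_sum]
    simp [MvPolynomial.eval_rename]
  rw [map_mul, MvPolynomial.eval_C, e2]
  field_simp
  ring

/-! ### Symmetric functions of the eigenvalues of smooth families -/

/-- A smooth family of positive definite matrices `g` and symmetric matrices `h` on an open set. -/
structure SmoothForms {E : Type*} [NormedAddCommGroup E] [NormedSpace ℝ E] (s : Set E)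
    (g h : E → Matrix (Fin 3) (Fin 3) ℝ) : Prop where
  isOpen : IsOpen s
  contDiffOn_left : ∀ i j, ContDiffOn ℝ ∞ (fun y => g y i j) s
  contDiffOn_right : ∀ i j, ContDiffOn ℝ ∞ (fun y => h y i j) s
  posDef : ∀ y ∈ s, (g y).PosDef
  symm : ∀ y ∈ s, (h y).transpose = h y

lemma eventually_abs_le {E : Type*} [NormedAddCommGroup E] {x : E}
    {a : E → Matrix (Fin 3) (Fin 3) ℝ}
    (ha : ∀ i j, ContinuousAt (fun y => a y i j) x) :
    ∃ B : ℝ, ∀ᶠ y in 𝓝 x, ∀ i j, |a y i j| ≤ B := by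
  refine ⟨∑ k, ∑ l, (|a x k l| + 1), ?_⟩
  rw [eventually_all]
  intro i
  rw [eventually_all]
  intro j
  have h1 : ∀ᶠ y in 𝓝 x, |a y i j| < |a x i j| + 1 :=
    (ha i j).abs.eventually_lt continuousAt_const (lt_add_one _)
  filter_upwards [h1] with y hy
  refine hy.le.trans ?_
  calc |a x i j| + 1 ≤ ∑ l, (|a x i l| + 1) :=
        Finset.single_le_sum (f := fun l => |a x i l| + 1) (fun _ _ => by positivity)
          (Finset.mem_univ j)
    _ ≤ _ := Finset.single_le_sum (f := fun k => ∑ l, (|a x k l| + 1))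
        (fun _ _ => Finset.sum_nonneg fun _ _ => by positivity) (Finset.mem_univ i)

lemma eventually_of_near {E : Type*} [NormedAddCommGroup E] {x : E} {lam : Coord} {C : ℝ} {T : E → Coord → Prop} {S : Set Coord}
    (hS : S ∈ 𝓝 lam) (h : ∀ᶠ y in 𝓝 x, ∃ μ, T y μ ∧ ‖μ - lam‖ ≤ C * ‖y - x‖) :
    ∀ᶠ y in 𝓝 x, ∃ μ ∈ S, T y μ ∧ ‖μ - lam‖ ≤ C * ‖y - x‖ := by
  obtain ⟨δ, hδ, hball⟩ := Metric.mem_nhds_iff.1 hS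
  have h1 : Tendsto (fun y => C * ‖y - x‖) (𝓝 x) (𝓝 0) := by
    have : ContinuousAt (fun y => C * ‖y - x‖) x := by fun_prop
    simpa using this.tendsto
  filter_upwards [h, h1.eventually (gt_mem_nhds hδ)] with y ⟨μ, hT, hμ⟩ hy
  exact ⟨μ, hball (by rw [Metric.mem_ball, dist_eq_norm]; exact hμ.trans_lt hy), hT, hμ⟩

section

variable {E : Type*} [NormedAddCommGroup E] [NormedSpace ℝ E] {s : Set E}
  {g h : E → Matrix (Fin 3) (Fin 3) ℝ} {x : E} {lam : Coord} {f : Coord → ℝ}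

lemma contDiffOn_det (hg : ∀ i j, ContDiffOn ℝ ∞ (fun y => g y i j) s) :
    ContDiffOn ℝ ∞ (fun y => (g y).det) s := by
  simp only [Matrix.det_apply]
  exact ContDiffOn.sum fun σ _ => (contDiffOn_prod fun i _ => hg _ _).const_smul _

lemma SmoothForms.contDiffOn_inv (H : SmoothForms s g h) (i j : Fin 3) :
    ContDiffOn ℝ ∞ (fun y => (g y)⁻¹ i j) s := by
  simp only [Matrix.inv_def, Ring.inverse_eq_inv', Matrix.smul_apply, Matrix.adjugate_apply,
    smul_eq_mul]
  refine ((contDiffOn_det H.contDiffOn_left).inv fun y hy => (H.posDef y hy).det_pos.ne').mul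
    (contDiffOn_det fun k l => ?_)
  by_cases hk : k = j
  · simpa [Matrix.updateRow_apply, hk] using contDiffOn_const
  · simpa [Matrix.updateRow_apply, hk] using H.contDiffOn_left k l

lemma SmoothForms.contDiffOn_inv_mul (H : SmoothForms s g h) (i j : Fin 3) :
    ContDiffOn ℝ ∞ (fun y => ((g y)⁻¹ * h y) i j) s := by
  simp only [Matrix.mul_apply]
  exact ContDiffOn.sum fun k _ => (H.contDiffOn_inv i k).mul (H.contDiffOn_right k j)

lemma SmoothForms.exists_isDiag (H : SmoothForms s g h) {y : E} (hy : y ∈ s) :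
    ∃ μ, IsDiag (g y) (h y) μ :=
  CurvatureFlow.exists_isDiag (H.posDef y hy) (H.symm y hy)

/-- The estimate is uniform over pairs of points near `x`, not only pairs containing `x`: gradients
at nearby points have to be bounded as well. -/
lemma SmoothForms.exists_lipschitz (H : SmoothForms s g h) (hx : x ∈ s) :
    ∃ C : ℝ, 0 ≤ C ∧ ∃ N ∈ 𝓝 x, N ⊆ s ∧ ∀ y ∈ N, ∀ y' ∈ N, ∀ μ μ', IsDiag (g y) (h y) μ →
      IsDiag (g y') (h y') μ' →
      ∃ σ : Equiv.Perm (Fin 3), ‖μ - μ' ∘ σ‖ ≤ C * ‖y - y'‖ := by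
  have hn := H.isOpen.mem_nhds hx
  obtain ⟨B₁, hB₁⟩ := eventually_abs_le (a := fun y => g y) (x := x) fun i j =>
    ((H.contDiffOn_left i j).contDiffAt hn).continuousAt
  obtain ⟨B₂, hB₂⟩ := eventually_abs_le (a := fun y => (g y)⁻¹) (x := x) fun i j =>
    ((H.contDiffOn_inv i j).contDiffAt hn).continuousAt
  have hlip : ∀ i j, ∃ K, ∃ t ∈ 𝓝 x, LipschitzOnWith K (fun y => ((g y)⁻¹ * h y) i j) t :=
    fun i j => (contDiffAt_infty.1 ((H.contDiffOn_inv_mul i j).contDiffAt hn) 1).exists_lipschitzOnWith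
  choose K t ht hK using hlip
  set B := max 1 (max B₁ B₂) with hB
  set L : ℝ := ∑ i, ∑ j, (K i j : ℝ) with hL
  have hL0 : 0 ≤ L := by positivity
  refine ⟨78732 * B ^ 12 * L, by positivity,
    {y | (∀ i j, |g y i j| ≤ B₁) ∧ (∀ i j, |(g y)⁻¹ i j| ≤ B₂)} ∩ (⋂ i, ⋂ j, t i j) ∩ s,
    inter_mem (inter_mem (hB₁.and hB₂) (iInter_mem.2 fun i => iInter_mem.2 fun j => ht i j)) hn,
    Set.inter_subset_right, ?_⟩
  rintro y ⟨⟨⟨hy1, hy2⟩, hy3⟩, -⟩ y' ⟨⟨⟨hy1', hy2'⟩, hy3'⟩, -⟩ μ μ' hμ hμ'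
  have b1 : B₁ ≤ B := (le_max_left _ _).trans (le_max_right _ _)
  have b2 : B₂ ≤ B := (le_max_right _ _).trans (le_max_right _ _)
  obtain ⟨σ, hσ⟩ := hμ.exists_perm_abs_sub_le (ε := L * ‖y - y'‖) (le_max_left _ _) hμ'
    (fun i j => (hy1 i j).trans b1) (fun i j => (hy1' i j).trans b1)
    (fun i j => (hy2 i j).trans b2) (fun i j => (hy2' i j).trans b2) (fun i j => by
      have h1 := (hK i j).dist_le_mul y (Set.mem_iInter.1 (Set.mem_iInter.1 hy3 i) j) y'
        (Set.mem_iInter.1 (Set.mem_iInter.1 hy3' i) j)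
      rw [Real.dist_eq, dist_eq_norm] at h1
      rw [Matrix.sub_apply]
      refine h1.trans (mul_le_mul_of_nonneg_right ?_ (norm_nonneg _))
      calc (K i j : ℝ) ≤ ∑ l, (K i l : ℝ) :=
            Finset.single_le_sum (f := fun l => (K i l : ℝ)) (fun _ _ => by positivity)
              (Finset.mem_univ j)
        _ ≤ _ := Finset.single_le_sum (f := fun k => ∑ l, (K k l : ℝ))
            (fun _ _ => Finset.sum_nonneg fun _ _ => by positivity) (Finset.mem_univ i))
  refine ⟨σ, (pi_norm_le_iff_of_nonneg (by positivity)).2 fun i => ?_⟩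
  rw [mul_assoc]
  exact hσ i

lemma SmoothForms.exists_eventually_near (H : SmoothForms s g h) (hx : x ∈ s)
    (hd : IsDiag (g x) (h x) lam) :
    ∃ C : ℝ, 0 ≤ C ∧ ∀ᶠ y in 𝓝 x, ∃ μ, IsDiag (g y) (h y) μ ∧ ‖μ - lam‖ ≤ C * ‖y - x‖ := by
  obtain ⟨C, hC, N, hN, hNs, key⟩ := H.exists_lipschitz hx
  refine ⟨C, hC, ?_⟩
  filter_upwards [hN] with y hy
  obtain ⟨μ, hμ⟩ := H.exists_isDiag (hNs hy)
  obtain ⟨σ, hσ⟩ := key x (mem_of_mem_nhds hN) y hy lam μ hd hμ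
  exact ⟨μ ∘ σ, hμ.comp_perm σ, by rwa [norm_sub_rev, norm_sub_rev y x]⟩

lemma IsDiag.ofForms_eq {g h : Matrix (Fin 3) (Fin 3) ℝ} {μ : Coord} (H : IsDiag g h μ)
    (hf : ∀ σ : Equiv.Perm (Fin 3), ∀ lam ∈ posCone, f (lam ∘ σ) = f lam) (hμ : μ ∈ posCone) :
    ofForms f g h = f μ := by
  obtain ⟨σ, hσ⟩ := H.principalCurvatures_eq
  rw [ofForms, hσ, hf σ μ hμ]

lemma IsDiag.ofForms_sub {g h : Matrix (Fin 3) (Fin 3) ℝ} {μ : Coord} (H : IsDiag g h μ)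
    (Q : Coord → ℝ) : ofForms (fun μ => f μ - Q (esymmVec μ)) g h
      = ofForms f g h - Q (matInv (g⁻¹ * h)) := by
  obtain ⟨σ, hσ⟩ := H.principalCurvatures_eq
  rw [ofForms, ofForms, H.matInv_eq, hσ, esymmVec_comp_perm]

lemma SmoothForms.contDiffOn_matInv (H : SmoothForms s g h) :
    ContDiffOn ℝ ∞ (fun y => matInv ((g y)⁻¹ * h y)) s := by
  have hA := H.contDiffOn_inv_mul
  rw [contDiffOn_pi]
  intro i
  fin_cases i
  · exact ((hA 0 0).add (hA 1 1)).add (hA 2 2)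
  · exact ((((hA 0 0).mul (hA 1 1)).sub ((hA 0 1).mul (hA 1 0))).add
      (((hA 0 0).mul (hA 2 2)).sub ((hA 0 2).mul (hA 2 0)))).add
      (((hA 1 1).mul (hA 2 2)).sub ((hA 1 2).mul (hA 2 1)))
  · exact ((((((hA 0 0).mul ((hA 1 1).mul (hA 2 2))).sub ((hA 0 0).mul ((hA 1 2).mul (hA 2 1)))).sub
      ((hA 0 1).mul ((hA 1 0).mul (hA 2 2)))).add ((hA 0 1).mul ((hA 1 2).mul (hA 2 0)))).add
      ((hA 0 2).mul ((hA 1 0).mul (hA 2 1)))).sub ((hA 0 2).mul ((hA 1 1).mul (hA 2 0)))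

/-- The eigenvalues can be listed within `O(‖y - x‖)` of `lam`, so an increment `o(‖μ - lam‖)`
becomes `o(‖y - x‖)` even if no listing is differentiable. Symmetry of `f` makes the choice of
listing irrelevant. -/
lemma SmoothForms.hasFDerivAt_zero (H : SmoothForms s g h) (hx : x ∈ s)
    (hd : IsDiag (g x) (h x) lam) (hlam : lam ∈ posCone)
    (hf : ∀ σ : Equiv.Perm (Fin 3), ∀ lam ∈ posCone, f (lam ∘ σ) = f lam)
    (h0 : HasFDerivAt f (0 : Coord →L[ℝ] ℝ) lam) : HasFDerivAt (fun y => ofForms f (g y) (h y)) (0 : E →L[ℝ] ℝ) x := by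
  obtain ⟨C, hC, hnear⟩ := H.exists_eventually_near hx hd
  rw [hasFDerivAt_iff_isLittleO, Asymptotics.isLittleO_iff]
  intro c hc
  have h1 := h0.isLittleO.def (c := c / (C + 1)) (by positivity)
  filter_upwards [eventually_of_near (inter_mem h1 (isOpen_posCone.mem_nhds hlam)) hnear] with y
    ⟨μ, ⟨hμ1, hμ2⟩, hμ3, hμ4⟩
  rw [hμ3.ofForms_eq hf hμ2, hd.ofForms_eq hf hlam]
  have hμ1' : ‖f μ - f lam - (0 : Coord →L[ℝ] ℝ) (μ - lam)‖ ≤ c / (C + 1) * ‖μ - lam‖ := hμ1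
  simp only [zero_apply, sub_zero] at hμ1' ⊢
  calc ‖f μ - f lam‖ ≤ c / (C + 1) * ‖μ - lam‖ := hμ1'
    _ ≤ c / (C + 1) * (C * ‖y - x‖) := by gcongr
    _ = c * ‖y - x‖ * (C / (C + 1)) := by ring
    _ ≤ c * ‖y - x‖ * 1 := by
        gcongr
        rw [div_le_one (by positivity)]
        linarith
    _ = _ := by ring

lemma IsCurvatureFunction.symm_sub (hf : IsCurvatureFunction f) (Q : Coord → ℝ) :
    ∀ σ : Equiv.Perm (Fin 3), ∀ lam ∈ posCone,
      (fun μ => f μ - Q (esymmVec μ)) (lam ∘ σ) = (fun μ => f μ - Q (esymmVec μ)) lam := by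
  intro σ lam hlam
  simp only [hf.symm σ lam hlam, esymmVec_comp_perm]

lemma Flat.hasFDerivAt {p : Coord} {r : Coord → ℝ} (h : Flat p r) :
    HasFDerivAt r (0 : Coord →L[ℝ] ℝ) p := by
  have := (h.contDiffAt.differentiableAt (by simp)).hasFDerivAt
  rwa [h.fderiv_eq_zero] at this

/-- Split `f` into its flat remainder, whose pullback has zero derivative at `x`, and `Q` of the
invariants of `g⁻¹h`, which is smooth in `y`. -/
lemma SmoothForms.hasFDerivAt_of_flat (H : SmoothForms s g h) (hx : x ∈ s)
    (hd : IsDiag (g x) (h x) lam) (hlam : lam ∈ posCone) (hf : IsCurvatureFunction f)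
    {Q : Coord → ℝ} (hQ : ContDiff ℝ ∞ Q) (hflat : Flat lam (fun μ => f μ - Q (esymmVec μ))) :
    HasFDerivAt (fun y => ofForms f (g y) (h y))
      (fderiv ℝ (fun y => Q (matInv ((g y)⁻¹ * h y))) x) x := by
  have h1 := H.hasFDerivAt_zero hx hd hlam (hf.symm_sub Q) hflat.hasFDerivAt
  have h2 := (differentiableAt_of_contDiffOn H.isOpen
    (hQ.comp_contDiffOn H.contDiffOn_matInv) hx).hasFDerivAt
  have h3 := h1.add h2
  rw [zero_add] at h3
  refine h3.congr_of_eventuallyEq ?_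
  filter_upwards [H.isOpen.mem_nhds hx] with y hy
  obtain ⟨μ, hμ⟩ := H.exists_isDiag hy
  simp [hμ.ofForms_sub]

lemma SmoothForms.eventually_differentiableAt (H : SmoothForms s g h) (hx : x ∈ s)
    (hd : IsDiag (g x) (h x) lam) (hlam : lam ∈ posCone) (hf : IsCurvatureFunction f) :
    ∀ᶠ y in 𝓝 x, DifferentiableAt ℝ (fun y => ofForms f (g y) (h y)) y := by
  obtain ⟨C, hC, hnear⟩ := H.exists_eventually_near hx hd
  filter_upwards [H.isOpen.mem_nhds hx,
    eventually_of_near (isOpen_posCone.mem_nhds hlam) hnear] with y hy ⟨μ, hμ1, hμ2, _⟩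
  -- The polynomial is chosen anew at each nearby point; only differentiability there is claimed.
  obtain ⟨Q, hQ, hflat⟩ := hf.exists_flat hμ1
  exact (H.hasFDerivAt_of_flat hy hμ2 hμ1 hf hQ hflat).differentiableAt

/-- A chain rule inequality that needs no differentiable choice of `μ'`: Lipschitz closeness of some
admissible value suffices. -/
lemma norm_fderiv_comp_le {r : Coord → ℝ} {v : E → ℝ} {μ : Coord} {y : E} {C : ℝ} (hC : 0 ≤ C)
    (hr : DifferentiableAt ℝ r μ) (hv : DifferentiableAt ℝ v y) (hvy : v y = r μ)
    (hnear : ∀ᶠ y' in 𝓝 y, ∃ μ', v y' = r μ' ∧ ‖μ' - μ‖ ≤ C * ‖y' - y‖) :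
    ‖fderiv ℝ v y‖ ≤ C * ‖fderiv ℝ r μ‖ := by
  refine le_of_forall_pos_le_add fun ε hε => ?_
  set δ := ε / (C + 1) with hδ
  have hδ0 : 0 < δ := by positivity
  have h1 : ‖fderiv ℝ v y‖ ≤ (‖fderiv ℝ r μ‖ + δ) * C := by
    refine hv.hasFDerivAt.le_of_lip' (by positivity) ?_
    have h2 := hr.hasFDerivAt.isLittleO.def hδ0
    filter_upwards [eventually_of_near h2 hnear] with y' ⟨μ', hμ1, hμ2, hμ3⟩
    have hμ1' : ‖r μ' - r μ - fderiv ℝ r μ (μ' - μ)‖ ≤ δ * ‖μ' - μ‖ := hμ1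
    rw [hμ2, hvy]
    calc ‖r μ' - r μ‖ = ‖(r μ' - r μ - fderiv ℝ r μ (μ' - μ)) + fderiv ℝ r μ (μ' - μ)‖ := by
          rw [sub_add_cancel]
      _ ≤ δ * ‖μ' - μ‖ + ‖fderiv ℝ r μ‖ * ‖μ' - μ‖ :=
          (norm_add_le _ _).trans (add_le_add hμ1' (ContinuousLinearMap.le_opNorm _ _))
      _ = (‖fderiv ℝ r μ‖ + δ) * ‖μ' - μ‖ := by ring
      _ ≤ (‖fderiv ℝ r μ‖ + δ) * (C * ‖y' - y‖) := by gcongr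
      _ = _ := by ring
  have h3 : δ * C ≤ ε := by
    rw [hδ, div_mul_eq_mul_div, div_le_iff₀ (by positivity)]
    nlinarith
  nlinarith

lemma SmoothForms.hasFDerivAt_fderiv_of_flat (H : SmoothForms s g h) (hx : x ∈ s)
    (hd : IsDiag (g x) (h x) lam) (hlam : lam ∈ posCone) (hf : IsCurvatureFunction f)
    {Q : Coord → ℝ} (hQ : ContDiff ℝ ∞ Q) (hflat : Flat lam (fun μ => f μ - Q (esymmVec μ))) :
    HasFDerivAt (fderiv ℝ (fun y => ofForms f (g y) (h y)))
      (fderiv ℝ (fderiv ℝ (fun y => Q (matInv ((g y)⁻¹ * h y)))) x) x := by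
  set r : Coord → ℝ := fun μ => f μ - Q (esymmVec μ) with hr
  set q : E → ℝ := fun y => Q (matInv ((g y)⁻¹ * h y)) with hq
  set v : E → ℝ := fun y => ofForms r (g y) (h y) with hv
  have hrs := hf.symm_sub Q
  have hqs : ContDiffOn ℝ ∞ q s := hQ.comp_contDiffOn H.contDiffOn_matInv
  have hvq : ∀ y ∈ s, v y = ofForms f (g y) (h y) - q y := by
    intro y hy
    obtain ⟨μ, hμ⟩ := H.exists_isDiag hy
    exact hμ.ofForms_sub Q
  have hvd : ∀ᶠ y in 𝓝 x, DifferentiableAt ℝ v y := by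
    filter_upwards [H.eventually_differentiableAt hx hd hlam hf, H.isOpen.mem_nhds hx] with y hy1 hy
    refine (hy1.sub (differentiableAt_of_contDiffOn H.isOpen hqs hy)).congr_of_eventuallyEq ?_
    filter_upwards [H.isOpen.mem_nhds hy] with y' hy' using hvq y' hy'
  have hv0 : fderiv ℝ v x = 0 := (H.hasFDerivAt_zero hx hd hlam hrs hflat.hasFDerivAt).fderiv
  -- The gradient of the pulled-back remainder at `y` is at most `C` times the gradient of `r` at
  -- nearby eigenvalues `μ`. Flatness makes the latter `o(‖μ - lam‖)`, hence `o(‖y - x‖)`, so the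
  -- remainder has zero second derivative at `x`.
  have key : HasFDerivAt (fderiv ℝ v) (0 : E →L[ℝ] E →L[ℝ] ℝ) x := by
    obtain ⟨C, hC, N, hN, hNs, hlip⟩ := H.exists_lipschitz hx
    obtain ⟨C', hC', hnear⟩ := H.exists_eventually_near hx hd
    rw [hasFDerivAt_iff_isLittleO, Asymptotics.isLittleO_iff]
    intro c hc
    have h1 := hflat.isLittleO.def (c := c / (C * C' + 1)) (by positivity)
    have h2 := Flat.eventually_differentiableAt hflat.contDiffAt
    filter_upwards [eventually_of_near
      (inter_mem (inter_mem h1 h2) (isOpen_posCone.mem_nhds hlam)) hnear, hvd,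
      eventually_mem_nhds_iff.2 hN] with y ⟨μ, ⟨⟨hμ1, hμd⟩, hμ2⟩, hμ3, hμ4⟩ hyd hyN
    have hμ1' : ‖fderiv ℝ r μ‖ ≤ c / (C * C' + 1) * ‖μ - lam‖ := hμ1
    have h3 : ‖fderiv ℝ v y‖ ≤ C * ‖fderiv ℝ r μ‖ := by
      refine norm_fderiv_comp_le hC hμd hyd (hμ3.ofForms_eq hrs hμ2) ?_
      have h4 : ∀ᶠ y' in 𝓝 y, ∃ μ', IsDiag (g y') (h y') μ' ∧ ‖μ' - μ‖ ≤ C * ‖y' - y‖ := by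
        filter_upwards [hyN] with y' hy'
        obtain ⟨μ', hμ'⟩ := H.exists_isDiag (hNs hy')
        obtain ⟨σ, hσ⟩ := hlip y (mem_of_mem_nhds hyN) y' hy' μ μ' hμ3 hμ'
        exact ⟨μ' ∘ σ, hμ'.comp_perm σ, by rwa [norm_sub_rev, norm_sub_rev y']⟩
      filter_upwards [eventually_of_near (isOpen_posCone.mem_nhds hμ2) h4] with y'
        ⟨μ', hμ'1, hμ'2, hμ'3⟩
      exact ⟨μ', hμ'2.ofForms_eq hrs hμ'1, hμ'3⟩
    simp only [hv0, sub_zero, zero_apply]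
    calc ‖fderiv ℝ v y‖ ≤ C * ‖fderiv ℝ r μ‖ := h3
      _ ≤ C * (c / (C * C' + 1) * (C' * ‖y - x‖)) := by
          gcongr
          exact hμ1'.trans (by gcongr)
      _ = c * ‖y - x‖ * (C * C' / (C * C' + 1)) := by ring
      _ ≤ c * ‖y - x‖ * 1 := by
          gcongr
          rw [div_le_one (by positivity)]
          linarith
      _ = _ := by ring
  have h5 : DifferentiableAt ℝ (fderiv ℝ q) x :=
    ((hqs.contDiffAt (H.isOpen.mem_nhds hx)).fderiv_right (m := 1) (by norm_cast)).differentiableAt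
      (by simp)
  have h6 := key.add h5.hasFDerivAt
  rw [zero_add] at h6
  refine h6.congr_of_eventuallyEq ?_
  filter_upwards [hvd, H.isOpen.mem_nhds hx] with y hy1 hy
  have h7 := differentiableAt_of_contDiffOn H.isOpen hqs hy
  rw [Pi.add_apply, ← fderiv_fun_add hy1 h7]
  refine Filter.EventuallyEq.fderiv_eq ?_
  filter_upwards [H.isOpen.mem_nhds hy] with y' hy'
  rw [hvq y' hy', sub_add_cancel]

end

/-! ### Derivatives of the invariants at a diagonal matrix -/

section

variable {E : Type*} [NormedAddCommGroup E] [NormedSpace ℝ E] {s : Set E} {x : E} {v w : E}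

lemma dirD_comp_coord {Q : Coord → ℝ} {e : E → Coord} (hQ : DifferentiableAt ℝ Q (e x))
    (he : DifferentiableAt ℝ e x) :
    dirD v (fun y => Q (e y)) x = ∑ m, pd m Q (e x) * dirD v (fun y => e y m) x := by
  have h1 : fderiv ℝ (fun y => Q (e y)) x = (fderiv ℝ Q (e x)).comp (fderiv ℝ e x) :=
    fderiv_comp x hQ he
  have h2 : ∀ m, dirD v (fun y => e y m) x = (fderiv ℝ e x v) m := by
    intro m
    rw [dirD, fderiv_apply he]
    rfl
  rw [dirD, h1, ContinuousLinearMap.comp_apply]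
  conv_lhs => rw [pi_eq_sum_univ' (fderiv ℝ e x v)]
  rw [map_sum]
  refine Finset.sum_congr rfl fun m _ => ?_
  rw [map_smul, smul_eq_mul, h2, mul_comm]
  rfl

lemma contDiff_pd {Q : Coord → ℝ} (hQ : ContDiff ℝ ∞ Q) (m : Fin 3) : ContDiff ℝ ∞ (pd m Q) :=
  contDiffOn_univ.1 (contDiffOn_dirD isOpen_univ hQ.contDiffOn)

lemma dirD₂_comp_coord (hs : IsOpen s) (hx : x ∈ s) {Q : Coord → ℝ} {e : E → Coord}
    (hQ : ContDiff ℝ ∞ Q) (he : ContDiffOn ℝ ∞ e s) :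
    dirD v (dirD w (fun y => Q (e y))) x
      = ∑ m, ((∑ n, pd n (pd m Q) (e x) * dirD v (fun y => e y n) x) * dirD w (fun y => e y m) x
        + pd m Q (e x) * dirD v (dirD w (fun y => e y m)) x) := by
  have hQd : ∀ m z, DifferentiableAt ℝ (pd m Q) z := fun m z =>
    (contDiff_pd hQ m).contDiffAt.differentiableAt (by simp)
  have hed : ∀ y ∈ s, DifferentiableAt ℝ e y := fun y hy => differentiableAt_of_contDiffOn hs he hy
  have hem : ∀ m, ContDiffOn ℝ ∞ (fun y => e y m) s := fun m => contDiffOn_pi.1 he m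
  have hemd : ∀ m, DifferentiableAt ℝ (dirD w (fun y => e y m)) x := fun m =>
    differentiableAt_of_contDiffOn hs (contDiffOn_dirD hs (hem m)) hx
  have hQe : ∀ m, DifferentiableAt ℝ (fun y => pd m Q (e y)) x := fun m =>
    (hQd m (e x)).comp x (hed x hx)
  rw [dirD_congr_on hs (fun y hy => dirD_comp_coord
    (hQ.contDiffAt.differentiableAt (by simp)) (hed y hy)) x hx,
    dirD_sum _ fun m _ => (hQe m).fun_mul (hemd m)]
  refine Finset.sum_congr rfl fun m _ => ?_
  rw [dirD_mul (hQe m) (hemd m), dirD_comp_coord (hQd m _) (hed x hx)]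

variable {A : E → Matrix (Fin 3) (Fin 3) ℝ} {lam : Coord}

/-- Off-diagonal entries enter the invariants only in products of at least two of them, so at a
diagonal matrix the first derivatives see the diagonal alone. -/
lemma dirD_matInv (hs : IsOpen s) (hx : x ∈ s) (hA : ∀ i j, ContDiffOn ℝ ∞ (fun y => A y i j) s)
    (hAx : A x = .diagonal lam) :
    dirD v (fun y => matInv (A y) 0) x = dirD v (fun y => A y 0 0) x + dirD v (fun y => A y 1 1) x
        + dirD v (fun y => A y 2 2) x ∧
    dirD v (fun y => matInv (A y) 1) x = dirD v (fun y => A y 0 0) x * (lam 1 + lam 2)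
        + dirD v (fun y => A y 1 1) x * (lam 0 + lam 2)
        + dirD v (fun y => A y 2 2) x * (lam 0 + lam 1) ∧
    dirD v (fun y => matInv (A y) 2) x = dirD v (fun y => A y 0 0) x * (lam 1 * lam 2)
        + dirD v (fun y => A y 1 1) x * (lam 0 * lam 2)
        + dirD v (fun y => A y 2 2) x * (lam 0 * lam 1) := by
  have hd : ∀ i j, DifferentiableAt ℝ (fun y => A y i j) x := fun i j =>
    differentiableAt_of_contDiffOn hs (hA i j) hx
  have e : ∀ i j, A x i j = if i = j then lam i else 0 := by
    intro i j; rw [hAx, Matrix.diagonal_apply]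
  refine ⟨?_, ?_, ?_⟩ <;> simp only [matInv, Matrix.cons_val]
  · simp (disch := fun_prop) only [dirD_add]
  · simp (disch := fun_prop) only [dirD_add, dirD_sub, dirD_mul]
    simp [e]
    ring
  · simp (disch := fun_prop) only [dirD_add, dirD_sub, dirD_mul]
    simp [e]
    ring

/-- The `c i j` are polarized `2 × 2` minors of the first derivatives. Their off-diagonal products
are the origin of the difference quotients in second derivatives of functions of eigenvalues. -/
lemma dirD₂_matInv (hs : IsOpen s) (hx : x ∈ s) (hA : ∀ i j, ContDiffOn ℝ ∞ (fun y => A y i j) s)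
    (hAx : A x = .diagonal lam) {c : Fin 3 → Fin 3 → ℝ}
    (hc : ∀ i j, c i j = dirD v (fun y => A y i i) x * dirD w (fun y => A y j j) x
      + dirD w (fun y => A y i i) x * dirD v (fun y => A y j j) x
      - dirD v (fun y => A y i j) x * dirD w (fun y => A y j i) x
      - dirD w (fun y => A y i j) x * dirD v (fun y => A y j i) x) :
    dirD v (dirD w (fun y => matInv (A y) 0)) x = dirD v (dirD w (fun y => A y 0 0)) x
        + dirD v (dirD w (fun y => A y 1 1)) x + dirD v (dirD w (fun y => A y 2 2)) x ∧
    dirD v (dirD w (fun y => matInv (A y) 1)) x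
      = dirD v (dirD w (fun y => A y 0 0)) x * (lam 1 + lam 2)
        + dirD v (dirD w (fun y => A y 1 1)) x * (lam 0 + lam 2)
        + dirD v (dirD w (fun y => A y 2 2)) x * (lam 0 + lam 1)
        + (c 0 1 + c 0 2 + c 1 2) ∧
    dirD v (dirD w (fun y => matInv (A y) 2)) x
      = dirD v (dirD w (fun y => A y 0 0)) x * (lam 1 * lam 2)
        + dirD v (dirD w (fun y => A y 1 1)) x * (lam 0 * lam 2)
        + dirD v (dirD w (fun y => A y 2 2)) x * (lam 0 * lam 1)
        + (c 0 1 * lam 2 + c 0 2 * lam 1 + c 1 2 * lam 0) := by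
  have hd : ∀ i j, DifferentiableAt ℝ (fun y => A y i j) x := fun i j =>
    differentiableAt_of_contDiffOn hs (hA i j) hx
  have e : ∀ i j, A x i j = if i = j then lam i else 0 := by
    intro i j; rw [hAx, Matrix.diagonal_apply]
  refine ⟨?_, ?_, ?_⟩ <;> simp only [matInv, Matrix.cons_val]
  · simp (disch := fun_prop) only [dirD₂_add hs hx]
  · simp (disch := fun_prop) only [dirD₂_add hs hx, dirD₂_sub hs hx, dirD₂_mul hs hx]
    simp [e, hc]
    ring
  · simp (disch := fun_prop) only [dirD₂_add hs hx, dirD₂_sub hs hx, dirD₂_mul hs hx, dirD_mul]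
    simp [e, hc]
    ring

end

lemma matInv_diagonal (μ : Coord) : matInv (.diagonal μ) = esymmVec μ := by
  simp [matInv, esymmVec, mul_assoc]

/-- The gradients of the elementary symmetric functions. -/
def esymmGrad (lam : Coord) (i : Fin 3) : Coord :=
  ![1, lam 0 + lam 1 + lam 2 - lam i, ![lam 1 * lam 2, lam 0 * lam 2, lam 0 * lam 1] i]

/-- The second derivatives of the elementary symmetric functions. -/
def esymmHess (lam : Coord) (i j : Fin 3) : Coord :=
  if i = j then 0 else
    ![0, 1, lam 0 + lam 1 + lam 2 - lam i - lam j]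

lemma contDiffOn_diagonal (i j : Fin 3) :
    ContDiffOn ℝ ∞ (fun μ : Coord => Matrix.diagonal μ i j) Set.univ := by
  by_cases hij : i = j
  · subst hij
    simpa using (contDiff_apply ℝ ℝ i).contDiffOn
  · simpa [hij] using contDiffOn_const

lemma dirD_diagonal (v : Coord) (lam : Coord) (i j : Fin 3) :
    dirD v (fun μ : Coord => Matrix.diagonal μ i j) lam = if i = j then v i else 0 := by
  by_cases hij : i = j
  · subst hij
    simp [dirD, fderiv_apply]
  · simp [hij, dirD]

lemma dirD₂_diagonal (v w : Coord) (lam : Coord) (i j : Fin 3) :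
    dirD v (dirD w (fun μ : Coord => Matrix.diagonal μ i j)) lam = 0 := by
  have : dirD w (fun μ : Coord => Matrix.diagonal μ i j) = fun _ => if i = j then w i else 0 :=
    funext fun μ => dirD_diagonal w μ i j
  rw [this, dirD_const]

/-- The special case of `dirD_matInv` for the family of diagonal matrices. -/
lemma pd_esymmVec (lam : Coord) (i m : Fin 3) :
    pd i (fun μ => esymmVec μ m) lam = esymmGrad lam i m := by
  simp only [← matInv_diagonal]
  obtain ⟨h0, h1, h2⟩ := dirD_matInv (v := Pi.single i 1) isOpen_univ (Set.mem_univ lam)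
    contDiffOn_diagonal rfl
  simp only [dirD_diagonal, if_true] at h0 h1 h2
  rw [pd_eq_dirD]
  fin_cases m
  · refine h0.trans ?_
    fin_cases i <;> simp [esymmGrad]
  · refine h1.trans ?_
    fin_cases i <;> simp [esymmGrad] <;> ring
  · refine h2.trans ?_
    fin_cases i <;> simp [esymmGrad]

lemma pd₂_esymmVec (lam : Coord) (i j m : Fin 3) :
    pd j (pd i (fun μ => esymmVec μ m)) lam = esymmHess lam i j m := by
  simp only [← matInv_diagonal]
  obtain ⟨h0, h1, h2⟩ := dirD₂_matInv (v := Pi.single j 1) (w := Pi.single i 1) isOpen_univ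
    (Set.mem_univ lam) contDiffOn_diagonal rfl (fun i j => rfl)
  simp only [dirD_diagonal, dirD₂_diagonal] at h0 h1 h2
  rw [pd_eq_dirD, pd_eq_dirD]
  fin_cases m
  · refine h0.trans ?_
    fin_cases i <;> fin_cases j <;> simp [esymmHess]
  · refine h1.trans ?_
    fin_cases i <;> fin_cases j <;> simp [esymmHess]
  · refine h2.trans ?_
    fin_cases i <;> fin_cases j <;> simp [esymmHess] <;> ring

lemma contDiff_esymmVec : ContDiff ℝ ∞ esymmVec := by
  have h : ∀ i, ContDiff ℝ ∞ (fun μ : Coord => μ i) := fun i => contDiff_apply ℝ ℝ i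
  rw [contDiff_pi]
  intro i
  fin_cases i
  · exact ((h 0).add (h 1)).add (h 2)
  · exact (((h 0).mul (h 1)).add ((h 0).mul (h 2))).add ((h 1).mul (h 2))
  · exact ((h 0).mul (h 1)).mul (h 2)

/-! ### Partial derivatives and difference quotients of symmetric functions -/

section

variable {f Q : Coord → ℝ} {lam : Coord}

lemma Flat.pd_eq_zero (h : Flat lam f) (i : Fin 3) : pd i f lam = 0 := by
  rw [pd, h.fderiv_eq_zero]
  rfl

lemma Flat.pd₂_eq_zero (h : Flat lam f) (i j : Fin 3) : pd j (pd i f) lam = 0 := by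
  have h1 : HasFDerivAt (pd i f) (0 : Coord →L[ℝ] ℝ) lam := by
    rw [hasFDerivAt_iff_isLittleO]
    simp only [h.pd_eq_zero, sub_zero, zero_apply]
    refine Asymptotics.IsBigO.trans_isLittleO ?_ h.isLittleO
    refine Asymptotics.IsBigO.of_bound 1 (Eventually.of_forall fun μ => ?_)
    refine ((fderiv ℝ f μ).le_opNorm _).trans ?_
    rw [Pi.norm_single, norm_one, mul_one, one_mul]
  rw [pd, h1.fderiv]
  rfl

lemma differentiableAt_pd (hf : ContDiffAt ℝ 2 f lam) (i : Fin 3) :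
    DifferentiableAt ℝ (pd i f) lam :=
  ((hf.fderiv_right (m := 1) (by norm_num)).differentiableAt (by simp)).clm_apply
    (differentiableAt_const _)

lemma Flat.pd_eq (hf : ContDiffAt ℝ 2 f lam) (hQ : ContDiff ℝ ∞ Q)
    (h : Flat lam (fun μ => f μ - Q (esymmVec μ))) (i : Fin 3) :
    pd i f lam = ∑ m, pd m Q (esymmVec lam) * esymmGrad lam i m := by
  have hQe : ContDiff ℝ ∞ (fun μ => Q (esymmVec μ)) := hQ.comp contDiff_esymmVec
  have h1 := h.pd_eq_zero i
  have h2 := dirD_sub (v := Pi.single i 1) (hf.differentiableAt (by simp))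
    (hQe.contDiffAt.differentiableAt (by simp)) (x := lam)
  have h3 := dirD_comp_coord (v := Pi.single i 1) (x := lam) (e := esymmVec)
    (hQ.contDiffAt.differentiableAt (by simp))
    (contDiff_esymmVec.contDiffAt.differentiableAt (by simp))
  simp only [← pd_eq_dirD, pd_esymmVec] at h2 h3
  rw [← h3]
  linarith

lemma Flat.pd₂_eq (hf : ContDiffAt ℝ 2 f lam) (hQ : ContDiff ℝ ∞ Q)
    (h : Flat lam (fun μ => f μ - Q (esymmVec μ))) (i j : Fin 3) :
    pd j (pd i f) lam = ∑ m, ((∑ n, pd n (pd m Q) (esymmVec lam) * esymmGrad lam j n)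
      * esymmGrad lam i m + pd m Q (esymmVec lam) * esymmHess lam i j m) := by
  have hQe : ContDiff ℝ ∞ (fun μ => Q (esymmVec μ)) := hQ.comp contDiff_esymmVec
  have h1 := h.pd₂_eq_zero i j
  have h2 : pd i (fun μ => f μ - Q (esymmVec μ)) =ᶠ[𝓝 lam]
      fun μ => pd i f μ - pd i (fun μ => Q (esymmVec μ)) μ := by
    filter_upwards [Flat.eventually_differentiableAt hf] with μ hμ
    exact dirD_sub hμ (hQe.contDiffAt.differentiableAt (by simp))
  have h3 := dirD_congr (v := Pi.single j 1) h2
  rw [dirD_sub (differentiableAt_pd hf i)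
    ((contDiff_pd hQe i).contDiffAt.differentiableAt (by simp))] at h3
  have h4 := dirD₂_comp_coord (v := Pi.single j 1) (w := Pi.single i 1) isOpen_univ
    (Set.mem_univ lam) hQ contDiff_esymmVec.contDiffOn
  simp only [← pd_eq_dirD, pd_esymmVec, pd₂_esymmVec] at h3 h4
  rw [← h4]
  linarith

lemma pd_comm (hf : ContDiffAt ℝ 2 f lam) (i j : Fin 3) :
    pd j (pd i f) lam = pd i (pd j f) lam := by
  have h2 : DifferentiableAt ℝ (fderiv ℝ f) lam :=
    (hf.fderiv_right (m := 1) (by norm_num)).differentiableAt (by simp)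
  have key : ∀ a b : Fin 3, pd a (pd b f) lam
      = fderiv ℝ (fderiv ℝ f) lam (Pi.single a 1) (Pi.single b 1) := by
    intro a b
    have : pd b f = fun y => fderiv ℝ f y (Pi.single b 1) := rfl
    rw [pd, this, fderiv_clm_apply h2 (differentiableAt_const _)]
    simp
  rw [key, key, (hf.isSymmSndFDerivAt (by simp)).eq]

lemma IsCurvatureFunction.pd_swap (hf : IsCurvatureFunction f) {μ : Coord} (hμ : μ ∈ posCone)
    (i j : Fin 3) : pd j f μ = pd i f (μ ∘ Equiv.swap i j) := by
  set σ := Equiv.swap i j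
  have h1 : HasFDerivAt f (fderiv ℝ f (μ ∘ σ)) (Flat.permCLM σ μ) :=
    ((hf.contDiffAt (comp_perm_mem_posCone hμ σ)).differentiableAt (by simp)).hasFDerivAt
  have h2 := h1.comp μ (Flat.permCLM σ).hasFDerivAt
  have h3 : HasFDerivAt f ((fderiv ℝ f (μ ∘ σ)).comp (Flat.permCLM σ)) μ := by
    refine h2.congr_of_eventuallyEq ?_
    filter_upwards [isOpen_posCone.mem_nhds hμ] with ν hν
    exact (hf.symm σ ν hν).symm
  have h4 : Flat.permCLM σ (Pi.single j 1) = (Pi.single i 1 : Coord) := by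
    rw [Flat.permCLM_apply]
    ext k
    have : σ k = j ↔ k = i := by
      rw [← Equiv.swap_apply_left i j]
      exact σ.injective.eq_iff
    simp [Pi.single_apply, this]
  rw [pd, h3.fderiv, ContinuousLinearMap.comp_apply, h4]
  rfl

/-- Without this, the limit taken in `quot` would not be uniquely determined. -/
instance neBot_nhdsWithin_ne (i j : Fin 3) (lam : Coord) [hij : Fact (i ≠ j)] :
    NeBot (𝓝[{μ : Coord | μ i ≠ μ j}] lam) := by
  rw [← mem_closure_iff_nhdsWithin_neBot]
  by_cases h : lam i = lam j
  · refine mem_closure_of_tendsto (b := 𝓝[≠] (0 : ℝ)) (f := fun s => lam + s • Pi.single i 1) ?_ ?_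
    · have : ContinuousAt (fun s : ℝ => lam + s • (Pi.single i 1 : Coord)) 0 := by fun_prop
      simpa using this.tendsto.mono_left nhdsWithin_le_nhds
    · filter_upwards [self_mem_nhdsWithin] with s hs
      have hs' : s ≠ 0 := hs
      simp [h, hs', hij.out.symm]
  · exact subset_closure h

/-- Symmetry gives `f_j(μ) = f_i(μ ∘ σ)` for the transposition `σ` of `i` and `j`, and `μ - μ ∘ σ =
(μ_i - μ_j)(e_i - e_j)`. As both `μ` and `μ ∘ σ` vary, strict differentiability of `f_i` at `lam` is
what is needed. -/
lemma IsCurvatureFunction.tendsto_diffQuot (hf : IsCurvatureFunction f) (hlam : lam ∈ posCone)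
    {i j : Fin 3} (h : lam i = lam j) :
    Tendsto (fun μ => (pd i f μ - pd j f μ) / (μ i - μ j)) (𝓝[{μ : Coord | μ i ≠ μ j}] lam)
      (𝓝 (pd i (pd i f) lam - pd j (pd i f) lam)) := by
  set σ := Equiv.swap i j with hσ
  have hlamσ : lam ∘ σ = lam := by
    ext k
    simp only [Function.comp_apply, hσ, Equiv.swap_apply_def]
    split_ifs with h1 h2
    · rw [h1, h]
    · rw [h2, h]
    · rfl
  set φ := pd i f with hφ
  set φ' := fderiv ℝ φ lam with hφ'
  have hstrict : HasStrictFDerivAt φ φ' lam := by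
    have : ContDiffAt ℝ 1 φ lam :=
      ((hf.contDiffAt hlam).fderiv_right (m := 1) (by norm_num)).clm_apply contDiffAt_const
    exact this.hasStrictFDerivAt (by simp)
  have hlim : Tendsto (fun μ : Coord => (μ, μ ∘ σ)) (𝓝 lam) (𝓝 (lam, lam)) := by
    have h1 : Tendsto (Flat.permCLM σ) (𝓝 lam) (𝓝 (Flat.permCLM σ lam)) :=
      (Flat.permCLM σ).continuous.continuousAt
    rw [Flat.permCLM_apply, hlamσ] at h1
    rw [nhds_prod_eq]
    exact tendsto_id.prodMk h1
  have hdiff : ∀ μ : Coord, μ - μ ∘ σ = (μ i - μ j) • (Pi.single i 1 - Pi.single j 1 : Coord) := by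
    intro μ
    ext k
    simp only [Pi.sub_apply, Function.comp_apply, hσ, Equiv.swap_apply_def, Pi.smul_apply,
      Pi.single_apply, smul_eq_mul]
    split_ifs with h1 h2 h2
    · subst h1; subst h2; simp
    · subst h1; simp
    · subst h2; simp
    · simp
  have h1 : (fun μ : Coord => φ μ - φ (μ ∘ σ) - φ' (μ - μ ∘ σ)) =o[𝓝 lam]
      fun μ : Coord => μ - μ ∘ σ := hstrict.isLittleO.comp_tendsto hlim
  have h2 : (fun μ : Coord => φ μ - φ (μ ∘ σ) - φ' (μ - μ ∘ σ)) =o[𝓝 lam]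
      fun μ : Coord => μ i - μ j := by
    refine h1.trans_isBigO ?_
    refine Asymptotics.IsBigO.of_bound ‖(Pi.single i 1 - Pi.single j 1 : Coord)‖
      (Eventually.of_forall fun μ => ?_)
    rw [hdiff, norm_smul, mul_comm]
  have h3 := (h2.mono nhdsWithin_le_nhds : _ =o[𝓝[{μ : Coord | μ i ≠ μ j}] lam] _)
    |>.tendsto_div_nhds_zero
  have h4 := h3.add_const (pd i φ lam - pd j φ lam)
  rw [zero_add] at h4
  refine h4.congr' ?_
  filter_upwards [self_mem_nhdsWithin, nhdsWithin_le_nhds (isOpen_posCone.mem_nhds hlam)] with μ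
    hμ hμ'
  have hne : μ i - μ j ≠ 0 := sub_ne_zero.2 hμ
  have h5 : φ' (μ - μ ∘ σ) = (μ i - μ j) * (pd i φ lam - pd j φ lam) := by
    rw [hdiff, map_smul, map_sub]
    rfl
  rw [h5, hf.pd_swap hμ' i j]
  field_simp
  ring

lemma quot_of_tendsto {i j : Fin 3} (hij : i ≠ j) {N : Coord → ℝ} {L : ℝ} (h : lam i = lam j)
    (hN : Tendsto (fun μ => N μ / (μ i - μ j)) (𝓝[{μ : Coord | μ i ≠ μ j}] lam) (𝓝 L)) :
    quot i j N lam = L := by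
  have : Fact (i ≠ j) := ⟨hij⟩
  rw [quot, if_pos h]
  exact hN.limUnder_eq

lemma IsCurvatureFunction.diffQuot_of_eq (hf : IsCurvatureFunction f) (hlam : lam ∈ posCone)
    {i j : Fin 3} (hij : i ≠ j) (h : lam i = lam j) :
    diffQuot i j f lam = pd i (pd i f) lam - pd j (pd i f) lam :=
  quot_of_tendsto hij h (hf.tendsto_diffQuot hlam h)

/-- Quotients of combinations of differences of partial derivatives reduce to `diffQuot`. -/
lemma quot_mul_sub_mul {w k l : Coord → ℝ} (hf : IsCurvatureFunction f)
    (hw : IsCurvatureFunction w) (hlam : lam ∈ posCone) {i j : Fin 3} (hij : i ≠ j)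
    (hk : ContinuousAt k lam) (hl : ContinuousAt l lam) :
    quot i j (fun μ => k μ * (pd i f μ - pd j f μ) - l μ * (pd i w μ - pd j w μ)) lam
      = k lam * diffQuot i j f lam - l lam * diffQuot i j w lam := by
  by_cases h : lam i = lam j
  · rw [hf.diffQuot_of_eq hlam hij h, hw.diffQuot_of_eq hlam hij h]
    refine quot_of_tendsto hij h ?_
    refine (((hk.tendsto.mono_left nhdsWithin_le_nhds).mul (hf.tendsto_diffQuot hlam h)).sub
      ((hl.tendsto.mono_left nhdsWithin_le_nhds).mul (hw.tendsto_diffQuot hlam h))).congr ?_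
    intro μ
    ring
  · simp only [diffQuot, quot, if_neg h]
    ring

/-- For distinct eigenvalues, the gradients of the second and third elementary symmetric functions
have differences `-(λ_i - λ_j)` and `-(λ_i - λ_j) λ_k`, with `k` the third index, and the quotient
cancels exactly. For equal ones the gradients coincide, and the limit `f_ii - f_ij` leaves the same
expression, coming from the mixed second derivatives. -/
lemma Flat.diffQuot_eq (hf : IsCurvatureFunction f) (hlam : lam ∈ posCone) (hQ : ContDiff ℝ ∞ Q)
    (h : Flat lam (fun μ => f μ - Q (esymmVec μ))) {i j : Fin 3} (hij : i ≠ j) :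
    diffQuot i j f lam = -(pd 1 Q (esymmVec lam)
      + pd 2 Q (esymmVec lam) * (lam 0 + lam 1 + lam 2 - lam i - lam j)) := by
  have hf2 := hf.contDiffAt hlam
  by_cases hl : lam i = lam j
  · rw [hf.diffQuot_of_eq hlam hij hl, h.pd₂_eq hf2 hQ, h.pd₂_eq hf2 hQ]
    have hg : esymmGrad lam i = esymmGrad lam j := by
      fin_cases i <;> fin_cases j <;> simp_all [esymmGrad, mul_comm]
      ring
    rw [← hg]
    simp [Fin.sum_univ_three, esymmHess, hij]
    ring
  · simp only [diffQuot, quot, if_neg hl]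
    rw [h.pd_eq hf2 hQ, h.pd_eq hf2 hQ]
    have hne := sub_ne_zero.2 hl
    rw [div_eq_iff hne]
    fin_cases i <;> fin_cases j <;> simp_all [Fin.sum_univ_three, esymmGrad] <;> ring

end

/-! ### The chain rule for functions of the principal curvatures -/

section

variable {E : Type*} [NormedAddCommGroup E] [NormedSpace ℝ E] {s : Set E}
  {g h : E → Matrix (Fin 3) (Fin 3) ℝ} {x : E} {lam : Coord} {f : Coord → ℝ}

lemma SmoothForms.dirD_ofForms (H : SmoothForms s g h) (hx : x ∈ s)
    (hd : IsDiag (g x) (h x) lam) (hA : (g x)⁻¹ * h x = .diagonal lam) (hlam : lam ∈ posCone)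
    (hf : IsCurvatureFunction f) (v : E) :
    dirD v (fun y => ofForms f (g y) (h y)) x
      = ∑ i, pd i f lam * dirD v (fun y => ((g y)⁻¹ * h y) i i) x := by
  obtain ⟨Q, hQ, hflat⟩ := hf.exists_flat hlam
  have hf2 := hf.contDiffAt hlam
  rw [dirD, (H.hasFDerivAt_of_flat hx hd hlam hf hQ hflat).fderiv]
  have h1 := dirD_comp_coord (v := v) (x := x) (e := fun y => matInv ((g y)⁻¹ * h y))
    (hQ.contDiffAt.differentiableAt (by simp))
    (differentiableAt_of_contDiffOn H.isOpen H.contDiffOn_matInv hx)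
  obtain ⟨e0, e1, e2⟩ := dirD_matInv (v := v) H.isOpen hx H.contDiffOn_inv_mul hA
  refine h1.trans ?_
  rw [hA, matInv_diagonal]
  simp only [Fin.sum_univ_three, e0, e1, e2, hflat.pd_eq hf2 hQ, esymmGrad, Matrix.cons_val]
  ring

/-- After replacing `f` by `Q` of the invariants, the off-diagonal products `d i j * d j i` carry
the weight `-(Q₁ + Q₂ λ_k)` up to the factor `2` (`k` the third index, invariants numbered from
`0`). By `Flat.diffQuot_eq` this weight is the difference quotient. -/
lemma SmoothForms.dirD₂_ofForms (H : SmoothForms s g h) (hx : x ∈ s)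
    (hd : IsDiag (g x) (h x) lam) (hA : (g x)⁻¹ * h x = .diagonal lam) (hlam : lam ∈ posCone)
    (hf : IsCurvatureFunction f) (v : E) {d : Fin 3 → Fin 3 → ℝ}
    (hdv : ∀ i j, d i j = dirD v (fun y => ((g y)⁻¹ * h y) i j) x) :
    dirD v (dirD v (fun y => ofForms f (g y) (h y))) x
      = ∑ i, pd i f lam * dirD v (dirD v (fun y => ((g y)⁻¹ * h y) i i)) x
        + hessForm f lam (d 0 0) (d 1 1) (d 2 2)
        + 2 * (diffQuot 0 1 f lam * (d 0 1 * d 1 0) + diffQuot 0 2 f lam * (d 0 2 * d 2 0)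
          + diffQuot 1 2 f lam * (d 1 2 * d 2 1)) := by
  obtain ⟨Q, hQ, hflat⟩ := hf.exists_flat hlam
  have hf2 := hf.contDiffAt hlam
  set q : E → ℝ := fun y => Q (matInv ((g y)⁻¹ * h y)) with hq
  have hqs : ContDiffOn ℝ ∞ q s := hQ.comp_contDiffOn H.contDiffOn_matInv
  have h2 : ∀ {u : E → ℝ}, DifferentiableAt ℝ (fderiv ℝ u) x →
      dirD v (dirD v u) x = fderiv ℝ (fderiv ℝ u) x v v := by
    intro u hu
    have : dirD v u = fun y => fderiv ℝ u y v := rfl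
    rw [dirD, this, fderiv_clm_apply hu (differentiableAt_const _)]
    simp
  have h3 := H.hasFDerivAt_fderiv_of_flat hx hd hlam hf hQ hflat
  have h4 : DifferentiableAt ℝ (fderiv ℝ q) x :=
    ((hqs.contDiffAt (H.isOpen.mem_nhds hx)).fderiv_right (m := 1) (by norm_cast)).differentiableAt
      (by simp)
  rw [h2 h3.differentiableAt, h3.fderiv, ← h2 h4]
  have h1 := dirD₂_comp_coord (v := v) (w := v) H.isOpen hx hQ H.contDiffOn_matInv
  obtain ⟨e0, e1, e2⟩ := dirD_matInv (v := v) H.isOpen hx H.contDiffOn_inv_mul hA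
  obtain ⟨c0, c1, c2⟩ := dirD₂_matInv (v := v) (w := v) H.isOpen hx H.contDiffOn_inv_mul hA
    (fun i j => rfl)
  simp only [← hdv] at e0 e1 e2 c0 c1 c2
  refine h1.trans ?_
  rw [hA, matInv_diagonal]
  have hQ2 : ContDiffAt ℝ 2 Q (esymmVec lam) := contDiffAt_infty.1 hQ.contDiffAt 2
  rw [hflat.diffQuot_eq hf hlam hQ (by decide), hflat.diffQuot_eq hf hlam hQ (by decide),
    hflat.diffQuot_eq hf hlam hQ (by decide), hessForm]
  simp only [Fin.sum_univ_three, e0, e1, e2, c0, c1, c2, hflat.pd_eq hf2 hQ, hflat.pd₂_eq hf2 hQ,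
    esymmGrad, esymmHess, Matrix.cons_val]
  simp only [pd_comm hQ2 1 0, pd_comm hQ2 2 0, pd_comm hQ2 2 1]
  simp
  ring

end

/-! ### Hypersurfaces and the Weingarten equation -/

/-- A smooth hypersurface patch with unit normal `ν`. -/
structure IsHypersurface (s : Set Coord) (X ν : Coord → Ambient) : Prop where
  isOpen : IsOpen s
  smooth : ContDiffOn ℝ ∞ X s
  smooth_normal : ContDiffOn ℝ ∞ ν s
  posDef : ∀ y ∈ s, (metric X y).PosDef
  unit : ∀ y ∈ s, inner ℝ (ν y) (ν y) = (1 : ℝ)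
  normal : ∀ y ∈ s, ∀ i, inner ℝ (pd i X y) (ν y) = (0 : ℝ)

section Calculus

variable {V : Type*} [NormedAddCommGroup V] [NormedSpace ℝ V] {s : Set Coord} {u : Coord → V}

lemma contDiffOn_pd (hs : IsOpen s) (hu : ContDiffOn ℝ ∞ u s) (i : Fin 3) :
    ContDiffOn ℝ ∞ (pd i u) s := contDiffOn_dirD hs hu

lemma pd_comm_of_contDiffOn (hs : IsOpen s) (hu : ContDiffOn ℝ ∞ u s) (i j : Fin 3) :
    ∀ y ∈ s, pd i (pd j u) y = pd j (pd i u) y := fun _ hy => dirD_comm hs hu hy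

/-- Differentiates `b = g a` where `g` is the identity with vanishing first derivative. It gives
derivatives of `A = g⁻¹h` from `gA = h` without differentiating an inverse matrix. -/
lemma pd_of_eq_sum_mul (hs : IsOpen s) {x : Coord} (hx : x ∈ s) {g a : Fin 3 → Coord → ℝ}
    {b : Coord → ℝ} {i v : Fin 3} (hg : ∀ l, ContDiffOn ℝ ∞ (g l) s)
    (ha : ∀ l, ContDiffOn ℝ ∞ (a l) s) (hb : ∀ y ∈ s, b y = ∑ l, g l y * a l y)
    (hgv : ∀ l, pd v (g l) x = 0) (hgx : ∀ l, g l x = if i = l then 1 else 0) :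
    pd v (a i) x = pd v b x ∧
      pd v (pd v (a i)) x = pd v (pd v b) x - ∑ l, pd v (pd v (g l)) x * a l x := by
  have hg1 := fun l => differentiableAt_of_contDiffOn hs (hg l) hx
  have ha1 := fun l => differentiableAt_of_contDiffOn hs (ha l) hx
  constructor
  · have e1 := dirD_congr_on (v := Pi.single v 1) hs hb x hx
    rw [dirD_sum _ fun l _ => (hg1 l).fun_mul (ha1 l)] at e1
    simp only [dirD_mul (hg1 _) (ha1 _), ← pd_eq_dirD, hgv, hgx] at e1
    simp at e1
    exact e1.symm
  · have e2 := dirD_congr_on (v := Pi.single v 1) hs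
      (dirD_congr_on (v := Pi.single v 1) hs hb) x hx
    rw [dirD₂_sum hs hx _ (a := fun l y => g l y * a l y) fun l _ => (hg l).mul (ha l)] at e2
    have e3 : ∀ l, pd v (pd v (fun y => g l y * a l y)) x = pd v (pd v (g l)) x * a l x
        + (if i = l then 1 else 0) * pd v (pd v (a l)) x := by
      intro l
      have := dirD₂_mul (v := Pi.single v 1) (w := Pi.single v 1) hs hx (hg l) (ha l)
      simp only [← pd_eq_dirD, hgv, hgx] at this
      rw [this]
      ring
    simp only [← pd_eq_dirD, e3, Finset.sum_add_distrib] at e2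
    simp at e2
    linarith

end Calculus

namespace IsHypersurface

variable {s : Set Coord} {X ν : Coord → Ambient} {x : Coord} {lam : Coord}

lemma pd₂_symm (H : IsHypersurface s X ν) (i j : Fin 3) :
    ∀ y ∈ s, pd j (pd i X) y = pd i (pd j X) y :=
  pd_comm_of_contDiffOn H.isOpen H.smooth j i

lemma smoothForms (H : IsHypersurface s X ν) : SmoothForms s (metric X) (secondForm X ν) where
  isOpen := H.isOpen
  contDiffOn_left i j :=
    (contDiffOn_pd H.isOpen H.smooth i).inner ℝ (contDiffOn_pd H.isOpen H.smooth j)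
  contDiffOn_right i j :=
    ((contDiffOn_pd H.isOpen (contDiffOn_pd H.isOpen H.smooth i) j).inner ℝ H.smooth_normal).neg
  posDef := H.posDef
  symm y hy := by
    ext i j
    simp only [Matrix.transpose_apply, secondForm, Matrix.of_apply]
    rw [H.pd₂_symm i j y hy]

lemma inner_pd_normal (H : IsHypersurface s X ν) (j : Fin 3) :
    ∀ y ∈ s, inner ℝ (pd j ν y) (ν y) = (0 : ℝ) := by
  intro y hy
  have hν := differentiableAt_of_contDiffOn H.isOpen H.smooth_normal hy
  have h1 := dirD_inner (v := Pi.single j 1) hν hν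
  rw [dirD_congr_on H.isOpen H.unit y hy, dirD_const, ← pd_eq_dirD,
    real_inner_comm (pd j ν y) (ν y)] at h1
  linarith

/-- Differentiate `⟨X_{,i}, ν⟩ = 0`; the minus sign in the second fundamental form is absorbed here.
-/
lemma inner_pd_pd_normal (H : IsHypersurface s X ν) (i j : Fin 3) :
    ∀ y ∈ s, inner ℝ (pd j ν y) (pd i X y) = secondForm X ν y i j := by
  intro y hy
  have hν := differentiableAt_of_contDiffOn H.isOpen H.smooth_normal hy
  have hX := differentiableAt_of_contDiffOn H.isOpen (contDiffOn_pd H.isOpen H.smooth i) hy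
  have h1 := dirD_inner (v := Pi.single j 1) hX hν
  rw [dirD_congr_on H.isOpen (fun z hz => H.normal z hz i) y hy, dirD_const, ← pd_eq_dirD,
    ← pd_eq_dirD, real_inner_comm (pd j ν y)] at h1
  simp only [secondForm, Matrix.of_apply]
  linarith

lemma inner_pd₂_normal (H : IsHypersurface s X ν) (j : Fin 3) {y : Coord} (hy : y ∈ s) :
    inner ℝ (pd j (pd j ν) y) (ν y) = -inner ℝ (pd j ν y) (pd j ν y) := by
  have hν := contDiffOn_pd H.isOpen H.smooth_normal j
  have h1 := dirD_inner (v := Pi.single j 1) (differentiableAt_of_contDiffOn H.isOpen hν hy)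
    (differentiableAt_of_contDiffOn H.isOpen H.smooth_normal hy)
  rw [dirD_congr_on H.isOpen (H.inner_pd_normal j) y hy, dirD_const] at h1
  simp only [← pd_eq_dirD] at h1
  linarith

/-- Where the coordinate vectors are orthonormal, together with the normal they form an
orthonormal basis. -/
lemma inner_eq_sum (H : IsHypersurface s X ν) (hx : x ∈ s) (hg : metric X x = 1) (v w : Ambient) :
    inner ℝ v w = ∑ k, inner ℝ v (pd k X x) * inner ℝ w (pd k X x)
      + inner ℝ v (ν x) * inner ℝ w (ν x) := by
  have hgij : ∀ i j, inner ℝ (pd i X x) (pd j X x) = if i = j then (1 : ℝ) else 0 := by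
    intro i j
    have := congrFun (congrFun hg i) j
    simpa [metric, Matrix.one_apply] using this
  set b : Option (Fin 3) → Ambient := fun o => o.elim (ν x) (fun i => pd i X x) with hb
  have hon : Orthonormal ℝ b := by
    rw [orthonormal_iff_ite]
    intro i j
    rcases i with _ | i <;> rcases j with _ | j
    · simpa [hb] using H.unit x hx
    · simpa [hb, real_inner_comm] using H.normal x hx j
    · simpa [hb] using H.normal x hx i
    · simpa [hb] using hgij i j
  set B := (basisOfOrthonormalOfCardEqFinrank hon (by simp)).toOrthonormalBasis
    (by simpa using hon) with hB
  have hBb : ∀ o, B o = b o := by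
    intro o
    simp [hB]
  rw [← B.sum_inner_mul_inner v w, Fintype.sum_option]
  simp only [hBb, hb, Option.elim]
  rw [add_comm]
  congr 1
  · refine Finset.sum_congr rfl fun k _ => ?_
    rw [real_inner_comm w]
  · rw [real_inner_comm w]

/-- The Weingarten equation at a point where the principal directions are orthonormal. -/
lemma inner_weingarten (H : IsHypersurface s X ν) (hx : x ∈ s) (hg : metric X x = 1)
    (hh : secondForm X ν x = .diagonal lam) (i : Fin 3) (v : Ambient) :
    inner ℝ v (pd i ν x) = lam i * inner ℝ v (pd i X x) := by
  rw [H.inner_eq_sum hx hg]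
  simp only [H.inner_pd_pd_normal _ i x hx, hh, H.inner_pd_normal i x hx, Matrix.diagonal_apply]
  simp [mul_comm]

lemma inner_pd_normal_self (H : IsHypersurface s X ν) (hx : x ∈ s) (hg : metric X x = 1)
    (hh : secondForm X ν x = .diagonal lam) (i : Fin 3) :
    inner ℝ (pd i ν x) (pd i ν x) = lam i ^ 2 := by
  have hXi : inner ℝ (pd i X x) (pd i X x) = (1 : ℝ) := by
    have := congrFun (congrFun hg i) i
    simpa [metric] using this
  rw [H.inner_weingarten hx hg hh, real_inner_comm, H.inner_weingarten hx hg hh, hXi]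
  ring

lemma pd_metric_of_normal (H : IsHypersurface s X ν) (hx : x ∈ s)
    (hΓ : ∀ i j k, inner ℝ (pd j (pd i X) x) (pd k X x) = (0 : ℝ)) (i j k : Fin 3) :
    pd k (fun y => metric X y i j) x = 0 := by
  have h1 := fun i => differentiableAt_of_contDiffOn H.isOpen (contDiffOn_pd H.isOpen H.smooth i) hx
  simp only [metric, Matrix.of_apply]
  rw [pd_eq_dirD, dirD_inner (h1 i) (h1 j)]
  simp only [← pd_eq_dirD]
  rw [hΓ, real_inner_comm, hΓ, add_zero]

/-! ### Gauss and Codazzi where the second derivatives of `X` have no tangential part -/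

section NormalCoordinates

variable (H : IsHypersurface s X ν) (hx : x ∈ s) (hg : metric X x = 1)
  (hh : secondForm X ν x = .diagonal lam)
  (hΓ : ∀ i j k, inner ℝ (pd j (pd i X) x) (pd k X x) = (0 : ℝ))
include H hx hg hΓ

lemma inner_pd₂_of_normal (i j : Fin 3) (v : Ambient) :
    inner ℝ (pd j (pd i X) x) v = -secondForm X ν x i j * inner ℝ v (ν x) := by
  rw [H.inner_eq_sum hx hg]
  simp [hΓ, secondForm]

lemma pd_secondForm_of_normal (i j k : Fin 3) :
    pd k (fun y => secondForm X ν y i j) x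
      = -inner ℝ (pd k (pd j (pd i X)) x) (ν x) := by
  have h2 := contDiffOn_pd H.isOpen (contDiffOn_pd H.isOpen H.smooth i) j
  simp only [secondForm, Matrix.of_apply]
  rw [pd_eq_dirD, dirD_neg, dirD_inner (differentiableAt_of_contDiffOn H.isOpen h2 hx)
    (differentiableAt_of_contDiffOn H.isOpen H.smooth_normal hx)]
  simp only [← pd_eq_dirD]
  rw [inner_pd₂_of_normal H hx hg hΓ, H.inner_pd_normal k x hx]
  simp

lemma pd_secondForm_symm_left (i j k : Fin 3) :
    pd k (fun y => secondForm X ν y i j) x = pd k (fun y => secondForm X ν y j i) x := by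
  rw [pd_secondForm_of_normal H hx hg hΓ, pd_secondForm_of_normal H hx hg hΓ,
    pd_eq_dirD k, dirD_congr_on H.isOpen (H.pd₂_symm i j) x hx]
  rfl

/-- The Codazzi equation: here `h_{ij,k}` is the normal component of a third derivative of `X`, up
to sign, and partial derivatives commute. -/
lemma pd_secondForm_symm_right (i j k : Fin 3) :
    pd k (fun y => secondForm X ν y i j) x = pd j (fun y => secondForm X ν y i k) x := by
  rw [pd_secondForm_of_normal H hx hg hΓ, pd_secondForm_of_normal H hx hg hΓ,
    pd_comm_of_contDiffOn H.isOpen (contDiffOn_pd H.isOpen H.smooth i) k j x hx]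

include hh

lemma pd₂_secondForm_of_normal (i k : Fin 3) :
    pd i (pd i (fun y => secondForm X ν y k k)) x
      = -inner ℝ (pd i (pd i (pd k (pd k X))) x) (ν x)
        - 2 * lam i * inner ℝ (pd i (pd k (pd k X)) x) (pd i X x) - lam k * lam i ^ 2 := by
  have hν := H.smooth_normal
  have h2 := contDiffOn_pd H.isOpen (contDiffOn_pd H.isOpen H.smooth k) k
  have e1 := dirD₂_inner (v := Pi.single i 1) (w := Pi.single i 1) H.isOpen hx h2 hν
  have e0 : pd i (pd i (fun y => secondForm X ν y k k)) x
      = -pd i (pd i (fun y => inner ℝ (pd k (pd k X) y) (ν y))) x := by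
    have : pd i (fun y => secondForm X ν y k k)
        = fun y => -pd i (fun y => inner ℝ (pd k (pd k X) y) (ν y)) y := by
      funext y
      simp only [secondForm, Matrix.of_apply]
      exact dirD_neg
    rw [this]
    exact dirD_neg
  simp only [← pd_eq_dirD] at e1
  rw [e0, e1, H.inner_weingarten hx hg hh, inner_pd₂_of_normal H hx hg hΓ, H.inner_pd₂_normal i hx,
    H.inner_pd_normal_self hx hg hh, hh]
  simp
  ring

lemma pd₂_metric_of_normal (i k : Fin 3) :
    pd i (pd i (fun y => metric X y k k)) x
      = 2 * inner ℝ (pd i (pd i (pd k X)) x) (pd k X x)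
        + if i = k then 2 * lam k ^ 2 else 0 := by
  have h1 := contDiffOn_pd H.isOpen H.smooth k
  have e1 := dirD₂_inner (v := Pi.single i 1) (w := Pi.single i 1) H.isOpen hx h1 h1
  simp only [← pd_eq_dirD] at e1
  simp only [metric, Matrix.of_apply]
  rw [e1, inner_pd₂_of_normal H hx hg hΓ, real_inner_comm (pd i (pd i (pd k X)) x)]
  have e2 : inner ℝ (pd i (pd k X) x) (ν x) = -secondForm X ν x k i := by
    simp [secondForm]
  rw [e2, hh]
  by_cases hik : i = k
  · subst hik
    simp
    ring
  · simp [hik, Ne.symm hik]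
    ring

lemma pd_shape_of_normal (i j k : Fin 3) :
    pd k (fun y => ((metric X y)⁻¹ * secondForm X ν y) i j) x
        = pd k (fun y => secondForm X ν y i j) x ∧
      pd k (pd k (fun y => ((metric X y)⁻¹ * secondForm X ν y) i j)) x
        = pd k (pd k (fun y => secondForm X ν y i j)) x
          - lam j * pd k (pd k (fun y => metric X y i j)) x := by
  have hS := H.smoothForms
  have hA : ∀ l, ((metric X x)⁻¹ * secondForm X ν x) l j = if l = j then lam j else 0 := by
    intro l
    rw [hg, hh, inv_one, one_mul, Matrix.diagonal_apply]
    split_ifs with h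
    · rw [h]
    · rfl
  have key := pd_of_eq_sum_mul (v := k) (i := i) H.isOpen hx
    (g := fun l y => metric X y i l) (a := fun l y => ((metric X y)⁻¹ * secondForm X ν y) l j)
    (b := fun y => secondForm X ν y i j) (fun l => hS.contDiffOn_left i l)
    (fun l => hS.contDiffOn_inv_mul l j) (fun y hy => by
      have hu : IsUnit (metric X y).det := isUnit_iff_ne_zero.2 (H.posDef y hy).det_pos.ne'
      rw [← Matrix.mul_apply, Matrix.mul_nonsing_inv_cancel_left _ _ hu])
    (fun l => pd_metric_of_normal H hx hΓ i l k) (fun l => by rw [hg, Matrix.one_apply])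
  refine ⟨key.1, key.2.trans ?_⟩
  simp only [hA]
  simp [mul_comm]

/-- Interchanging second derivatives of the shape operator: the equations of Gauss and Codazzi. -/
lemma pd₂_shape_sub (i k : Fin 3) :
    pd i (pd i (fun y => ((metric X y)⁻¹ * secondForm X ν y) k k)) x
      - pd k (pd k (fun y => ((metric X y)⁻¹ * secondForm X ν y) i i)) x
      = lam i * lam k ^ 2 - lam k * lam i ^ 2 := by
  by_cases hik : i = k
  · subst hik
    ring
  have h1 := H.smooth
  have hs := H.isOpen
  have c3 : ∀ i k, pd i (pd k (pd k X)) x = pd k (pd k (pd i X)) x := by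
    intro i k
    rw [pd_comm_of_contDiffOn hs (contDiffOn_pd hs h1 k) i k x hx]
    exact dirD_congr_on hs (pd_comm_of_contDiffOn hs h1 i k) x hx
  have c4 : pd i (pd i (pd k (pd k X))) x = pd k (pd k (pd i (pd i X))) x := by
    have a1 : ∀ y ∈ s, pd i (pd k (pd k X)) y = pd k (pd k (pd i X)) y := by
      intro y hy
      rw [pd_comm_of_contDiffOn hs (contDiffOn_pd hs h1 k) i k y hy]
      exact dirD_congr_on hs (pd_comm_of_contDiffOn hs h1 i k) y hy
    have a2 : pd i (pd i (pd k (pd k X))) x = pd i (pd k (pd k (pd i X))) x :=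
      dirD_congr_on hs a1 x hx
    rw [a2, pd_comm_of_contDiffOn hs (contDiffOn_pd hs (contDiffOn_pd hs h1 i) k) i k x hx]
    exact dirD_congr_on hs (pd_comm_of_contDiffOn hs (contDiffOn_pd hs h1 i) i k) x hx
  -- The fourth derivatives of `X` agree by commutation. The tangential third-derivative terms from
  -- `h` on one side match those from the metric on the other, so only the cubic terms in `lam`
  -- survive.
  rw [(pd_shape_of_normal H hx hg hh hΓ k k i).2, (pd_shape_of_normal H hx hg hh hΓ i i k).2,
    pd₂_secondForm_of_normal H hx hg hh hΓ, pd₂_secondForm_of_normal H hx hg hh hΓ,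
    pd₂_metric_of_normal H hx hg hh hΓ, pd₂_metric_of_normal H hx hg hh hΓ, c4, c3 i k, c3 k i,
    if_neg hik, if_neg (Ne.symm hik)]
  ring

end NormalCoordinates

end IsHypersurface

/-! ### Quadratic coordinates that remove the Christoffel symbols at a point -/

open Matrix in
lemma principalCurvatures_congr_basis {g h S : Matrix (Fin 3) (Fin 3) ℝ} (hS : IsUnit S.det) :
    principalCurvatures (Sᵀ * g * S) (Sᵀ * h * S) = principalCurvatures g h := by
  have hST : IsUnit Sᵀ.det := by rwa [det_transpose]
  have h1 : (Sᵀ * g * S)⁻¹ * (Sᵀ * h * S) = S⁻¹ * (g⁻¹ * h * S) := by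
    rw [Matrix.mul_inv_rev, Matrix.mul_inv_rev]
    calc S⁻¹ * (g⁻¹ * Sᵀ⁻¹) * (Sᵀ * h * S) = S⁻¹ * (g⁻¹ * ((Sᵀ⁻¹ * Sᵀ) * (h * S))) := by
          simp only [Matrix.mul_assoc]
      _ = _ := by rw [nonsing_inv_mul _ hST, Matrix.one_mul, Matrix.mul_assoc]
  have h2 : (S⁻¹ * (g⁻¹ * h * S)).charpoly = (g⁻¹ * h).charpoly := by
    rw [Matrix.charpoly_mul_comm, Matrix.mul_assoc, mul_nonsing_inv _ hS, Matrix.mul_one]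
  unfold principalCurvatures
  rw [h1, h2]

/-- The quadratic change of coordinates `z ↦ x + z - ½ Γ(z, z)`. -/
def quadChart (x : Coord) (Γ : Fin 3 → Fin 3 → Fin 3 → ℝ) (z : Coord) : Coord :=
  fun a => x a + z a - (1 / 2) * ∑ k, ∑ j, Γ a k j * (z k * z j)

/-- The Jacobian matrix of `quadChart`. -/
def quadJac (Γ : Fin 3 → Fin 3 → Fin 3 → ℝ) (z : Coord) : Matrix (Fin 3) (Fin 3) ℝ :=
  Matrix.of fun a i => (if a = i then 1 else 0) - ∑ j, Γ a i j * z j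

section

variable {x : Coord} {Γ : Fin 3 → Fin 3 → Fin 3 → ℝ} {V : Type*} [NormedAddCommGroup V]
  [NormedSpace ℝ V] {u : Coord → V} {z : Coord}

lemma quadChart_zero : quadChart x Γ 0 = x := by
  ext a
  simp [quadChart]

lemma quadJac_zero : quadJac Γ 0 = 1 := by
  ext a i
  simp [quadJac, Matrix.one_apply]

lemma contDiff_quadChart : ContDiff ℝ ∞ (quadChart x Γ) := by
  rw [contDiff_pi]
  intro a
  unfold quadChart
  fun_prop

lemma contDiff_quadJac (a i : Fin 3) : ContDiff ℝ ∞ (fun z => quadJac Γ z a i) := by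
  simp only [quadJac, Matrix.of_apply]
  fun_prop

lemma pd_apply (i k : Fin 3) (z : Coord) : pd i (fun z : Coord => z k) z = if k = i then 1 else 0 := by
  simp [pd, fderiv_apply, Pi.single_apply]

lemma pd_quadJac (a i j : Fin 3) : pd j (fun z => quadJac Γ z a i) z = -Γ a i j := by
  simp only [quadJac, Matrix.of_apply, Fin.sum_univ_three, pd_eq_dirD]
  simp (disch := fun_prop) only [dirD_sub, dirD_add, dirD_mul, dirD_const]
  simp only [← pd_eq_dirD, pd_apply]
  fin_cases j <;> simp

lemma pd_quadChart (hΓ : ∀ a i j, Γ a i j = Γ a j i) (a i : Fin 3) :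
    pd i (fun z => quadChart x Γ z a) z = quadJac Γ z a i := by
  simp only [quadChart, quadJac, Matrix.of_apply, Fin.sum_univ_three, pd_eq_dirD]
  simp (disch := fun_prop) only [dirD_sub, dirD_add, dirD_mul, dirD_const]
  simp only [← pd_eq_dirD, pd_apply]
  fin_cases i <;> simp [hΓ a 1 0, hΓ a 2 0, hΓ a 2 1] <;> ring

lemma pd_comp_quadChart (hΓ : ∀ a i j, Γ a i j = Γ a j i)
    (hu : DifferentiableAt ℝ u (quadChart x Γ z)) (i : Fin 3) :
    pd i (fun z => u (quadChart x Γ z)) z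
      = ∑ a, quadJac Γ z a i • pd a u (quadChart x Γ z) := by
  have he : DifferentiableAt ℝ (quadChart x Γ) z :=
    contDiff_quadChart.contDiffAt.differentiableAt (by simp)
  have h1 : fderiv ℝ (fun z => u (quadChart x Γ z)) z
      = (fderiv ℝ u (quadChart x Γ z)).comp (fderiv ℝ (quadChart x Γ) z) := fderiv_comp z hu he
  have h2 : ∀ a, quadJac Γ z a i = (fderiv ℝ (quadChart x Γ) z (Pi.single i 1)) a := by
    intro a
    rw [← pd_quadChart (x := x) hΓ, pd, fderiv_apply he]
    rfl
  rw [pd, h1, ContinuousLinearMap.comp_apply]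
  conv_lhs => rw [pi_eq_sum_univ' (fderiv ℝ (quadChart x Γ) z (Pi.single i 1))]
  rw [map_sum]
  refine Finset.sum_congr rfl fun m _ => ?_
  rw [map_smul, h2]
  rfl

lemma pd₂_comp_quadChart (hΓ : ∀ a i j, Γ a i j = Γ a j i)
    (hu : ∀ᶠ y in 𝓝 (quadChart x Γ z), DifferentiableAt ℝ u y)
    (hu2 : ∀ a, DifferentiableAt ℝ (pd a u) (quadChart x Γ z)) (i j : Fin 3) :
    pd j (pd i (fun z => u (quadChart x Γ z))) z
      = ∑ a, (-Γ a i j) • pd a u (quadChart x Γ z)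
        + ∑ a, quadJac Γ z a i • ∑ b, quadJac Γ z b j • pd b (pd a u) (quadChart x Γ z) := by
  have hψ : ∀ z, DifferentiableAt ℝ (quadChart x Γ) z := fun z =>
    contDiff_quadChart.contDiffAt.differentiableAt (by simp)
  have h1 : pd i (fun z => u (quadChart x Γ z))
      =ᶠ[𝓝 z] fun z => ∑ a, quadJac Γ z a i • pd a u (quadChart x Γ z) := by
    filter_upwards [(hψ z).continuousAt.eventually hu] with z' hz'
    exact pd_comp_quadChart hΓ hz' i
  have hJ : ∀ a, DifferentiableAt ℝ (fun z => quadJac Γ z a i) z := fun a =>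
    (contDiff_quadJac a i).contDiffAt.differentiableAt (by simp)
  have hp : ∀ a, DifferentiableAt ℝ (fun z => pd a u (quadChart x Γ z)) z := fun a =>
    (hu2 a).comp z (hψ z)
  rw [pd_eq_dirD j, dirD_congr h1, dirD_sum _ fun a _ => (hJ a).fun_smul (hp a),
    ← Finset.sum_add_distrib]
  refine Finset.sum_congr rfl fun a _ => ?_
  rw [dirD_smul (hJ a) (hp a)]
  simp only [← pd_eq_dirD]
  rw [pd_quadJac, pd_comp_quadChart hΓ (hu2 a)]

lemma pd_comp_quadChart_zero (hΓ : ∀ a i j, Γ a i j = Γ a j i)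
    (hu : DifferentiableAt ℝ u x) (i : Fin 3) :
    pd i (fun z => u (quadChart x Γ z)) 0 = pd i u x := by
  rw [pd_comp_quadChart hΓ (by rwa [quadChart_zero]), quadChart_zero, quadJac_zero]
  simp [Matrix.one_apply]

/-- With the Christoffel symbols as `Γ`, the right side is the second covariant derivative: second
partials in the new coordinates are covariant ones in the old. -/
lemma pd₂_comp_quadChart_zero (hΓ : ∀ a i j, Γ a i j = Γ a j i)
    (hu : ∀ᶠ y in 𝓝 x, DifferentiableAt ℝ u y)
    (hu2 : ∀ a, DifferentiableAt ℝ (pd a u) x) (i j : Fin 3) :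
    pd j (pd i (fun z => u (quadChart x Γ z))) 0
      = pd j (pd i u) x - ∑ a, Γ a i j • pd a u x := by
  rw [pd₂_comp_quadChart hΓ (by rwa [quadChart_zero]) (by rwa [quadChart_zero]), quadChart_zero,
    quadJac_zero]
  simp [Matrix.one_apply]
  abel

end

namespace IsHypersurface

variable {s : Set Coord} {X ν : Coord → Ambient} {x : Coord} {lam : Coord}

lemma christoffel_symm (X : Coord → Ambient) (x : Coord) (a i j : Fin 3) :
    christoffel X a i j x = christoffel X a j i x := by
  unfold christoffel
  congr 1
  refine Finset.sum_congr rfl fun l _ => ?_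
  have : (fun y => metric X y i j) = fun y => metric X y j i := by
    funext y
    simp only [metric, Matrix.of_apply]
    exact real_inner_comm _ _
  rw [this]
  ring

lemma christoffel_eq (H : IsHypersurface s X ν) (hx : x ∈ s) (hg : metric X x = 1)
    (k i j : Fin 3) : christoffel X k i j x = inner ℝ (pd j (pd i X) x) (pd k X x) := by
  have h1 := fun i => differentiableAt_of_contDiffOn H.isOpen (contDiffOn_pd H.isOpen H.smooth i) hx
  have h2 : ∀ i j k, pd k (fun y => metric X y i j) x
      = inner ℝ (pd k (pd i X) x) (pd j X x) + inner ℝ (pd k (pd j X) x) (pd i X x) := by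
    intro i j k
    simp only [metric, Matrix.of_apply]
    rw [pd_eq_dirD, dirD_inner (h1 i) (h1 j), real_inner_comm (dirD _ _ x)]
    rfl
  unfold christoffel
  simp only [h2, hg, inv_one, Matrix.one_apply]
  simp
  rw [H.pd₂_symm i j x hx, H.pd₂_symm k j x hx, H.pd₂_symm k i x hx]
  ring

variable (H : IsHypersurface s X ν)

section Chart

variable {Γ : Fin 3 → Fin 3 → Fin 3 → ℝ} (hΓ : ∀ a i j, Γ a i j = Γ a j i)
include H hΓ

lemma metric_comp_quadChart {z : Coord} (hz : quadChart x Γ z ∈ s) :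
    metric (fun z => X (quadChart x Γ z)) z
      = (quadJac Γ z).transpose * metric X (quadChart x Γ z) * quadJac Γ z := by
  have hX := differentiableAt_of_contDiffOn H.isOpen H.smooth hz
  ext i j
  simp only [metric, Matrix.of_apply, Matrix.mul_apply, Matrix.transpose_apply,
    pd_comp_quadChart hΓ hX, sum_inner, inner_sum, inner_smul_left, inner_smul_right,
    Finset.sum_mul, Finset.mul_sum]
  refine Finset.sum_congr rfl fun a _ => Finset.sum_congr rfl fun b _ => ?_
  simp [real_inner_comm]
  ring

/-- The second derivatives of the chart only add tangential vectors, which `ν` annihilates; hence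
`h` transforms as a tensor. -/
lemma secondForm_comp_quadChart {z : Coord} (hz : quadChart x Γ z ∈ s) :
    secondForm (fun z => X (quadChart x Γ z)) (fun z => ν (quadChart x Γ z)) z
      = (quadJac Γ z).transpose * secondForm X ν (quadChart x Γ z) * quadJac Γ z := by
  have hX : ∀ᶠ y in 𝓝 (quadChart x Γ z), DifferentiableAt ℝ X y := by
    filter_upwards [H.isOpen.mem_nhds hz] with y hy
      using differentiableAt_of_contDiffOn H.isOpen H.smooth hy
  have hX2 := fun a =>
    differentiableAt_of_contDiffOn H.isOpen (contDiffOn_pd H.isOpen H.smooth a) hz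
  ext i j
  simp only [secondForm, Matrix.of_apply, Matrix.mul_apply, Matrix.transpose_apply,
    pd₂_comp_quadChart hΓ hX hX2, inner_add_left, sum_inner, inner_smul_left, Finset.sum_mul,
    H.normal _ hz]
  rw [Finset.sum_comm]
  simp only [mul_zero, Finset.sum_const_zero, zero_add, ← Finset.sum_neg_distrib, Finset.mul_sum]
  refine Finset.sum_congr rfl fun a _ => Finset.sum_congr rfl fun b _ => ?_
  simp
  ring

lemma comp_quadChart (hx : x ∈ s) : ∃ s' : Set Coord, (0 : Coord) ∈ s' ∧
    (∀ z ∈ s', quadChart x Γ z ∈ s ∧ IsUnit (quadJac Γ z).det) ∧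
    IsHypersurface s' (fun z => X (quadChart x Γ z)) (fun z => ν (quadChart x Γ z)) := by
  have hψ : ContDiff ℝ ∞ (quadChart x Γ) := contDiff_quadChart
  have hJ : Continuous fun z => (quadJac Γ z).det :=
    (contDiffOn_univ.1 (contDiffOn_det fun a i => (contDiff_quadJac a i).contDiffOn)).continuous
  refine ⟨quadChart x Γ ⁻¹' s ∩ {z | (quadJac Γ z).det ≠ 0}, ⟨by simpa [quadChart_zero], by
    simp [quadJac_zero]⟩, fun z hz => ⟨hz.1, isUnit_iff_ne_zero.2 hz.2⟩, ?_⟩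
  refine
    { isOpen := (H.isOpen.preimage hψ.continuous).inter (isOpen_ne_fun hJ continuous_const)
      smooth := H.smooth.comp hψ.contDiffOn fun z hz => hz.1
      smooth_normal := H.smooth_normal.comp hψ.contDiffOn fun z hz => hz.1
      posDef := fun z hz => ?_
      unit := fun z hz => H.unit _ hz.1
      normal := fun z hz i => ?_ }
  · rw [H.metric_comp_quadChart hΓ hz.1]
    have := (H.posDef _ hz.1).conjTranspose_mul_mul_same (B := quadJac Γ z)
      (Matrix.mulVec_injective_iff_isUnit.2
        ((Matrix.isUnit_iff_isUnit_det _).2 (isUnit_iff_ne_zero.2 hz.2)))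
    rwa [Matrix.conjTranspose_eq_transpose_of_trivial] at this
  · rw [pd_comp_quadChart hΓ (differentiableAt_of_contDiffOn H.isOpen H.smooth hz.1)]
    simp [sum_inner, inner_smul_left, H.normal _ hz.1]

end Chart

include H

/-- First and second covariant derivatives of all functions of the principal curvatures at a point
with orthonormal coordinate vectors that diagonalize the second fundamental form. -/
theorem exists_covariant_jet (hx : x ∈ s) (hg : metric X x = 1)
    (hh : secondForm X ν x = .diagonal lam) (hlam : lam ∈ posCone) :
    ∃ (C : Fin 3 → Fin 3 → Fin 3 → ℝ) (D : Fin 3 → Fin 3 → ℝ),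
      (∀ i j k, C i j k = secondFormCov X ν i j k x) ∧
      (∀ i j k, C i j k = C j i k) ∧ (∀ i j k, C i j k = C i k j) ∧
      (∀ i k, D k i - D i k = lam i * lam k ^ 2 - lam k * lam i ^ 2) ∧
      ∀ f, IsCurvatureFunction f →
        (∀ i, pd i (onSurface f X ν) x = ∑ k, pd k f lam * C k k i) ∧
        ∀ i, hessianCov X (onSurface f X ν) i i x
          = ∑ k, pd k f lam * D k i + hessForm f lam (C 0 0 i) (C 1 1 i) (C 2 2 i)
            + 2 * (diffQuot 0 1 f lam * C 0 1 i ^ 2 + diffQuot 0 2 f lam * C 0 2 i ^ 2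
              + diffQuot 1 2 f lam * C 1 2 i ^ 2) := by
  set Γ : Fin 3 → Fin 3 → Fin 3 → ℝ := fun a i j => christoffel X a i j x with hΓdef
  have hΓ : ∀ a i j, Γ a i j = Γ a j i := fun a i j => christoffel_symm X x a i j
  obtain ⟨s', h0, hs', H'⟩ := H.comp_quadChart (x := x) hΓ hx
  set Y : Coord → Ambient := fun z => X (quadChart x Γ z) with hY
  set N : Coord → Ambient := fun z => ν (quadChart x Γ z) with hN
  have hgY : metric Y 0 = 1 := by
    rw [hY, H.metric_comp_quadChart hΓ (hs' 0 h0).1, quadChart_zero, quadJac_zero, hg]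
    simp
  have hhY : secondForm Y N 0 = .diagonal lam := by
    rw [hY, hN, H.secondForm_comp_quadChart hΓ (hs' 0 h0).1, quadChart_zero, quadJac_zero, hh]
    simp
  have hXd : ∀ᶠ y in 𝓝 x, DifferentiableAt ℝ X y := by
    filter_upwards [H.isOpen.mem_nhds hx] with y hy
      using differentiableAt_of_contDiffOn H.isOpen H.smooth hy
  have hX2 := fun a =>
    differentiableAt_of_contDiffOn H.isOpen (contDiffOn_pd H.isOpen H.smooth a) hx
  have hgij : ∀ i j, inner ℝ (pd i X x) (pd j X x) = if i = j then (1 : ℝ) else 0 := by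
    intro i j
    have := congrFun (congrFun hg i) j
    simpa [metric, Matrix.one_apply] using this
  -- The chart subtracts from `X_{,ij}` exactly its tangential part, since the coordinate vectors
  -- are orthonormal at `x`.
  have hΓY : ∀ i j k, inner ℝ (pd j (pd i Y) 0) (pd k Y 0) = (0 : ℝ) := by
    intro i j k
    rw [hY, pd₂_comp_quadChart_zero hΓ hXd hX2, pd_comp_quadChart_zero hΓ hXd.self_of_nhds,
      inner_sub_left, sum_inner]
    simp only [inner_smul_left, hgij, ← H.christoffel_eq hx hg]
    simp [hΓdef]
  have hu : ∀ f, ∀ z ∈ s', onSurface f Y N z = onSurface f X ν (quadChart x Γ z) := by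
    intro f z hz
    simp only [onSurface, ofForms]
    rw [hY, hN, H.metric_comp_quadChart hΓ (hs' z hz).1,
      H.secondForm_comp_quadChart hΓ (hs' z hz).1, principalCurvatures_congr_basis (hs' z hz).2]
  have hdiag : ∀ {M : Matrix (Fin 3) (Fin 3) ℝ}, M = 1 → IsDiag M (.diagonal lam) lam := by
    rintro M rfl
    exact ⟨1, by simp, by simp⟩
  -- In the new coordinates `C` and `D` are plain partial derivatives of `h` and of the diagonal of
  -- `g⁻¹h`. They are chosen before `f`, so `F` and `w` can share them.
  refine ⟨fun i j k => pd k (fun z => secondForm Y N z i j) 0,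
    fun k i => pd i (pd i (fun y => ((metric Y y)⁻¹ * secondForm Y N y) k k)) 0, ?_, ?_, ?_, ?_, ?_⟩
  · intro i j k
    have hS := H.smoothForms
    have hh1 : ∀ a b, DifferentiableAt ℝ (fun y => secondForm X ν y a b) x := fun a b =>
      differentiableAt_of_contDiffOn H.isOpen (hS.contDiffOn_right a b) hx
    have hh2 : ∀ a b, DifferentiableAt ℝ (fun z => secondForm X ν (quadChart x Γ z) a b) 0 := by
      intro a b
      refine DifferentiableAt.comp (g := fun y => secondForm X ν y a b) 0 ?_
        (contDiff_quadChart.contDiffAt.differentiableAt (by simp))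
      rw [quadChart_zero]
      exact hh1 a b
    have hJ : ∀ a i, DifferentiableAt ℝ (fun z => quadJac Γ z a i) 0 := fun a i =>
      (contDiff_quadJac a i).contDiffAt.differentiableAt (by simp)
    have e1 : ∀ z ∈ s', secondForm Y N z i j = ∑ b, (∑ a, quadJac Γ z a i
        * secondForm X ν (quadChart x Γ z) a b) * quadJac Γ z b j := by
      intro z hz
      rw [hY, hN, H.secondForm_comp_quadChart hΓ (hs' z hz).1]
      simp [Matrix.mul_apply]
    have hsum : ∀ b, DifferentiableAt ℝ (fun z => ∑ a, quadJac Γ z a i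
        * secondForm X ν (quadChart x Γ z) a b) 0 := fun b =>
      DifferentiableAt.fun_sum fun a _ => (hJ a i).fun_mul (hh2 a b)
    refine (dirD_congr_on (v := Pi.single k 1) H'.isOpen e1 0 h0).trans ?_
    rw [dirD_sum _ fun b _ => (hsum b).fun_mul (hJ b j)]
    simp only [dirD_mul (hsum _) (hJ _ _), dirD_sum _ fun a _ => (hJ a i).fun_mul (hh2 a _),
      dirD_mul (hJ _ _) (hh2 _ _), ← pd_eq_dirD, pd_quadJac, quadJac_zero, quadChart_zero,
      pd_comp_quadChart_zero hΓ (hh1 _ _), Matrix.one_apply]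
    -- The derivatives of the two Jacobian factors are `-Γ`; they supply the two correction terms of
    -- the covariant derivative.
    simp [secondFormCov, Finset.sum_add_distrib]
    simp only [hΓdef, mul_comm (secondForm X ν x i _)]
    ring
  · exact fun i j k => pd_secondForm_symm_left H' h0 hgY hΓY i j k
  · exact fun i j k => pd_secondForm_symm_right H' h0 hgY hΓY i j k
  · exact fun i k => pd₂_shape_sub H' h0 hgY hhY hΓY i k
  · intro f hf
    have hS := H.smoothForms
    have hS' := H'.smoothForms
    have hd' : IsDiag (metric Y 0) (secondForm Y N 0) lam := by rw [hhY]; exact hdiag hgY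
    have hd : IsDiag (metric X x) (secondForm X ν x) lam := by rw [hh]; exact hdiag hg
    have hAY : (metric Y 0)⁻¹ * secondForm Y N 0 = .diagonal lam := by
      rw [hgY, hhY, inv_one, one_mul]
    have hd1 : ∀ᶠ y in 𝓝 x, DifferentiableAt ℝ (onSurface f X ν) y :=
      hS.eventually_differentiableAt hx hd hlam hf
    obtain ⟨Q, hQ, hflat⟩ := hf.exists_flat hlam
    have hd2 : ∀ a, DifferentiableAt ℝ (pd a (onSurface f X ν)) x := fun a =>
      (hS.hasFDerivAt_fderiv_of_flat hx hd hlam hf hQ hflat).differentiableAt.clm_apply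
        (differentiableAt_const _)
    constructor
    · intro i
      have h1 := hS'.dirD_ofForms h0 hd' hAY hlam hf (Pi.single i 1)
      simp only [← pd_eq_dirD, (pd_shape_of_normal H' h0 hgY hhY hΓY _ _ _).1] at h1
      rw [← h1, ← pd_comp_quadChart_zero hΓ hd1.self_of_nhds]
      exact (dirD_congr_on H'.isOpen (hu f) 0 h0).symm
    · intro i
      have h1 := hS'.dirD₂_ofForms h0 hd' hAY hlam hf (Pi.single i 1)
        (d := fun k l => pd i (fun z => secondForm Y N z k l) 0)
        (fun k l => (pd_shape_of_normal H' h0 hgY hhY hΓY k l i).1.symm)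
      simp only [← pd_eq_dirD] at h1
      have h2 : hessianCov X (onSurface f X ν) i i x = pd i (pd i (onSurface f Y N)) 0 := by
        have := pd₂_comp_quadChart_zero hΓ hd1 hd2 i i
        rw [hessianCov]
        simp only [smul_eq_mul] at this
        rw [← this]
        exact (dirD_congr_on H'.isOpen (dirD_congr_on H'.isOpen (hu f)) 0 h0).symm
      rw [h2]
      refine h1.trans ?_
      simp only [pd_secondForm_symm_left H' h0 hgY hΓY 1 0, pd_secondForm_symm_left H' h0 hgY hΓY 2 0,
        pd_secondForm_symm_left H' h0 hgY hΓY 2 1]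
      ring

end IsHypersurface

/-! ### Space and time derivatives of a family -/

section Slices

variable {V : Type*} [NormedAddCommGroup V] [NormedSpace ℝ V] {J : Set ℝ} {U : Set Coord}
  {u : ℝ → Coord → V} {t : ℝ} {x : Coord}

lemma pd_slice (hu : DifferentiableAt ℝ (fun p : ℝ × Coord => u p.1 p.2) (t, x)) (i : Fin 3) :
    pd i (u t) x
      = dirD ((0, Pi.single i 1) : ℝ × Coord) (fun p : ℝ × Coord => u p.1 p.2) (t, x) := by
  have h1 : HasFDerivAt (fun y : Coord => ((t, y) : ℝ × Coord))
      (ContinuousLinearMap.inr ℝ ℝ Coord) x := hasFDerivAt_prodMk_right t x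
  have h2 := HasFDerivAt.comp (f := fun y : Coord => ((t, y) : ℝ × Coord)) x hu.hasFDerivAt h1
  have h3 : fderiv ℝ (u t) x = _ := h2.fderiv
  rw [pd, h3]
  rfl

lemma hasDerivAt_slice (hu : DifferentiableAt ℝ (fun p : ℝ × Coord => u p.1 p.2) (t, x)) :
    HasDerivAt (fun s => u s x)
      (dirD ((1, 0) : ℝ × Coord) (fun p : ℝ × Coord => u p.1 p.2) (t, x)) t := by
  have h1 : HasFDerivAt (fun s : ℝ => ((s, x) : ℝ × Coord))
      (ContinuousLinearMap.inl ℝ ℝ Coord) t := hasFDerivAt_prodMk_left t x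
  have h2 := HasFDerivAt.comp (f := fun s : ℝ => ((s, x) : ℝ × Coord)) t hu.hasFDerivAt h1
  exact h2.hasDerivAt

lemma contDiffOn_slice_space (hu : ContDiffOn ℝ ∞ (fun p : ℝ × Coord => u p.1 p.2) (J ×ˢ U))
    (ht : t ∈ J) : ContDiffOn ℝ ∞ (u t) U :=
  hu.comp (f := fun y : Coord => ((t, y) : ℝ × Coord)) (by fun_prop) fun _ hy => ⟨ht, hy⟩

lemma contDiffOn_slice_time (hu : ContDiffOn ℝ ∞ (fun p : ℝ × Coord => u p.1 p.2) (J ×ˢ U))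
    (hx : x ∈ U) : ContDiffOn ℝ ∞ (fun s => u s x) J :=
  hu.comp (f := fun s : ℝ => ((s, x) : ℝ × Coord)) (by fun_prop) fun _ hs => ⟨hs, hx⟩

variable (hJ : IsOpen J) (hU : IsOpen U)
  (hu : ContDiffOn ℝ ∞ (fun p : ℝ × Coord => u p.1 p.2) (J ×ˢ U))
include hJ hU hu

lemma contDiffOn_pd_slice (i : Fin 3) :
    ContDiffOn ℝ ∞ (fun p : ℝ × Coord => pd i (u p.1) p.2) (J ×ˢ U) := by
  have hW := hJ.prod hU
  refine (contDiffOn_dirD (v := ((0, Pi.single i 1) : ℝ × Coord)) hW hu).congr fun p hp => ?_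
  exact pd_slice (differentiableAt_of_contDiffOn hW hu hp) i

/-- The time derivative commutes with the space derivatives. -/
lemma hasDerivAt_pd_slice {Z : Coord → V} (ht : t ∈ J) (hx : x ∈ U)
    (hZ : ∀ y ∈ U, HasDerivAt (fun s => u s y) (Z y) t) (i : Fin 3) :
    HasDerivAt (fun s => pd i (u s) x) (pd i Z x) t := by
  have hW := hJ.prod hU
  have hd : ∀ p ∈ J ×ˢ U, DifferentiableAt ℝ (fun p : ℝ × Coord => u p.1 p.2) p := fun p hp =>
    differentiableAt_of_contDiffOn hW hu hp
  set τ : ℝ × Coord := (1, 0)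
  set e : ℝ × Coord := (0, Pi.single i 1)
  set w : ℝ × Coord → V := fun p => u p.1 p.2 with hw
  have h1 := hasDerivAt_slice (differentiableAt_of_contDiffOn hW
    (contDiffOn_pd_slice hJ hU hu i) (⟨ht, hx⟩ : (t, x) ∈ J ×ˢ U))
    (u := fun s y => pd i (u s) y)
  have h2 : dirD τ (fun p : ℝ × Coord => pd i (u p.1) p.2) (t, x) = dirD τ (dirD e w) (t, x) :=
    dirD_congr_on hW (fun p hp => pd_slice (hd p hp) i) _ ⟨ht, hx⟩
  -- On `J ×ˢ U` both orders of differentiation are iterated directional derivatives of one smooth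
  -- map, so `dirD_comm` applies.
  have h3 : pd i Z x = dirD e (dirD τ w) (t, x) := by
    have h4 : ∀ y ∈ U, Z y = dirD τ w (t, y) := fun y hy =>
      (hZ y hy).unique (hasDerivAt_slice (hd (t, y) ⟨ht, hy⟩))
    refine (dirD_congr_on hU h4 x hx).trans ?_
    exact pd_slice (u := fun s y => dirD τ w (s, y)) (differentiableAt_of_contDiffOn hW
      (contDiffOn_dirD hW hu) ⟨ht, hx⟩) i
  rw [h3, ← dirD_comm hW hu ⟨ht, hx⟩, ← h2]
  exact h1

end Slices

lemma isDiag_one_diagonal (lam : Coord) : IsDiag 1 (.diagonal lam) lam := ⟨1, by simp, by simp⟩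

/-- To first order the eigenvalues of a diagonal matrix change by the diagonal of the perturbation,
which is zero for a symmetrized unit matrix with `i ≠ j`. -/
lemma derivForm_one_diagonal {F : Coord → ℝ} (hF : IsCurvatureFunction F) {lam : Coord}
    (hlam : lam ∈ posCone) (i j : Fin 3) :
    derivForm F 1 (.diagonal lam) i j = if i = j then pd i F lam else 0 := by
  set M : Matrix (Fin 3) (Fin 3) ℝ :=
    (1 / 2 : ℝ) • (Matrix.single i j (1 : ℝ) + Matrix.single j i (1 : ℝ)) with hM
  have hMk : ∀ k, M k k = if i = j ∧ k = i then 1 else 0 := by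
    intro k
    simp only [hM, Matrix.smul_apply, Matrix.add_apply, Matrix.single_apply, smul_eq_mul]
    by_cases h1 : i = k <;> by_cases h2 : j = k <;> simp [h1, h2] <;> grind
  have hS : SmoothForms Set.univ (fun _ : ℝ => (1 : Matrix (Fin 3) (Fin 3) ℝ))
      (fun s : ℝ => Matrix.diagonal lam + s • M) :=
    { isOpen := isOpen_univ
      contDiffOn_left := fun i j => contDiffOn_const
      contDiffOn_right := fun i j => by
        simp only [Matrix.add_apply, Matrix.smul_apply]
        fun_prop
      posDef := fun _ _ => Matrix.PosDef.one
      symm := fun s _ => by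
        simp [hM, Matrix.transpose_add, Matrix.transpose_single, add_comm] }
  have h1 := hS.dirD_ofForms (Set.mem_univ 0) (lam := lam)
    (by simpa using isDiag_one_diagonal lam) (by simp) hlam hF 1
  have h2 : ∀ k, dirD (1 : ℝ) (fun s : ℝ => ((1 : Matrix (Fin 3) (Fin 3) ℝ)⁻¹
      * (Matrix.diagonal lam + s • M)) k k) 0 = M k k := by
    intro k
    have : (fun s : ℝ => ((1 : Matrix (Fin 3) (Fin 3) ℝ)⁻¹
      * (Matrix.diagonal lam + s • M)) k k) = fun s => lam k + s * M k k := by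
      funext s
      simp
    rw [this, dirD]
    simp
  refine h1.trans ?_
  simp only [h2, hMk]
  by_cases hij : i = j <;> simp [hij]

/-! ### Evolution of the geometry under the flow -/

namespace IsFlow

variable {F : Coord → ℝ} {J : Set ℝ} {U : Set Coord} {X ν : ℝ → Coord → Ambient} {t : ℝ}
  {x : Coord} {lam : Coord}

lemma isHypersurface (hX : IsFlow F J U X ν) (ht : t ∈ J) : IsHypersurface U (X t) (ν t) where
  isOpen := hX.isOpen_space
  smooth := contDiffOn_slice_space hX.smooth ht
  smooth_normal := contDiffOn_slice_space hX.smooth_normal ht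
  posDef y hy := Matrix.posDef_gram_of_linearIndependent (hX.immersion t ht y hy)
  unit y hy := by rw [real_inner_self_eq_norm_sq, hX.unit t ht y hy, one_pow]
  normal := hX.normal t ht

lemma mem_posCone (hX : IsFlow F J U X ν) (ht : t ∈ J) (hx : x ∈ U)
    (hg : metric (X t) x = 1) (hh : secondForm (X t) (ν t) x = .diagonal lam) :
    lam ∈ posCone := by
  have h1 := hX.convex t ht x hx
  rw [hg, hh] at h1
  obtain ⟨σ, hσ⟩ := (isDiag_one_diagonal lam).principalCurvatures_eq
  rw [hσ] at h1
  intro i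
  simpa using h1 (σ.symm i)

lemma smoothForms_time (hX : IsFlow F J U X ν) (hx : x ∈ U) :
    SmoothForms J (fun s => metric (X s) x) (fun s => secondForm (X s) (ν s) x) where
  isOpen := hX.isOpen_time
  contDiffOn_left i j := by
    have h := fun i => contDiffOn_slice_time (u := fun s y => pd i (X s) y)
      (contDiffOn_pd_slice hX.isOpen_time hX.isOpen_space hX.smooth i) hx
    exact (h i).inner ℝ (h j)
  contDiffOn_right i j := by
    have h1 := contDiffOn_pd_slice hX.isOpen_time hX.isOpen_space hX.smooth i
    have h2 := contDiffOn_slice_time (u := fun s y => pd j (pd i (X s)) y)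
      (contDiffOn_pd_slice (u := fun s y => pd i (X s) y) hX.isOpen_time hX.isOpen_space h1 j) hx
    exact (h2.inner ℝ (contDiffOn_slice_time hX.smooth_normal hx)).neg
  posDef s hs := (hX.isHypersurface hs).posDef x hx
  symm s hs := (hX.isHypersurface hs).smoothForms.symm x hx

/-- Although `F` is only `C²`, the speed along the surface equals `-⟨∂ₜX, ν⟩`, which inherits the
smoothness of the flow. -/
lemma contDiffOn_speed (hX : IsFlow F J U X ν) (ht : t ∈ J) :
    ContDiffOn ℝ ∞ (onSurface F (X t) (ν t)) U := by
  have hW := hX.isOpen_time.prod hX.isOpen_space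
  have h1 := contDiffOn_slice_space (t := t)
    (u := fun s y => dirD ((1, 0) : ℝ × Coord) (fun p : ℝ × Coord => X p.1 p.2) (s, y))
    (contDiffOn_dirD hW hX.smooth) ht
  refine (h1.inner ℝ (contDiffOn_slice_space hX.smooth_normal ht)).neg.congr fun y hy => ?_
  have h2 := (hX.evolution t ht y hy).unique
    (hasDerivAt_slice (differentiableAt_of_contDiffOn hW hX.smooth ⟨ht, hy⟩))
  rw [← h2, inner_smul_left, real_inner_self_eq_norm_sq, hX.unit t ht y hy]
  simp

/-- The evolution equation of the diagonal entries of the shape operator. -/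
lemma dirD_shape (hX : IsFlow F J U X ν) (ht : t ∈ J) (hx : x ∈ U)
    (hg : metric (X t) x = 1) (hh : secondForm (X t) (ν t) x = .diagonal lam) (i : Fin 3) :
    dirD (1 : ℝ) (fun s => ((metric (X s) x)⁻¹ * secondForm (X s) (ν s) x) i i) t
      = hessianCov (X t) (onSurface F (X t) (ν t)) i i x
        + onSurface F (X t) (ν t) x * lam i ^ 2 := by
  have H := hX.isHypersurface ht
  have hJ := hX.isOpen_time
  have hU := hX.isOpen_space
  have hS := hX.smoothForms_time hx
  set φ := onSurface F (X t) (ν t) with hφ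
  have hφs : ContDiffOn ℝ ∞ φ U := hX.contDiffOn_speed ht
  set Z : Coord → Ambient := fun y => -(φ y • ν t y) with hZdef
  have hZ : ∀ y ∈ U, HasDerivAt (fun s => X s y) (Z y) t := by
    intro y hy
    have := hX.evolution t ht y hy
    rwa [neg_smul] at this
  have hX1 : ∀ i, ∀ y ∈ U, HasDerivAt (fun s => pd i (X s) y) (pd i Z y) t := fun i y hy =>
    hasDerivAt_pd_slice hJ hU hX.smooth ht hy hZ i
  have hX2 : HasDerivAt (fun s => pd i (pd i (X s)) x) (pd i (pd i Z) x) t :=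
    hasDerivAt_pd_slice (u := fun s y => pd i (X s) y) hJ hU
      (contDiffOn_pd_slice hJ hU hX.smooth i) ht hx (hX1 i) i
  have hν := hasDerivAt_slice (u := ν) (differentiableAt_of_contDiffOn (hJ.prod hU)
    hX.smooth_normal (⟨ht, hx⟩ : (t, x) ∈ J ×ˢ U))
  set ν' := dirD ((1, 0) : ℝ × Coord) (fun p : ℝ × Coord => ν p.1 p.2) (t, x)
  have hZ1 : ∀ i, pd i Z x = -(pd i φ x • ν t x + φ x • pd i (ν t) x) := by
    intro i
    rw [hZdef, pd_eq_dirD, dirD_neg, dirD_smul (differentiableAt_of_contDiffOn hU hφs hx)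
      (differentiableAt_of_contDiffOn hU H.smooth_normal hx)]
    rfl
  have hZ2 : pd i (pd i Z) x = -(pd i (pd i φ) x • ν t x + pd i φ x • pd i (ν t) x
      + (pd i φ x • pd i (ν t) x + φ x • pd i (pd i (ν t)) x)) := by
    have h1 := dirD₂_smul (v := Pi.single i 1) (w := Pi.single i 1) hU hx hφs H.smooth_normal
    have h2 : pd i Z = fun y => -pd i (fun y => φ y • ν t y) y := by
      funext y
      exact dirD_neg
    rw [h2, pd_eq_dirD, dirD_neg]
    simp only [← pd_eq_dirD] at h1
    rw [← pd_eq_dirD, h1]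
  have hνν : inner ℝ (ν t x) (ν t x) = (1 : ℝ) := H.unit x hx
  have hν'ν : inner ℝ ν' (ν t x) = (0 : ℝ) := by
    have h1 := hν.inner ℝ hν
    have h2 : (fun s => inner ℝ (ν s x) (ν s x)) =ᶠ[𝓝 t] fun _ => (1 : ℝ) := by
      filter_upwards [hJ.mem_nhds ht] with s hs using (hX.isHypersurface hs).unit x hx
    have h3 := h1.unique ((hasDerivAt_const t (1 : ℝ)).congr_of_eventuallyEq h2)
    rw [real_inner_comm ν'] at h3
    linarith
  -- Together with `hν'ν` this says that `∂ₜν` is the tangential gradient of the speed.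
  have hν'X : ∀ k, inner ℝ ν' (pd k (X t) x) = pd k φ x := by
    intro k
    have h1 := (hX1 k x hx).inner ℝ hν
    have h2 : (fun s => inner ℝ (pd k (X s) x) (ν s x)) =ᶠ[𝓝 t] fun _ => (0 : ℝ) := by
      filter_upwards [hJ.mem_nhds ht] with s hs using (hX.isHypersurface hs).normal x hx k
    have h3 := h1.unique ((hasDerivAt_const t (0 : ℝ)).congr_of_eventuallyEq h2)
    rw [hZ1, real_inner_comm ν', inner_neg_left, inner_add_left, inner_smul_left, inner_smul_left,
      H.inner_pd_normal k x hx, hνν] at h3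
    simp at h3
    linarith
  have hgt : ∀ l, HasDerivAt (fun s => metric (X s) x i l)
      (-2 * φ x * secondForm (X t) (ν t) x i l) t := by
    intro l
    refine ((hX1 i x hx).inner ℝ (hX1 l x hx)).congr_deriv ?_
    have h1 : ∀ k m, inner ℝ (pd k Z x) (pd m (X t) x)
        = -φ x * secondForm (X t) (ν t) x m k := by
      intro k m
      rw [hZ1, inner_neg_left, inner_add_left, inner_smul_left, inner_smul_left,
        H.inner_pd_pd_normal m k x hx, real_inner_comm, H.normal x hx m]
      simp
    rw [real_inner_comm, h1, h1, hh]
    by_cases h : i = l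
    · subst h; ring
    · simp [h, Ne.symm h]
  have hht : HasDerivAt (fun s => secondForm (X s) (ν s) x i i)
      (hessianCov (X t) φ i i x - φ x * lam i ^ 2) t := by
    refine (hX2.inner ℝ hν).neg.congr_deriv ?_
    -- The tangential part of `X_{,ii}` paired with the gradient of the speed is the Christoffel
    -- term of the covariant Hessian.
    have h1 : inner ℝ (pd i (pd i (X t)) x) ν' = ∑ k, christoffel (X t) k i i x * pd k φ x := by
      rw [H.inner_eq_sum hx hg, hν'ν]
      simp only [hν'X, H.christoffel_eq hx hg, mul_zero, add_zero]
    rw [h1, hZ2, inner_neg_left]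
    simp only [inner_add_left, inner_smul_left, H.inner_pd_normal i x hx,
      H.inner_pd₂_normal i hx, H.inner_pd_normal_self hx hg hh, hνν, hessianCov]
    simp
    ring
  have hA := fun k => (differentiableAt_of_contDiffOn hJ (hS.contDiffOn_inv_mul k i) ht).hasDerivAt
  have hprod : HasDerivAt (fun s => ∑ l, metric (X s) x i l
      * ((metric (X s) x)⁻¹ * secondForm (X s) (ν s) x) l i) _ t :=
    HasDerivAt.fun_sum fun l _ => (hgt l).mul (hA l)
  -- Differentiating `h = gA` avoids the inverse metric: `-F λ²` from `∂ₜh` and `+2F λ²` from `∂ₜg`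
  -- combine to `+F λ²`.
  have heq : (fun s => secondForm (X s) (ν s) x i i) =ᶠ[𝓝 t] fun s => ∑ l, metric (X s) x i l
      * ((metric (X s) x)⁻¹ * secondForm (X s) (ν s) x) l i := by
    filter_upwards [hJ.mem_nhds ht] with s hs
    have hu : IsUnit (metric (X s) x).det :=
      isUnit_iff_ne_zero.2 (hS.posDef s hs).det_pos.ne'
    rw [← Matrix.mul_apply, Matrix.mul_nonsing_inv_cancel_left _ _ hu]
  have key := hht.unique (hprod.congr_of_eventuallyEq heq)
  simp only [hg, hh, inv_one, one_mul, Matrix.one_apply, Matrix.diagonal_apply,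
    Finset.sum_add_distrib] at key
  simp at key
  change deriv _ t = _
  linarith

/-- The time derivative of a function of the principal curvatures. -/
lemma deriv_onSurface (hX : IsFlow F J U X ν) (ht : t ∈ J) (hx : x ∈ U)
    (hg : metric (X t) x = 1) (hh : secondForm (X t) (ν t) x = .diagonal lam)
    {w : Coord → ℝ} (hw : IsCurvatureFunction w) :
    deriv (fun s => onSurface w (X s) (ν s) x) t
      = ∑ k, pd k w lam * (hessianCov (X t) (onSurface F (X t) (ν t)) k k x
        + onSurface F (X t) (ν t) x * lam k ^ 2) := by
  have h1 := (hX.smoothForms_time hx).dirD_ofForms ht (lam := lam)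
    (by rw [hg, hh]; exact isDiag_one_diagonal lam) (by rw [hg, hh]; simp)
    (hX.mem_posCone ht hx hg hh) hw 1
  simp only [hX.dirD_shape ht hx hg hh] at h1
  exact h1

end IsFlow

/-! ### Quotients with limits, and the quadratic forms of part (ii) -/

section Quotients

variable {F w : Coord → ℝ} {lam : Coord}

lemma IsCurvatureFunction.continuousAt_pd (hF : IsCurvatureFunction F) (hlam : lam ∈ posCone)
    (i : Fin 3) : ContinuousAt (pd i F) lam :=
  (differentiableAt_pd (hF.contDiffAt hlam) i).continuousAt

lemma termE_eq (hF : IsCurvatureFunction F) (hw : IsCurvatureFunction w) (hlam : lam ∈ posCone) :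
    termE F w lam = 2 * (pd 2 w lam * diffQuot 0 1 F lam - pd 2 F lam * diffQuot 0 1 w lam
      + (pd 1 w lam * diffQuot 0 2 F lam - pd 1 F lam * diffQuot 0 2 w lam)
      + (pd 0 w lam * diffQuot 1 2 F lam - pd 0 F lam * diffQuot 1 2 w lam)) := by
  have h := fun {i j : Fin 3} (hij : i ≠ j) (k : Fin 3) =>
    quot_mul_sub_mul hF hw hlam hij (hw.continuousAt_pd hlam k) (hF.continuousAt_pd hlam k)
  rw [termE, h (by decide), h (by decide), h (by decide)]

/-- Adding and subtracting `F_i w_i` in the numerator exhibits it as a combination of differences;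
with `F_j w_j` one gets `crossQuot_eq_right`. Which version is needed depends on the index of the
gradient component that is not eliminated. -/
lemma crossQuot_eq_left (hF : IsCurvatureFunction F) (hw : IsCurvatureFunction w)
    (hlam : lam ∈ posCone) {i j : Fin 3} (hij : i ≠ j) :
    crossQuot i j F w lam
      = pd i w lam * diffQuot i j F lam - pd i F lam * diffQuot i j w lam := by
  rw [← quot_mul_sub_mul hF hw hlam hij (hw.continuousAt_pd hlam i) (hF.continuousAt_pd hlam i),
    crossQuot]
  congr 1
  funext μ
  ring

lemma crossQuot_eq_right (hF : IsCurvatureFunction F) (hw : IsCurvatureFunction w)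
    (hlam : lam ∈ posCone) {i j : Fin 3} (hij : i ≠ j) :
    crossQuot i j F w lam
      = pd j w lam * diffQuot i j F lam - pd j F lam * diffQuot i j w lam := by
  rw [← quot_mul_sub_mul hF hw hlam hij (hw.continuousAt_pd hlam j) (hF.continuousAt_pd hlam j),
    crossQuot]
  congr 1
  funext μ
  ring

end Quotients

section QuadraticForms

variable {F w : Coord → ℝ} {lam : Coord}

lemma termR_eq_mulVec (hF : IsCurvatureFunction F) (hw : IsCurvatureFunction w)
    (hlam : lam ∈ posCone) (h : pd 0 w lam ≠ 0) (q r : ℝ) :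
    termR F w lam (-(1 / pd 0 w lam) * (pd 1 w lam * q + pd 2 w lam * r)) q r
      = dotProduct ![q, r] (Matrix.mulVec (matR F w lam) ![q, r]) := by
  simp only [termR, matR, hessForm, crossQuot_eq_right hF hw hlam (show (0 : Fin 3) ≠ 1 by decide),
    crossQuot_eq_right hF hw hlam (show (0 : Fin 3) ≠ 2 by decide), Matrix.mulVec, dotProduct,
    Fin.sum_univ_two, Matrix.of_apply, Matrix.cons_val_zero, Matrix.cons_val_one]
  field_simp
  ring

lemma termS_eq_mulVec (hF : IsCurvatureFunction F) (hw : IsCurvatureFunction w)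
    (hlam : lam ∈ posCone) (h : pd 1 w lam ≠ 0) (p r : ℝ) :
    termS F w lam p (-(1 / pd 1 w lam) * (pd 0 w lam * p + pd 2 w lam * r)) r
      = dotProduct ![p, r] (Matrix.mulVec (matS F w lam) ![p, r]) := by
  simp only [termS, matS, hessForm, crossQuot_eq_left hF hw hlam (show (0 : Fin 3) ≠ 1 by decide),
    crossQuot_eq_right hF hw hlam (show (1 : Fin 3) ≠ 2 by decide), Matrix.mulVec, dotProduct,
    Fin.sum_univ_two, Matrix.of_apply, Matrix.cons_val_zero, Matrix.cons_val_one]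
  field_simp
  ring

lemma termT_eq_mulVec (hF : IsCurvatureFunction F) (hw : IsCurvatureFunction w)
    (hlam : lam ∈ posCone) (h : pd 2 w lam ≠ 0) (p q : ℝ) :
    termT F w lam p q (-(1 / pd 2 w lam) * (pd 0 w lam * p + pd 1 w lam * q))
      = dotProduct ![p, q] (Matrix.mulVec (matT F w lam) ![p, q]) := by
  simp only [termT, matT, hessForm, crossQuot_eq_left hF hw hlam (show (0 : Fin 3) ≠ 2 by decide),
    crossQuot_eq_left hF hw hlam (show (1 : Fin 3) ≠ 2 by decide), Matrix.mulVec, dotProduct,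
    Fin.sum_univ_two, Matrix.of_apply, Matrix.cons_val_zero, Matrix.cons_val_one]
  field_simp
  ring

end QuadraticForms

/-! ### The evolution equation of `w` -/

section Evolution

variable {F w : Coord → ℝ} {J : Set ℝ} {U : Set Coord} {X ν : ℝ → Coord → Ambient}
  {t : ℝ} {x lam : Coord}

lemma IsFlow.linOp_eq (hX : IsFlow F J U X ν) (hF : IsCurvatureFunction F)
    (hw : IsCurvatureFunction w) (ht : t ∈ J) (hx : x ∈ U)
    (hg : metric (X t) x = 1) (hh : secondForm (X t) (ν t) x = .diagonal lam) :
    linOp F w X ν t x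
      = ∑ k, (pd k w lam * (hessianCov (X t) (onSurface F (X t) (ν t)) k k x + F lam * lam k ^ 2)
        - pd k F lam * hessianCov (X t) (onSurface w (X t) (ν t)) k k x) := by
  have hlam := hX.mem_posCone ht hx hg hh
  have hFx : onSurface F (X t) (ν t) x = F lam := by
    rw [onSurface, hg, hh]
    exact (isDiag_one_diagonal lam).ofForms_eq hF.symm hlam
  rw [linOp, hX.deriv_onSurface ht hx hg hh hw, hFx, hg, hh, Finset.sum_sub_distrib]
  simp only [derivForm_one_diagonal hF hlam, ite_mul, zero_mul, Finset.sum_ite_eq,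
    Finset.mem_univ, if_true]

/-- The first covariant derivatives of a function of the principal curvatures. -/
lemma IsFlow.sum_pd_mul_secondFormCov (hX : IsFlow F J U X ν) (hw : IsCurvatureFunction w)
    (ht : t ∈ J) (hx : x ∈ U) (hg : metric (X t) x = 1)
    (hh : secondForm (X t) (ν t) x = .diagonal lam) (i : Fin 3) :
    pd i (onSurface w (X t) (ν t)) x
      = ∑ k, pd k w lam * secondFormCov (X t) (ν t) k k i x := by
  obtain ⟨C, D, hC, -, -, -, hj⟩ :=
    (hX.isHypersurface ht).exists_covariant_jet hx hg hh (hX.mem_posCone ht hx hg hh)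
  simp only [(hj w hw).1, hC]

/-- The evolution equation of a function of the principal curvatures, written in terms of the
covariant derivatives of the second fundamental form. -/
lemma IsFlow.linOp_eq_terms (hX : IsFlow F J U X ν) (hF : IsCurvatureFunction F)
    (hw : IsCurvatureFunction w) (ht : t ∈ J) (hx : x ∈ U)
    (hg : metric (X t) x = 1) (hh : secondForm (X t) (ν t) x = .diagonal lam) :
    let C := fun i j k => secondFormCov (X t) (ν t) i j k x
    linOp F w X ν t x = termC F w lam + termE F w lam * C 0 1 2 ^ 2
      + termR F w lam (C 0 0 0) (C 1 1 0) (C 2 2 0)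
      + termS F w lam (C 0 0 1) (C 1 1 1) (C 2 2 1)
      + termT F w lam (C 0 0 2) (C 1 1 2) (C 2 2 2) := by
  have hlam := hX.mem_posCone ht hx hg hh
  obtain ⟨C, D, hC, hC1, hC2, hD, hj⟩ := (hX.isHypersurface ht).exists_covariant_jet hx hg hh hlam
  simp only [hX.linOp_eq hF hw ht hx hg hh, ← hC, (hj F hF).2, (hj w hw).2, termE_eq hF hw hlam,
    termR, termS, termT, termC, Fin.sum_univ_three]
  -- Total symmetry of `C`: components with a repeated index become `C k k i`, entering `termR`,
  -- `termS` and `termT`, while those with three distinct indices all equal `C 0 1 2`.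
  rw [show C 0 1 0 = C 0 0 1 from hC2 _ _ _, show C 0 2 0 = C 0 0 2 from hC2 _ _ _,
    show C 0 1 1 = C 1 1 0 by rw [hC1, hC2], show C 0 2 2 = C 2 2 0 by rw [hC1, hC2],
    show C 1 2 1 = C 1 1 2 from hC2 _ _ _, show C 1 2 2 = C 2 2 1 by rw [hC1, hC2],
    show C 0 2 1 = C 0 1 2 from hC2 _ _ _, show C 1 2 0 = C 0 1 2 by rw [hC2, hC1]]
  -- What is left is `w_k F_l - F_k w_l` times `D l k - D k l` for `k < l`; the commutator identity
  -- `hD` turns these into the part of `termC` without the factor `F lam`.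
  linear_combination (pd 0 w lam * pd 1 F lam - pd 0 F lam * pd 1 w lam) * hD 0 1
    + (pd 0 w lam * pd 2 F lam - pd 0 F lam * pd 2 w lam) * hD 0 2
    + (pd 1 w lam * pd 2 F lam - pd 1 F lam * pd 2 w lam) * hD 1 2

end Evolution

end CurvatureFlow

end

theorem lemma4p4
    (F w : (Fin 3 → ℝ) → ℝ)
    (hF : CurvatureFlow.IsCurvatureFunction F)
    (hw : CurvatureFlow.IsCurvatureFunction w)
    (J : Set ℝ) (U : Set (Fin 3 → ℝ))
    (X ν : ℝ → (Fin 3 → ℝ) → EuclideanSpace ℝ (Fin 4))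
    (hX : CurvatureFlow.IsFlow F J U X ν)
    (t : ℝ) (ht : t ∈ J) (x : Fin 3 → ℝ) (hx : x ∈ U)
    (hcrit : ∀ i, CurvatureFlow.pd i (CurvatureFlow.onSurface w (X t) (ν t)) x = 0)
    (lam : Fin 3 → ℝ)
    (hg : CurvatureFlow.metric (X t) x = 1)
    (hh : CurvatureFlow.secondForm (X t) (ν t) x = Matrix.diagonal lam)
    (h' : Fin 3 → Fin 3 → Fin 3 → ℝ)
    (hh' : ∀ i j k, h' i j k = CurvatureFlow.secondFormCov (X t) (ν t) i j k x) :
    CurvatureFlow.linOp F w X ν t x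
        = CurvatureFlow.termC F w lam
          + CurvatureFlow.termE F w lam * h' 0 1 2 ^ 2
          + CurvatureFlow.termR F w lam (h' 0 0 0) (h' 1 1 0) (h' 2 2 0)
          + CurvatureFlow.termS F w lam (h' 0 0 1) (h' 1 1 1) (h' 2 2 1)
          + CurvatureFlow.termT F w lam (h' 0 0 2) (h' 1 1 2) (h' 2 2 2)
    ∧ (CurvatureFlow.pd 0 w lam ≠ 0 →
        h' 0 0 0 = -(1 / CurvatureFlow.pd 0 w lam)
          * (CurvatureFlow.pd 1 w lam * h' 1 1 0 + CurvatureFlow.pd 2 w lam * h' 2 2 0)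
        ∧ CurvatureFlow.termR F w lam (h' 0 0 0) (h' 1 1 0) (h' 2 2 0)
          = dotProduct ![h' 1 1 0, h' 2 2 0]
              (Matrix.mulVec (CurvatureFlow.matR F w lam) ![h' 1 1 0, h' 2 2 0]))
    ∧ (CurvatureFlow.pd 1 w lam ≠ 0 →
        h' 1 1 1 = -(1 / CurvatureFlow.pd 1 w lam)
          * (CurvatureFlow.pd 0 w lam * h' 0 0 1 + CurvatureFlow.pd 2 w lam * h' 2 2 1)
        ∧ CurvatureFlow.termS F w lam (h' 0 0 1) (h' 1 1 1) (h' 2 2 1)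
          = dotProduct ![h' 0 0 1, h' 2 2 1]
              (Matrix.mulVec (CurvatureFlow.matS F w lam) ![h' 0 0 1, h' 2 2 1]))
    ∧ (CurvatureFlow.pd 2 w lam ≠ 0 →
        h' 2 2 2 = -(1 / CurvatureFlow.pd 2 w lam)
          * (CurvatureFlow.pd 0 w lam * h' 0 0 2 + CurvatureFlow.pd 1 w lam * h' 1 1 2)
        ∧ CurvatureFlow.termT F w lam (h' 0 0 2) (h' 1 1 2) (h' 2 2 2)
          = dotProduct ![h' 0 0 2, h' 1 1 2]
              (Matrix.mulVec (CurvatureFlow.matT F w lam) ![h' 0 0 2, h' 1 1 2])) := by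
  have hlam := hX.mem_posCone ht hx hg hh
  obtain rfl : h' = fun i j k => CurvatureFlow.secondFormCov (X t) (ν t) i j k x := by
    ext i j k
    exact hh' i j k
  -- Criticality reads `∑ₖ w_k h_{kk;i} = 0`; for each `i` it is solved for the component
  -- `h_{ii;i}`.
  have hcrit' := fun i => (hX.sum_pd_mul_secondFormCov hw ht hx hg hh i).symm.trans (hcrit i)
  simp only [Fin.sum_univ_three] at hcrit'
  refine ⟨hX.linOp_eq_terms hF hw ht hx hg hh, fun h => ?_, fun h => ?_, fun h => ?_⟩
  · have h1 := CurvatureFlow.termR_eq_mulVec hF hw hlam h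
    refine (fun hp => ⟨hp, ?_⟩ : _ → _ ∧ _) ?_
    · rw [hp, h1]
    · have := hcrit' 0
      field_simp
      linarith
  · have h1 := CurvatureFlow.termS_eq_mulVec hF hw hlam h
    refine (fun hp => ⟨hp, ?_⟩ : _ → _ ∧ _) ?_
    · rw [hp, h1]
    · have := hcrit' 1
      field_simp
      linarith
  · have h1 := CurvatureFlow.termT_eq_mulVec hF hw hlam h
    refine (fun hp => ⟨hp, ?_⟩ : _ → _ ∧ _) ?_
    · rw [hp, h1]
    · have := hcrit' 2
      field_simp
      linarith
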